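/- Let $\Omega\subset\mathbb R^3$ be a bounded Lipschitz domain and $\Gamma_D\subset\partial\Omega$ closed and nonempty such that $\Omega\cup\Gamma_D$ is regular in the sense of Gröger: each $x\in\partial\Omega$ has an open neighbourhood $U$ and a bi-Lipschitz map $\phi$ from $U$ onto a scaled open cube $aK$, $K$ the open unit cube centred at $0$, with $\phi(x)=0$, such that $\phi((\Omega\cup\Gamma_D)\cap U)$ is $aK_-$, $a(K_-\cup\Sigma_K)$ or $a(K_-\cup\Sigma_K^0)$, where $K_-=K\cap\{y_3<0\}$, $\Sigma_K=K\cap\{y_3=0\}$, $\Sigma_K^0=\Sigma_K\cap\{y_2\le0\}$. ("Lipschitz domain" is meant as this condition with $\emptyset$ in place of $\Gamma_D$.) Let $\omega$ be the surface measure on $\partial\Omega$, $T_0<T_1$, $J=(T_0,T_1)$ and $\Sigma=\partial\Omega\times J$. For $p\in(1,\infty)$ let $W^{1,p}$ be the Sobolev space on $\Omega$, and $W^{1,p}_{\Gamma_D}$ the closure in it of the restrictions to $\Omega$ of all $\psi\in C_c^\infty(\mathbb R^3)$ with $\operatorname{supp}\psi\cap\Gamma_D=\emptyset$; for $1/q+1/q'=1$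 let $W^{-1,q}_\emptyset$ and $W^{-1,q}_{\Gamma_D}$ be the duals of $W^{1,q'}$ and $W^{1,q'}_{\Gamma_D}$. $W^{1,q}$ is embedded in $W^{-1,q}_\emptyset$ through the $L^2$ scalar product. Assume: $\sigma,\eta:\mathbb R\to(0,\infty)$ are Lipschitz continuous on bounded intervals; $\varepsilon,\kappa\in L^\infty(\Omega;\mathbb R^{3\times3})$ are symmetric and uniformly elliptic; $\theta_l\in L^\infty(\Sigma)$; $\alpha\in L^\infty(\partial\Omega)$, $\alpha\ge0$ a.e., $\int_{\partial\Omega}\alpha\,d\omega>0$; $q\in(3,4)$ is such that $-\nabla\cdot\varepsilon\nabla:W^{1,q}_{\Gamma_D}\to W^{-1,q}_{\Gamma_D}$ and $-\nabla\cdot\kappa\nabla+1:W^{1,q}\to W^{-1,q}_\emptyset$ are topological isomorphisms; $\frac{2q}{q-3}<r<\infty$; $u\in L^{2r}(J;W^{-1,q}_{\Gamma_D})$; and $\theta_0$ lies in the real interpolation space $(W^{1,q},W^{-1,q}_\emptyset)_{1/r,r}$. Let $T_\bullet\in(T_0,T_1]$ and let $(\theta,\varphi)$ be a (local) solution of the thermistor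 problem on $(T_0,T_\bullet)$, that is, $\theta\in W^{1,r}(T_0,T_\bullet;W^{-1,q}_\emptyset)\cap L^r(T_0,T_\bullet;W^{1,q})$ and $\varphi\in L^{2r}(T_0,T_\bullet;W^{1,q}_{\Gamma_D})$ satisfy $\theta(T_0)=\theta_0$ and, for almost all $t\in(T_0,T_\bullet)$, $$\langle\theta'(t),\xi\rangle+\int_\Omega\eta(\theta(t))\kappa\nabla\theta(t)\cdot\nabla\xi\,dx+\int_{\partial\Omega}\alpha\,\theta(t)\,\xi\,d\omega=\int_\Omega(\sigma(\theta(t))\varepsilon\nabla\varphi(t)\cdot\nabla\varphi(t))\,\xi\,dx+\int_{\partial\Omega}\alpha\,\theta_l(t)\,\xi\,d\omega\quad\text{for all }\xi\in W^{1,q'},$$ $$\int_\Omega\sigma(\theta(t))\varepsilon\nabla\varphi(t)\cdot\nabla\xi\,dx=\langle u(t),\xi\rangle\quad\text{for all }\xi\in W^{1,q'}_{\Gamma_D}.$$ (Such a solution exists exactly for the $T_\bullet$ in the maximal interval of existence, where the right end point $T_1$ is included if there is a solution on all of $J$ in this class.) Then $\theta$ has a representative that is continuous on $\overline\Omega\times[T_0,T_\bullet]$,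 $\theta_0$ is represented by its value at $T_0$, a continuous function on $\overline\Omega$, and for this representative $$\theta(x,t)\ \ge\ \min\Bigl(\operatorname*{ess\,inf}_{\Sigma}\theta_l,\ \min_{\overline\Omega}\theta_0\Bigr)\qquad\text{for all }(x,t)\in\overline\Omega\times[T_0,T_\bullet].$$ -/

import Mathlib

open MeasureTheory Set Filter Topology
open scoped ENNReal NNReal ContDiff

noncomputable section

namespace Thermistor

/-- Three-dimensional Euclidean space. -/
abbrev E3 : Type := EuclideanSpace ℝ (Fin 3)

/-! ### Geometry -/

/-- The open cube of side length `a` centered at the origin. -/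
def cube (a : ℝ) : Set E3 := {y | ∀ i, |y i| < a / 2}

/-- The lower half of the open cube. -/
def lowerCube (a : ℝ) : Set E3 := {y | y ∈ cube a ∧ y 2 < 0}

/-- The upper plate of the lower half cube. -/
def plate (a : ℝ) : Set E3 := {y | y ∈ cube a ∧ y 2 = 0}

/-- The left half of the upper plate, with its dividing line. -/
def halfPlate (a : ℝ) : Set E3 := {y | y ∈ cube a ∧ y 2 = 0 ∧ y 1 ≤ 0}

/-- `Ω ∪ Ξ` is regular in the sense of Gröger: each boundary point `x` of `Ω` has an open
neighbourhood `U` and a bi-Lipschitz map `φ` of `U` onto a cube with `φ x = 0` which maps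
`(Ω ∪ Ξ) ∩ U` onto the lower half cube, without upper plate, with the whole upper plate, or with
half of it. For `Ξ = ∅` this is the definition of a (weak) Lipschitz domain. -/
def IsGroegerRegular (Ω Ξ : Set E3) : Prop :=
  ∀ x ∈ frontier Ω, ∃ (U : Set E3) (a : ℝ) (φ : E3 → E3) (L₁ L₂ : ℝ≥0),
    IsOpen U ∧ x ∈ U ∧ 0 < a ∧
    (∀ y ∈ U, ∀ z ∈ U, dist (φ y) (φ z) ≤ L₁ * dist y z) ∧
    (∀ y ∈ U, ∀ z ∈ U, dist y z ≤ L₂ * dist (φ y) (φ z)) ∧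
    φ '' U = cube a ∧ φ x = 0 ∧
    (φ '' ((Ω ∪ Ξ) ∩ U) = lowerCube a ∨
      φ '' ((Ω ∪ Ξ) ∩ U) = lowerCube a ∪ plate a ∨
      φ '' ((Ω ∪ Ξ) ∩ U) = lowerCube a ∪ halfPlate a)

/-- A bounded Lipschitz domain in three-dimensional space. -/
structure IsLipschitzDomain (Ω : Set E3) : Prop where
  isOpen : IsOpen Ω
  isConnected : IsConnected Ω
  isBounded : Bornology.IsBounded Ω
  lipschitz : IsGroegerRegular Ω ∅

/-- The boundary (surface) measure on `∂Ω`. Mathlib's Hausdorff measure is built from the sums of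
`diam ^ 2`, so the factor `π / 4` (the area of a disc of diameter one) makes it surface area. -/
def boundaryMeasure (Ω : Set E3) : Measure E3 :=
  ENNReal.ofReal (Real.pi / 4) • (μH[2] : Measure E3).restrict (frontier Ω)

/-! ### Sobolev spaces -/

/-- `g` is the weak gradient of `f` in `Ω`. -/
def HasWeakGradient (Ω : Set E3) (f : E3 → ℝ) (g : E3 → E3) : Prop :=
  ∀ ψ : E3 → ℝ, ContDiff ℝ ∞ ψ → HasCompactSupport ψ → tsupport ψ ⊆ Ω → ∀ v : E3,
    ∫ x in Ω, fderiv ℝ ψ x v * f x = - ∫ x in Ω, ψ x * inner ℝ (g x) v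

lemma integrable_fderiv_mul {Ω : Set E3} {p : ℝ≥0∞} (hp : 1 ≤ p) {f : E3 → ℝ}
    (hf : MemLp f p (volume.restrict Ω)) {ψ : E3 → ℝ} (hψ : ContDiff ℝ ∞ ψ)
    (hc : HasCompactSupport ψ) (v : E3) :
    Integrable (fun x => fderiv ℝ ψ x v * f x) (volume.restrict Ω) := by
  have h1 : Continuous (fun x => fderiv ℝ ψ x v) :=
    (hψ.continuous_fderiv (by simp)).clm_apply continuous_const
  have h2 : HasCompactSupport (fun x => fderiv ℝ ψ x v) := hc.fderiv_apply ℝ v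
  exact (hf.locallyIntegrable hp).integrable_smul_left_of_hasCompactSupport h1 h2

lemma integrable_mul_inner {Ω : Set E3} {p : ℝ≥0∞} (hp : 1 ≤ p) {g : E3 → E3}
    (hg : MemLp g p (volume.restrict Ω)) {ψ : E3 → ℝ} (hψ : ContDiff ℝ ∞ ψ)
    (hc : HasCompactSupport ψ) (v : E3) :
    Integrable (fun x => ψ x * inner ℝ (g x) v) (volume.restrict Ω) := by
  have h := ((hg.locallyIntegrable hp).integrable_smul_left_of_hasCompactSupport
    hψ.continuous hc).inner_const (𝕜 := ℝ) v
  simpa [real_inner_smul_left] using h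

/-- The pairs `(f, ∇f)` with `f ∈ L^p(Ω)` and weak gradient `∇f ∈ L^p(Ω)`, as a subspace of the
product space. -/
def sobolevSubmodule (Ω : Set E3) (p : ℝ≥0∞) [hp : Fact (1 ≤ p)] :
    Submodule ℝ (Lp ℝ p (volume.restrict Ω) × Lp E3 p (volume.restrict Ω)) where
  carrier := {w | HasWeakGradient Ω w.1 w.2}
  zero_mem' := by
    intro ψ hψ hc hs v
    have h1 : ∫ x in Ω, fderiv ℝ ψ x v * (0 : Lp ℝ p (volume.restrict Ω) × Lp E3 p (volume.restrict Ω)).1 x = 0 := by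
      refine integral_eq_zero_of_ae ?_
      filter_upwards [Lp.coeFn_zero ℝ p (volume.restrict Ω)] with x hx
      simp only [Prod.fst_zero, hx, Pi.zero_apply, mul_zero]
    have h2 : ∫ x in Ω, ψ x * inner ℝ
        ((0 : Lp ℝ p (volume.restrict Ω) × Lp E3 p (volume.restrict Ω)).2 x) v = 0 := by
      refine integral_eq_zero_of_ae ?_
      filter_upwards [Lp.coeFn_zero E3 p (volume.restrict Ω)] with x hx
      simp only [Prod.snd_zero, hx, Pi.zero_apply, inner_zero_left, mul_zero]
    rw [h1, h2, neg_zero]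
  add_mem' := by
    intro w z hw hz ψ hψ hc hs v
    have h1 : ∫ x in Ω, fderiv ℝ ψ x v * (w + z).1 x
        = ∫ x in Ω, (fderiv ℝ ψ x v * w.1 x + fderiv ℝ ψ x v * z.1 x) := by
      refine integral_congr_ae ?_
      filter_upwards [Lp.coeFn_add w.1 z.1] with x hx
      simp only [Prod.fst_add, hx, Pi.add_apply]; ring
    have h2 : ∫ x in Ω, ψ x * inner ℝ ((w + z).2 x) v
        = ∫ x in Ω, (ψ x * inner ℝ (w.2 x) v + ψ x * inner ℝ (z.2 x) v) := by
      refine integral_congr_ae ?_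
      filter_upwards [Lp.coeFn_add w.2 z.2] with x hx
      simp only [Prod.snd_add, hx, Pi.add_apply, inner_add_left]; ring
    rw [h1, h2, integral_add (integrable_fderiv_mul hp.out (Lp.memLp w.1) hψ hc v)
      (integrable_fderiv_mul hp.out (Lp.memLp z.1) hψ hc v),
      integral_add (integrable_mul_inner hp.out (Lp.memLp w.2) hψ hc v)
      (integrable_mul_inner hp.out (Lp.memLp z.2) hψ hc v), hw ψ hψ hc hs v, hz ψ hψ hc hs v]
    ring
  smul_mem' := by
    intro c w hw ψ hψ hc hs v
    have h1 : ∫ x in Ω, fderiv ℝ ψ x v * (c • w).1 x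
        = ∫ x in Ω, c * (fderiv ℝ ψ x v * w.1 x) := by
      refine integral_congr_ae ?_
      filter_upwards [Lp.coeFn_smul c w.1] with x hx
      simp only [Prod.smul_fst, hx, Pi.smul_apply, smul_eq_mul]; ring
    have h2 : ∫ x in Ω, ψ x * inner ℝ ((c • w).2 x) v
        = ∫ x in Ω, c * (ψ x * inner ℝ (w.2 x) v) := by
      refine integral_congr_ae ?_
      filter_upwards [Lp.coeFn_smul c w.2] with x hx
      simp only [Prod.smul_snd, hx, Pi.smul_apply, real_inner_smul_left]; ring
    rw [h1, h2, integral_const_mul, integral_const_mul, hw ψ hψ hc hs v]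
    ring

/-- The Sobolev space `W^{1,p}(Ω)`, each element being stored together with its weak gradient. Its
norm `max (‖f‖_{L^p}) (‖∇f‖_{L^p})` is equivalent to the usual one. -/
def W1 (Ω : Set E3) (p : ℝ≥0∞) [Fact (1 ≤ p)] : Type := sobolevSubmodule Ω p

instance (Ω : Set E3) (p : ℝ≥0∞) [Fact (1 ≤ p)] : NormedAddCommGroup (W1 Ω p) :=
  inferInstanceAs (NormedAddCommGroup (sobolevSubmodule Ω p))

instance (Ω : Set E3) (p : ℝ≥0∞) [Fact (1 ≤ p)] : NormedSpace ℝ (W1 Ω p) :=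
  inferInstanceAs (NormedSpace ℝ (sobolevSubmodule Ω p))

/-- The function underlying an element of `W^{1,p}(Ω)`. -/
def fn {Ω : Set E3} {p : ℝ≥0∞} [Fact (1 ≤ p)] (w : W1 Ω p) : E3 → ℝ := w.1.1

/-- The weak gradient of an element of `W^{1,p}(Ω)`. -/
def grad {Ω : Set E3} {p : ℝ≥0∞} [Fact (1 ≤ p)] (w : W1 Ω p) : E3 → E3 := w.1.2

/-- The restrictions to `Ω` of the functions `ψ ∈ C_c^∞(ℝ³)` whose support does not meet `Ξ`, as
elements of `W^{1,p}(Ω)`. -/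
def smoothRestrictions (Ω Ξ : Set E3) (p : ℝ≥0∞) [Fact (1 ≤ p)] : Submodule ℝ (W1 Ω p) where
  carrier := {w | ∃ ψ : E3 → ℝ, ContDiff ℝ ∞ ψ ∧ HasCompactSupport ψ ∧
    Disjoint (tsupport ψ) Ξ ∧ fn w =ᵐ[volume.restrict Ω] ψ}
  zero_mem' := by
    refine ⟨fun _ => 0, contDiff_const, HasCompactSupport.zero, ?_, ?_⟩
    · have : tsupport (fun _ : E3 => (0 : ℝ)) = ∅ := tsupport_eq_empty_iff.2 rfl
      rw [this]; exact Set.empty_disjoint Ξ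
    · exact Lp.coeFn_zero ℝ p (volume.restrict Ω)
  add_mem' := by
    rintro w z ⟨ψ, h1, h2, h3, h4⟩ ⟨χ, k1, k2, k3, k4⟩
    refine ⟨ψ + χ, h1.add k1, h2.add k2, ?_, ?_⟩
    · exact Set.disjoint_of_subset_left (tsupport_add ψ χ) (Set.disjoint_union_left.2 ⟨h3, k3⟩)
    · exact (Lp.coeFn_add w.1.1 z.1.1).trans (h4.add k4)
  smul_mem' := by
    rintro c w ⟨ψ, h1, h2, h3, h4⟩
    refine ⟨c • ψ, h1.const_smul c, h2.smul_left (f := fun _ => c), ?_, ?_⟩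
    · exact Set.disjoint_of_subset_left
        (closure_mono (Function.support_const_smul_subset c ψ)) h3
    · exact (Lp.coeFn_smul c w.1.1).trans (h4.const_smul c)

/-- The space `W^{1,p}_Ξ(Ω)`: the closure in `W^{1,p}(Ω)` of the restrictions of the functions
`ψ ∈ C_c^∞(ℝ³)` whose support does not meet `Ξ`. -/
def W1Zero (Ω Ξ : Set E3) (p : ℝ≥0∞) [Fact (1 ≤ p)] : Submodule ℝ (W1 Ω p) :=
  (smoothRestrictions Ω Ξ p).topologicalClosure

/-- The space `W^{-1,q}_∅(Ω)`, i.e. the dual of `W^{1,q'}(Ω)`; the argument is the conjugate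
exponent `q'`. -/
abbrev W1Dual (Ω : Set E3) (q' : ℝ≥0∞) [Fact (1 ≤ q')] : Type := StrongDual ℝ (W1 Ω q')

/-- The space `W^{-1,q}_Ξ(Ω)`, i.e. the dual of `W^{1,q'}_Ξ(Ω)`; the argument is the conjugate
exponent `q'`. -/
abbrev W1ZeroDual (Ω Ξ : Set E3) (q' : ℝ≥0∞) [Fact (1 ≤ q')] : Type :=
  StrongDual ℝ (W1Zero Ω Ξ q')

/-- `W^{1,p}(Ω) → L^p(Ω)`. -/
def W1.toLp (Ω : Set E3) (p : ℝ≥0∞) [Fact (1 ≤ p)] :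
    W1 Ω p →L[ℝ] Lp ℝ p (volume.restrict Ω) :=
  (ContinuousLinearMap.fst ℝ _ _).comp (sobolevSubmodule Ω p).subtypeL

/-- The embedding of `W^{1,q}(Ω)` into `W^{-1,q}_∅(Ω)` through the scalar product of `L²`. -/
def embed (Ω : Set E3) (q q' : ℝ≥0∞) [Fact (1 ≤ q)] [Fact (1 ≤ q')]
    [ENNReal.HolderConjugate q q'] : W1 Ω q →L[ℝ] W1Dual Ω q' :=
  ((ContinuousLinearMap.mul ℝ ℝ).lpPairing (volume.restrict Ω) q q').bilinearComp
    (W1.toLp Ω q) (W1.toLp Ω q')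

lemma embed_apply (Ω : Set E3) (q q' : ℝ≥0∞) [Fact (1 ≤ q)] [Fact (1 ≤ q')]
    [ENNReal.HolderConjugate q q'] (w : W1 Ω q) (ξ : W1 Ω q') :
    embed Ω q q' w ξ = ∫ x in Ω, fn w x * fn ξ x := by
  simp only [embed, ContinuousLinearMap.bilinearComp_apply,
    ContinuousLinearMap.lpPairing_eq_integral, ContinuousLinearMap.mul_apply']
  rfl

/-- The boundary trace of a function on `Ω`: at `x ∈ ∂Ω` it is the limit, as `ρ → 0`, of the mean
values of the function over `Ω ∩ B(x, ρ)`. For a function in `W^{1,p}(Ω)`, `p > 1`, on a Lipschitz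
domain this limit exists at almost every boundary point and is the usual trace; for a function that
is continuous up to the boundary it is the boundary value. -/
def trace (Ω : Set E3) (f : E3 → ℝ) (x : E3) : ℝ :=
  limUnder (𝓝[>] (0 : ℝ)) (fun ρ => ⨍ y in Ω ∩ Metric.ball x ρ, f y)

/-! ### Coefficients, interpolation, time derivatives -/

/-- `(A v) · w`. -/
def form (A : Matrix (Fin 3) (Fin 3) ℝ) (v w : E3) : ℝ := ∑ i, ∑ j, A i j * v j * w i

/-- `A ∈ L^∞(Ω; M_3)` takes symmetric matrices as values and is elliptic. -/
structure IsEllipticCoefficient (Ω : Set E3) (A : E3 → Matrix (Fin 3) (Fin 3) ℝ) : Prop where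
  memLp : ∀ i j, MemLp (fun x => A x i j) ⊤ (volume.restrict Ω)
  symm : ∀ᵐ x ∂volume.restrict Ω, (A x).IsSymm
  elliptic : ∃ c : ℝ, 0 < c ∧ ∀ ξ : E3, ∀ᵐ x ∂volume.restrict Ω, c * ‖ξ‖ ^ 2 ≤ form (A x) ξ ξ

/-- Positive and Lipschitz continuous on every bounded interval. -/
structure IsConductivity (f : ℝ → ℝ) : Prop where
  pos : ∀ s, 0 < f s
  lipschitz : ∀ R : ℝ, ∃ L : ℝ≥0, LipschitzOnWith L f (Icc (-R) R)

/-- Peetre's `K`-functional of the couple `(Y, X)`, where `Y` is embedded in `X` by `ι`. -/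
def kFunctional {X Y : Type*} [NormedAddCommGroup X] [NormedSpace ℝ X] [NormedAddCommGroup Y]
    [NormedSpace ℝ Y] (ι : Y →L[ℝ] X) (s : ℝ) (x : X) : ℝ :=
  ⨅ y : Y, (‖y‖ + s * ‖x - ι y‖)

/-- `x` lies in the real interpolation space `(Y, X)_{τ,r}`, where `Y` is embedded in `X` by `ι`
and `1 ≤ r < ∞`. -/
def MemRealInterpolation {X Y : Type*} [NormedAddCommGroup X] [NormedSpace ℝ X]
    [NormedAddCommGroup Y] [NormedSpace ℝ Y] (ι : Y →L[ℝ] X) (τ r : ℝ) (x : X) : Prop :=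
  ∫⁻ s in Ioi (0 : ℝ), ENNReal.ofReal ((s ^ (-τ) * kFunctional ι s x) ^ r / s) < ⊤

/-- `w'` is the derivative of `w` on the interval `(a, b)` in the sense of vector-valued
distributions. -/
def HasWeakTimeDeriv {X : Type*} [NormedAddCommGroup X] [NormedSpace ℝ X] (a b : ℝ)
    (w w' : ℝ → X) : Prop :=
  ∀ ψ : ℝ → ℝ, ContDiff ℝ ∞ ψ → HasCompactSupport ψ → tsupport ψ ⊆ Ioo a b →
    ∫ t in Ioo a b, deriv ψ t • w t = - ∫ t in Ioo a b, ψ t • w' t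

/-! ### The thermistor problem -/

/-- The data of the thermistor problem, in which `q'` is the exponent conjugate to `q`. -/
structure Data (q' : ℝ≥0∞) [Fact (1 ≤ q')] where
  /-- the domain -/
  Ω : Set E3
  /-- the Dirichlet part of the boundary -/
  ΓD : Set E3
  /-- initial time -/
  T₀ : ℝ
  /-- end time -/
  T₁ : ℝ
  /-- temperature dependence of the heat conductivity -/
  η : ℝ → ℝ
  /-- temperature dependence of the electric conductivity -/
  σ : ℝ → ℝ
  /-- coefficient of the heat conductivity -/
  κ : E3 → Matrix (Fin 3) (Fin 3) ℝ
  /-- coefficient of the electric conductivity -/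
  ε : E3 → Matrix (Fin 3) (Fin 3) ℝ
  /-- heat transfer coefficient -/
  α : E3 → ℝ
  /-- surrounding temperature, as a function of the boundary point and the time -/
  θl : E3 × ℝ → ℝ
  /-- current -/
  u : ℝ → W1ZeroDual Ω ΓD q'
  /-- initial temperature -/
  θ₀ : W1Dual Ω q'

namespace Data

variable {q' : ℝ≥0∞} [Fact (1 ≤ q')]

/-- The measure on the lateral surface `Σ = ∂Ω × (T₀, T₁)`. -/
def lateralMeasure (D : Data q') : Measure (E3 × ℝ) :=
  (boundaryMeasure D.Ω).prod (volume.restrict (Ioo D.T₀ D.T₁))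

/-- The general assumptions on the data of the thermistor problem: the geometric setting, the
assumptions on the coefficients, boundary and initial data, and the isomorphism property of the
two elliptic operators for the exponent `q ∈ (3, 4)`. -/
structure IsAdmissible (D : Data q') (q r : ℝ≥0∞) [Fact (1 ≤ q)]
    [ENNReal.HolderConjugate q q'] : Prop where
  time : D.T₀ < D.T₁
  three_lt : 3 < q
  lt_four : q < 4
  critical_lt : 2 * q / (q - 3) < r
  r_lt_top : r < ⊤
  domain : IsLipschitzDomain D.Ω
  dirichlet_subset : D.ΓD ⊆ frontier D.Ω
  dirichlet_closed : IsClosed D.ΓD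
  dirichlet_nonempty : D.ΓD.Nonempty
  dirichlet_regular : IsGroegerRegular D.Ω D.ΓD
  η_cond : IsConductivity D.η
  σ_cond : IsConductivity D.σ
  κ_elliptic : IsEllipticCoefficient D.Ω D.κ
  ε_elliptic : IsEllipticCoefficient D.Ω D.ε
  θl_memLp : MemLp D.θl ⊤ D.lateralMeasure
  α_memLp : MemLp D.α ⊤ (boundaryMeasure D.Ω)
  α_nonneg : ∀ᵐ x ∂boundaryMeasure D.Ω, 0 ≤ D.α x
  α_pos : 0 < ∫ x, D.α x ∂boundaryMeasure D.Ω
  u_memLp : MemLp D.u (2 * r) (volume.restrict (Ioo D.T₀ D.T₁))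
  θ₀_mem : MemRealInterpolation (embed D.Ω q q') (1 / r.toReal) r.toReal D.θ₀
  /-- `-∇ · ε∇ : W^{1,q}_{Γ_D} → W^{-1,q}_{Γ_D}` is a topological isomorphism -/
  ε_iso : ∃ e : W1Zero D.Ω D.ΓD q ≃L[ℝ] W1ZeroDual D.Ω D.ΓD q', ∀ ψ ξ,
    e ψ ξ = ∫ x in D.Ω, form (D.ε x) (grad ψ.1 x) (grad ξ.1 x)
  /-- `-∇ · κ∇ + 1 : W^{1,q} → W^{-1,q}_∅` is a topological isomorphism -/
  κ_iso : ∃ e : W1 D.Ω q ≃L[ℝ] W1Dual D.Ω q', ∀ ψ ξ,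
    e ψ ξ = (∫ x in D.Ω, form (D.κ x) (grad ψ x) (grad ξ x)) + ∫ x in D.Ω, fn ψ x * fn ξ x

/-- The parabolic equation
`ϑ' + 𝒜(ϑ) ϑ = (σ(ϑ) ε ∇χ) · ∇χ + α θ_l(t)` in `W^{-1,q}_∅` at the time `t`, where
`𝒜(ϑ) = -∇ · η(ϑ) κ ∇ + α̃` and `α̃` stands for the boundary form `∫ α ϑ ξ` on `∂Ω`. -/
def ParabolicEq (D : Data q') {q : ℝ≥0∞} [Fact (1 ≤ q)] (t : ℝ) (ϑ : W1 D.Ω q)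
    (dϑ : W1Dual D.Ω q') (χ : W1 D.Ω q) : Prop :=
  ∀ ξ : W1 D.Ω q',
    dϑ ξ + ((∫ x in D.Ω, D.η (fn ϑ x) * form (D.κ x) (grad ϑ x) (grad ξ x)) +
        ∫ x, D.α x * trace D.Ω (fn ϑ) x * trace D.Ω (fn ξ) x ∂boundaryMeasure D.Ω) =
      (∫ x in D.Ω, D.σ (fn ϑ x) * form (D.ε x) (grad χ x) (grad χ x) * fn ξ x) +
        ∫ x, D.α x * D.θl (x, t) * trace D.Ω (fn ξ) x ∂boundaryMeasure D.Ω

/-- The elliptic equation `-∇ · σ(ϑ) ε ∇χ = u(t)` in `W^{-1,q}_{Γ_D}` at the time `t`. -/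
def EllipticEq (D : Data q') {q : ℝ≥0∞} [Fact (1 ≤ q)] (t : ℝ) (ϑ : W1 D.Ω q)
    (χ : W1 D.Ω q) : Prop :=
  ∀ ξ : W1Zero D.Ω D.ΓD q',
    ∫ x in D.Ω, D.σ (fn ϑ x) * form (D.ε x) (grad χ x) (grad ξ.1 x) = D.u t ξ

/-- `(θ, φ)` is a (local) solution of the thermistor problem on `(T₀, S) ⊆ (T₀, T₁)`:
`θ ∈ W^{1,r}(T₀, S; W^{-1,q}_∅) ∩ L^r(T₀, S; W^{1,q})`, `φ ∈ L^{2r}(T₀, S; W^{1,q}_{Γ_D})`, both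
equations hold at almost every time, and `θ(T₀) = θ₀` for the continuous representative of `θ` with
values in `W^{-1,q}_∅`. -/
structure IsLocalSolution (D : Data q') {q : ℝ≥0∞} [Fact (1 ≤ q)] [ENNReal.HolderConjugate q q']
    (r : ℝ≥0∞) (S : ℝ) (θ : ℝ → W1 D.Ω q) (φ : ℝ → W1Zero D.Ω D.ΓD q) : Prop where
  lt : D.T₀ < S
  le : S ≤ D.T₁
  θ_memLp : MemLp θ r (volume.restrict (Ioo D.T₀ S))
  φ_memLp : MemLp φ (2 * r) (volume.restrict (Ioo D.T₀ S))
  parabolic : ∃ dθ : ℝ → W1Dual D.Ω q', MemLp dθ r (volume.restrict (Ioo D.T₀ S)) ∧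
    HasWeakTimeDeriv D.T₀ S (fun t => embed D.Ω q q' (θ t)) dθ ∧
    ∀ᵐ t ∂volume.restrict (Ioo D.T₀ S), D.ParabolicEq t (θ t) (dθ t) (φ t).1
  elliptic : ∀ᵐ t ∂volume.restrict (Ioo D.T₀ S), D.EllipticEq t (θ t) (φ t).1
  initial : ∃ w : ℝ → W1Dual D.Ω q', ContinuousOn w (Icc D.T₀ S) ∧
    (∀ᵐ t ∂volume.restrict (Ioo D.T₀ S), w t = embed D.Ω q q' (θ t)) ∧ w D.T₀ = D.θ₀

/-- `f` is the continuous function on the closure of `Ω` that the element `θ₀` of `W^{-1,q}_∅`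
stands for. -/
def IsContinuousInitialValue (D : Data q') (f : E3 → ℝ) : Prop :=
  ContinuousOn f (closure D.Ω) ∧ ∀ ξ : W1 D.Ω q', D.θ₀ ξ = ∫ x in D.Ω, f x * fn ξ x

/-- `Θ` is the representative of `θ` that is continuous on `closure Ω × [T₀, S]`. -/
def IsContinuousRep (D : Data q') {q : ℝ≥0∞} [Fact (1 ≤ q)] (S : ℝ) (θ : ℝ → W1 D.Ω q)
    (Θ : E3 × ℝ → ℝ) : Prop :=
  ContinuousOn Θ (closure D.Ω ×ˢ Icc D.T₀ S) ∧
    ∀ᵐ t ∂volume.restrict (Ioo D.T₀ S), fn (θ t) =ᵐ[volume.restrict D.Ω] fun x => Θ (x, t)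

end Data

end Thermistor

end

/-! The theorem is a weak minimum principle, obtained by truncation. Let `M` be the bound on the
right-hand side and test the heat equation at almost every time t with ξ(t) = -(M - θ(t))₊². The
diffusion term is nonnegative because ∇ξ = 2 (M - θ)₊ ∇θ. The Joule heat is nonnegative and is
multiplied by ξ ≤ 0. On the boundary ξ is nonzero only where θ < M ≤ θ_l. Hence ⟨θ'(t), ξ(t)⟩ ≤ 0
(`Data.ParabolicEq.apply_nonpos`). Formally the left side is the derivative of F(t) = ∫ (M - θ(t))₊³
/ 3, and F ≥ 0 with F(T₀) = 0 forces F = 0.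

A chain rule for F is avoided by convexity: F(t) - F(t') ≤ ⟨θ(t) - θ(t'), ξ(t)⟩ = ∫ ⟨θ'(s), ξ(t)⟩ ds
over (t', t). Replacing θ'(s) by θ'(s) - θ'(t) only increases this, so the difference is at most
‖ξ(t)‖ ∫ ‖θ'(s) - θ'(t)‖ ds. Integrated in t with t - t' = k fixed, the bound is o(k), because
translations are continuous in L² and ‖ξ(t)‖ ≤ C (1 + ‖θ(t)‖) is square integrable. Hence F never
exceeds its initial value (`le_of_forall_ofReal_sub_le`).

All of this rests on the continuity of θ on the closed cylinder: it makes θ bounded, so that ξ(t) is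
an admissible element of W^{1,q'} (`exists_test_function`), and it turns traces into boundary values
(`trace_eq`). In space, boundary charts map onto convex sets, and Morrey's argument compares v(x)
with an average of v over an interior ball of size l. The difference is O(l^{1-3/q}) ‖v‖ in terms of
the W^{1,q} norm. The average is a pairing with a smooth function, hence O(l^{-1-3/q}) times the
W^{-1,q} norm (`IsConvexChart.estimate`, `exists_embedding`). In time, averages of θ over windows of
length comparable to l² have W^{1,q} norm O(l^{-2/r}) and W^{-1,q} distance O(l^{2-2/r}) to θ(t).
Consecutive averages with l = 2^{-n} therefore differ uniformly by O(l^{1-3/q-2/r}), a convergent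
geometric series exactly because r > 2q/(q-3) (`exists_continuous_curve`). -/

namespace Thermistor

/-! ### Mollification -/

/-- A sequence of bump functions on `ℝ³` whose supports shrink to the origin. -/
noncomputable def mollifier (n : ℕ) : ContDiffBump (0 : E3) where
  rIn := 1 / (2 * ((n : ℝ) + 1))
  rOut := 1 / ((n : ℝ) + 1)
  rIn_pos := by positivity
  rIn_lt_rOut := by
    apply one_div_lt_one_div_of_lt <;> nlinarith [Nat.cast_nonneg (α := ℝ) n]

/-- The mollification kernel. -/
noncomputable abbrev mollKernel (n : ℕ) : E3 → ℝ := (mollifier n).normed volume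

/-- Mollification by convolution. -/
noncomputable def mollify {F : Type*} [NormedAddCommGroup F] [NormedSpace ℝ F] (n : ℕ) (g : E3 → F) : E3 → F :=
  convolution (mollKernel n) g (ContinuousLinearMap.lsmul ℝ ℝ) volume

section Mollify

variable {F : Type*} [NormedAddCommGroup F] [NormedSpace ℝ F]

lemma mollify_apply (n : ℕ) (g : E3 → F) (x : E3) :
    mollify n g x = ∫ u, mollKernel n u • g (x - u) := rfl

lemma mollify_apply' (n : ℕ) (g : E3 → F) (x : E3) :
    mollify n g x = ∫ y, mollKernel n (x - y) • g y := by
  unfold mollify; rw [convolution_eq_swap]; rfl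

lemma tendsto_mollifier_rOut : Tendsto (fun n => (mollifier n).rOut) atTop (𝓝 0) :=
  tendsto_one_div_add_atTop_nhds_zero_nat

lemma ae_tendsto_mollify [CompleteSpace F] {g : E3 → F} (hg : LocallyIntegrable g volume) :
    ∀ᵐ x, Tendsto (fun n => mollify n g x) atTop (𝓝 (g x)) := by
  -- The two radii of `mollifier n` have ratio exactly 2; the differentiation theorem needs a bound
  -- on it uniform in `n`.
  refine ContDiffBump.ae_convolution_tendsto_right_of_locallyIntegrable (K := 2)
    tendsto_mollifier_rOut (Eventually.of_forall fun n => ?_) hg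
  simp only [mollifier]
  have : (n : ℝ) + 1 ≠ 0 := by positivity
  field_simp
  norm_num

lemma contDiff_mollify {g : E3 → F} (n : ℕ) (hg : LocallyIntegrable g volume) :
    ContDiff ℝ ∞ (mollify n g) :=
  HasCompactSupport.contDiff_convolution_left (n := ⊤) _ (mollifier n).hasCompactSupport_normed
    (mollifier n).contDiff_normed hg

lemma lintegral_mollKernel (n : ℕ) : ∫⁻ u, ENNReal.ofReal (mollKernel n u) = 1 := by
  rw [← ofReal_integral_eq_lintegral_ofReal (mollifier n).integrable_normed
    (Eventually.of_forall fun x => (mollifier n).nonneg_normed x), (mollifier n).integral_normed]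
  simp

lemma enorm_mollKernel (n : ℕ) (u : E3) : ‖mollKernel n u‖ₑ = ENNReal.ofReal (mollKernel n u) :=
  Real.enorm_of_nonneg ((mollifier n).nonneg_normed u)

lemma measurable_mollKernel (n : ℕ) : Measurable (mollKernel n) :=
  (mollifier n).continuous_normed.measurable

lemma enorm_mollify_le (n : ℕ) (g : E3 → F) (x : E3) :
    ‖mollify n g x‖ₑ ≤ ∫⁻ u, ENNReal.ofReal (mollKernel n u) * ‖g (x - u)‖ₑ := by
  rw [mollify_apply]
  refine (enorm_integral_le_lintegral_enorm _).trans (le_of_eq ?_)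
  simp_rw [enorm_smul, enorm_mollKernel]

lemma norm_mollify_le {g : E3 → F} {B : ℝ} (hB : ∀ᵐ x, ‖g x‖ ≤ B) (n : ℕ) (x : E3) :
    ‖mollify n g x‖ ≤ B := by
  rw [mollify_apply']
  have h2 : Integrable (fun y => mollKernel n (x - y) * B) :=
    ((mollifier n).integrable_normed.comp_sub_left x).mul_const B
  refine (norm_integral_le_of_norm_le h2 ?_).trans (le_of_eq ?_)
  · filter_upwards [hB] with y hy
    rw [norm_smul, Real.norm_of_nonneg ((mollifier n).nonneg_normed _)]
    exact mul_le_mul_of_nonneg_left hy ((mollifier n).nonneg_normed _)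
  · rw [integral_mul_const, integral_sub_left_eq_self (mollKernel n) volume x,
      (mollifier n).integral_normed, one_mul]

/-- Mollification does not increase the `L^p` norm. -/
lemma lintegral_mollify_rpow_le {g : E3 → F} (hg : AEStronglyMeasurable g volume) {p : ℝ}
    (hp : 1 ≤ p) (n : ℕ) :
    ∫⁻ x, ‖mollify n g x‖ₑ ^ p ≤ ∫⁻ x, ‖g x‖ₑ ^ p := by
  -- Both sides depend only on the almost everywhere class; a strongly measurable representative
  -- makes the integrand of the double integral measurable.
  wlog hgm : StronglyMeasurable g generalizing g
  · have h1 : mollify n g = mollify n (hg.mk g) := by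
      ext x
      rw [mollify_apply', mollify_apply']
      refine integral_congr_ae ?_
      filter_upwards [hg.ae_eq_mk] with y hy
      rw [hy]
    have h2 : ∫⁻ x, ‖g x‖ₑ ^ p = ∫⁻ x, ‖hg.mk g x‖ₑ ^ p := by
      refine lintegral_congr_ae ?_
      filter_upwards [hg.ae_eq_mk] with y hy
      rw [hy]
    rw [h1, h2]
    exact this hg.stronglyMeasurable_mk.aestronglyMeasurable hg.stronglyMeasurable_mk
  have hm : Measurable (fun z : E3 × E3 => ‖g (z.1 - z.2)‖ₑ ^ p) :=
    (hgm.enorm.comp (measurable_fst.sub measurable_snd)).pow_const p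
  have hk : Measurable (fun u => ENNReal.ofReal (mollKernel n u)) :=
    (measurable_mollKernel n).ennreal_ofReal
  -- The kernel as a probability measure: Jensen's inequality becomes the monotonicity of L^p norms
  -- in p.
  set μ : Measure E3 := volume.withDensity (fun u => ENNReal.ofReal (mollKernel n u)) with hμ
  have hμ1 : μ univ = 1 := by
    rw [hμ, withDensity_apply _ MeasurableSet.univ, Measure.restrict_univ, lintegral_mollKernel]
  have hpt : ∀ x, ‖mollify n g x‖ₑ ^ p
      ≤ ∫⁻ u, ENNReal.ofReal (mollKernel n u) * ‖g (x - u)‖ₑ ^ p := by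
    intro x
    have hmx : Measurable (fun u => ‖g (x - u)‖ₑ) :=
      hgm.enorm.comp (measurable_const.sub measurable_id)
    have e1 : ∫⁻ u, ENNReal.ofReal (mollKernel n u) * ‖g (x - u)‖ₑ = ∫⁻ u, ‖g (x - u)‖ₑ ∂μ := by
      rw [hμ, lintegral_withDensity_eq_lintegral_mul _ hk hmx]; rfl
    have e2 : ∫⁻ u, ENNReal.ofReal (mollKernel n u) * ‖g (x - u)‖ₑ ^ p
        = ∫⁻ u, ‖g (x - u)‖ₑ ^ p ∂μ := by
      rw [hμ, lintegral_withDensity_eq_lintegral_mul _ hk (hmx.pow_const p)]; rfl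
    rw [e2]
    refine (ENNReal.rpow_le_rpow ((enorm_mollify_le n g x).trans_eq e1) (by linarith)).trans ?_
    have h3 := eLpNorm_le_eLpNorm_mul_rpow_measure_univ (μ := μ) (p := 1) (q := ENNReal.ofReal p)
      (f := fun u => g (x - u)) (by simpa using hp)
      (hgm.comp_measurable (measurable_const.sub measurable_id)).aestronglyMeasurable
    rw [hμ1, ENNReal.one_rpow, mul_one, eLpNorm_one_eq_lintegral_enorm,
      eLpNorm_eq_lintegral_rpow_enorm_toReal (by simp; linarith) (by simp),
      ENNReal.toReal_ofReal (by linarith)] at h3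
    refine (ENNReal.rpow_le_rpow h3 (by linarith)).trans (le_of_eq ?_)
    rw [← ENNReal.rpow_mul, one_div, inv_mul_cancel₀ (by linarith), ENNReal.rpow_one]
  calc ∫⁻ x, ‖mollify n g x‖ₑ ^ p
      ≤ ∫⁻ x, ∫⁻ u, ENNReal.ofReal (mollKernel n u) * ‖g (x - u)‖ₑ ^ p := lintegral_mono hpt
    _ = ∫⁻ u, ∫⁻ x, ENNReal.ofReal (mollKernel n u) * ‖g (x - u)‖ₑ ^ p := by
        refine lintegral_lintegral_swap ?_
        exact ((hk.comp measurable_snd).mul hm).aemeasurable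
    _ = ∫⁻ u, ENNReal.ofReal (mollKernel n u) * ∫⁻ x, ‖g x‖ₑ ^ p := by
        refine lintegral_congr fun u => ?_
        rw [lintegral_const_mul' _ _ ENNReal.ofReal_ne_top,
          lintegral_sub_right_eq_self (fun x => ‖g x‖ₑ ^ p) u]
    _ = ∫⁻ x, ‖g x‖ₑ ^ p := by
        rw [lintegral_mul_const _ hk, lintegral_mollKernel, one_mul]

/-- Translations are continuous in `L^p`. -/
lemma tendsto_eLpNorm_translate {G : Type*} [NormedAddCommGroup G]
    [MeasurableSpace G] [BorelSpace G] [LocallyCompactSpace G] [SecondCountableTopology G]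
    {μ : Measure G} [μ.IsAddHaarMeasure] {F : Type*} [NormedAddCommGroup F] {p : ℝ≥0∞}
    (hp : 1 ≤ p) (hp' : p ≠ ⊤) {f : G → F} (hf : MemLp f p μ) :
    Tendsto (fun u : G => eLpNorm (fun z => f (z - u) - f z) p μ) (𝓝 0) (𝓝 0) := by
  have : Fact (1 ≤ p) := ⟨hp⟩
  -- Currying makes the translation by `u` depend continuously on `u` in the compact-open topology,
  -- which is the continuity that composition in L^p asks for.
  let T : C(G, C(G, G)) := ContinuousMap.curry ⟨fun z : G × G => z.2 - z.1, by fun_prop⟩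
  have hT : ∀ u, MeasurePreserving (T u) μ μ := fun u => measurePreserving_sub_right μ u
  have h := Filter.Tendsto.compMeasurePreservingLp (μ := μ) (ν := μ) (p := p)
    (f := fun _ : G => hf.toLp f) (l := 𝓝 0) tendsto_const_nhds (T.continuous.tendsto 0) hT (hT 0)
    hp'
  have h0 : Lp.compMeasurePreserving (T 0) (hT 0) (hf.toLp f) = hf.toLp f := by
    refine Lp.ext ?_
    refine (Lp.coeFn_compMeasurePreserving (hf.toLp f) (hT 0)).trans ?_
    refine Eventually.of_forall fun x => ?_
    simp [T, ContinuousMap.curry]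
  rw [h0] at h
  rw [Lp.tendsto_Lp_iff_tendsto_eLpNorm'] at h
  refine h.congr fun u => eLpNorm_congr_ae ?_
  have h1 := Lp.coeFn_compMeasurePreserving (hf.toLp f) (hT u)
  have h2 := hf.coeFn_toLp
  have h3 := (hT u).quasiMeasurePreserving.ae h2
  filter_upwards [h1, h2, h3] with z hz1 hz2 hz3
  simp only [Pi.sub_apply, hz1, hz2, Function.comp_apply, hz3]
  rfl

/-- Mollifications of an integrable function converge in `L¹`. -/
lemma tendsto_lintegral_mollify_sub [CompleteSpace F] {g : E3 → F} (hg : Integrable g volume) :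
    Tendsto (fun n => ∫⁻ x, ‖mollify n g x - g x‖ₑ) atTop (𝓝 0) := by
  have ht := tendsto_eLpNorm_translate (μ := (volume : Measure E3)) le_rfl (by simp)
    (memLp_one_iff_integrable.2 hg)
  rw [ENNReal.tendsto_nhds_zero] at ht ⊢
  intro ε hε
  obtain ⟨δ, hδ, hball⟩ := Metric.eventually_nhds_iff.1 (ht ε hε)
  have h1 : ∀ᶠ n in atTop, (mollifier n).rOut < δ :=
    (tendsto_mollifier_rOut.eventually (gt_mem_nhds hδ))
  filter_upwards [h1] with n hn
  have hk : Measurable (fun u => ENNReal.ofReal (mollKernel n u)) :=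
    (measurable_mollKernel n).ennreal_ofReal
  have hpt : ∀ᵐ x, ‖mollify n g x - g x‖ₑ
      ≤ ∫⁻ u, ENNReal.ofReal (mollKernel n u) * ‖g (x - u) - g x‖ₑ := by
    refine Eventually.of_forall fun x => ?_
    have hi : Integrable (fun u => mollKernel n u • g (x - u)) := by
      have := (mollifier n).hasCompactSupport_normed (μ := volume) |>.convolutionExists_left
        (ContinuousLinearMap.lsmul ℝ ℝ) (mollifier n).continuous_normed hg.locallyIntegrable x
      exact this
    have : mollify n g x - g x = ∫ u, mollKernel n u • (g (x - u) - g x) := by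
      simp_rw [smul_sub]
      rw [integral_sub hi ((mollifier n).integrable_normed.smul_const _), integral_smul_const,
        (mollifier n).integral_normed, one_smul]
      rfl
    rw [this]
    refine (enorm_integral_le_lintegral_enorm _).trans (le_of_eq ?_)
    simp_rw [enorm_smul, enorm_mollKernel]
  have hm : AEMeasurable (fun z : E3 × E3 => ENNReal.ofReal (mollKernel n z.2) *
      ‖g (z.1 - z.2) - g z.1‖ₑ) (volume.prod volume) := by
    refine (hk.comp measurable_snd).aemeasurable.mul (AEStronglyMeasurable.enorm ?_)
    refine AEStronglyMeasurable.sub ?_ hg.1.comp_fst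
    exact hg.1.comp_quasiMeasurePreserving (quasiMeasurePreserving_sub volume volume)
  calc ∫⁻ x, ‖mollify n g x - g x‖ₑ
      ≤ ∫⁻ x, ∫⁻ u, ENNReal.ofReal (mollKernel n u) * ‖g (x - u) - g x‖ₑ :=
        lintegral_mono_ae hpt
    _ = ∫⁻ u, ∫⁻ x, ENNReal.ofReal (mollKernel n u) * ‖g (x - u) - g x‖ₑ :=
        lintegral_lintegral_swap hm
    _ = ∫⁻ u, ENNReal.ofReal (mollKernel n u) * eLpNorm (fun x => g (x - u) - g x) 1 volume := by
        refine lintegral_congr fun u => ?_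
        rw [lintegral_const_mul' _ _ ENNReal.ofReal_ne_top, eLpNorm_one_eq_lintegral_enorm]
    _ ≤ ∫⁻ u, ENNReal.ofReal (mollKernel n u) * ε := by
        refine lintegral_mono fun u => ?_
        by_cases hu : u ∈ Metric.ball (0 : E3) (mollifier n).rOut
        · exact mul_le_mul_right (hball ((Metric.mem_ball.1 hu).trans hn)) _
        · have : mollKernel n u = 0 := by
            rw [← Function.notMem_support, (mollifier n).support_normed_eq]; exact hu
          simp [this]
    _ = ε := by rw [lintegral_mul_const _ hk, lintegral_mollKernel, one_mul]

end Mollify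

/-- Where the kernel fits into `Ω`, the gradient of a mollification is the mollification of the
weak gradient. -/
lemma fderiv_mollify {Ω : Set E3} (hΩ : MeasurableSet Ω) {f : E3 → ℝ} {g : E3 → E3}
    (hf : IntegrableOn f Ω) (hg : IntegrableOn g Ω) (h : HasWeakGradient Ω f g) {n : ℕ} {x : E3}
    (hx : Metric.closedBall x (mollifier n).rOut ⊆ Ω) (v : E3) :
    fderiv ℝ (mollify n (Ω.indicator f)) x v
      = inner ℝ (mollify n (Ω.indicator g) x) v := by
  have hfi : LocallyIntegrable (Ω.indicator f) volume :=
    ((integrable_indicator_iff hΩ).2 hf).locallyIntegrable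
  have hgi : LocallyIntegrable (Ω.indicator g) volume :=
    ((integrable_indicator_iff hΩ).2 hg).locallyIntegrable
  have hc := (mollifier n).hasCompactSupport_normed (μ := volume)
  have hs : ContDiff ℝ ∞ (mollKernel n) := (mollifier n).contDiff_normed
  have h1 : fderiv ℝ (mollify n (Ω.indicator f)) x v
      = ∫ y, Ω.indicator f y * fderiv ℝ (mollKernel n) (x - y) v := by
    have e : mollify n (Ω.indicator f) = convolution (Ω.indicator f) (mollKernel n)
        (ContinuousLinearMap.lsmul ℝ ℝ).flip volume := by
      unfold mollify; rw [convolution_flip]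
    rw [e, (hc.hasFDerivAt_convolution_right _ hfi (hs.of_le (by simp)) x).fderiv,
      convolution_precompR_apply _ hfi (hc.fderiv ℝ) (hs.continuous_fderiv (by simp))]
    rw [convolution_def]
    refine integral_congr_ae (Eventually.of_forall fun y => ?_)
    simp [mul_comm]
  -- The reflected kernel is an admissible test function because its support lies in the closed ball
  -- that fits into `Ω`. Reflection changes the sign of the derivative and so cancels the sign of
  -- the integration by parts.
  set ψ : E3 → ℝ := fun y => mollKernel n (x - y) with hψ
  have hψs : ContDiff ℝ ∞ ψ := hs.comp (contDiff_const.sub contDiff_id)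
  have hψt : tsupport ψ ⊆ Metric.closedBall x (mollifier n).rOut := by
    refine closure_minimal ?_ Metric.isClosed_closedBall
    intro y hy
    have : x - y ∈ Function.support (mollKernel n) := hy
    rw [(mollifier n).support_normed_eq, Metric.mem_ball, dist_zero_right] at this
    rw [Metric.mem_closedBall, dist_comm, dist_eq_norm]
    exact this.le
  have hψc : HasCompactSupport ψ :=
    (isCompact_closedBall x _).of_isClosed_subset (isClosed_tsupport _) hψt
  have hfd : ∀ y, fderiv ℝ ψ y v = - fderiv ℝ (mollKernel n) (x - y) v := by
    intro y
    have h2 : HasFDerivAt ψ ((fderiv ℝ (mollKernel n) (x - y)).comp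
        (-(ContinuousLinearMap.id ℝ E3))) y :=
      ((hs.differentiable (by simp)).differentiableAt.hasFDerivAt (x := x - y)).comp y
        ((hasFDerivAt_id y).const_sub x)
    rw [h2.fderiv]; simp
  have hw := h ψ hψs hψc (hψt.trans hx) v
  have hi : Integrable (fun y => mollKernel n (x - y) • Ω.indicator g y) :=
    (hgi.integrable_smul_left_of_hasCompactSupport hψs.continuous hψc)
  rw [h1, mollify_apply', real_inner_comm, ← integral_inner hi v]
  have e1 : ∫ y, Ω.indicator f y * fderiv ℝ (mollKernel n) (x - y) v
      = - ∫ y in Ω, fderiv ℝ ψ y v * f y := by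
    rw [← integral_neg, ← integral_indicator hΩ]
    refine integral_congr_ae (Eventually.of_forall fun y => ?_)
    by_cases hy : y ∈ Ω <;> simp [hy, hfd, mul_comm]
  rw [e1, hw, neg_neg, ← integral_indicator hΩ]
  refine integral_congr_ae (Eventually.of_forall fun y => ?_)
  by_cases hy : y ∈ Ω <;> simp [hy, ψ, real_inner_smul_right, real_inner_comm]

/-! ### Elements of the Sobolev spaces -/

section Sobolev

variable {Ω : Set E3} {p : ℝ≥0∞} [Fact (1 ≤ p)]

/-- Every defining identity pairs the couple with fixed functions of the conjugate Lebesgue space,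
so the subspace is an intersection of closed sets. The resulting completeness is what Bochner time
averages with values in `W1 Ω p` require. -/
lemma isClosed_sobolevSubmodule (Ω : Set E3) (p : ℝ≥0∞) [hp : Fact (1 ≤ p)] :
    IsClosed (sobolevSubmodule Ω p : Set (Lp ℝ p (volume.restrict Ω) ×
      Lp E3 p (volume.restrict Ω))) := by
  have hconj : ENNReal.HolderConjugate (ENNReal.conjExponent p) p :=
    (ENNReal.HolderConjugate.conjExponent hp.out).symm
  have hq : Fact (1 ≤ ENNReal.conjExponent p) := ⟨ENNReal.HolderConjugate.one_le _ p⟩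
  have e : (sobolevSubmodule Ω p : Set (Lp ℝ p (volume.restrict Ω) ×
      Lp E3 p (volume.restrict Ω))) = ⋂ (ψ : E3 → ℝ) (_ : ContDiff ℝ ∞ ψ)
      (_ : HasCompactSupport ψ) (_ : tsupport ψ ⊆ Ω) (v : E3),
      {w | ∫ x in Ω, fderiv ℝ ψ x v * w.1 x = - ∫ x in Ω, ψ x * inner ℝ (w.2 x) v} := by
    ext w
    simp only [mem_iInter]
    rfl
  rw [e]
  refine isClosed_iInter fun ψ => isClosed_iInter fun hψ => isClosed_iInter fun hc =>
    isClosed_iInter fun _ => isClosed_iInter fun v => ?_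
  have h1 : MemLp (fun x => fderiv ℝ ψ x v) (ENNReal.conjExponent p) (volume.restrict Ω) :=
    (((hψ.continuous_fderiv (by simp)).clm_apply continuous_const).memLp_of_hasCompactSupport
      (hc.fderiv_apply ℝ v))
  have h2 : MemLp (fun x => ψ x • v) (ENNReal.conjExponent p) (volume.restrict Ω) :=
    ((hψ.continuous.smul continuous_const).memLp_of_hasCompactSupport hc.smul_right)
  refine isClosed_eq ?_ (Continuous.neg ?_)
  · have hcont : Continuous fun w : Lp ℝ p (volume.restrict Ω) × Lp E3 p (volume.restrict Ω) =>
        (ContinuousLinearMap.mul ℝ ℝ).lpPairing (volume.restrict Ω) (ENNReal.conjExponent p) p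
          (h1.toLp _) w.1 := by fun_prop
    refine hcont.congr fun w => ?_
    rw [ContinuousLinearMap.lpPairing_eq_integral]
    refine integral_congr_ae ?_
    filter_upwards [h1.coeFn_toLp] with x hx
    simp [hx]
  · have hcont : Continuous fun w : Lp ℝ p (volume.restrict Ω) × Lp E3 p (volume.restrict Ω) =>
        (innerSL ℝ (E := E3)).lpPairing (volume.restrict Ω) (ENNReal.conjExponent p) p
          (h2.toLp _) w.2 := by fun_prop
    refine hcont.congr fun w => ?_
    rw [ContinuousLinearMap.lpPairing_eq_integral]
    refine integral_congr_ae ?_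
    filter_upwards [h2.coeFn_toLp] with x hx
    rw [hx]
    change inner ℝ (ψ x • v) (w.2 x) = _
    rw [real_inner_smul_left, real_inner_comm]

instance : CompleteSpace (W1 Ω p) :=
  (isClosed_sobolevSubmodule Ω p).completeSpace_coe

lemma hasWeakGradient_fn (w : W1 Ω p) : HasWeakGradient Ω (fn w) (grad w) := w.2

lemma memLp_fn (w : W1 Ω p) : MemLp (fn w) p (volume.restrict Ω) := Lp.memLp w.1.1

lemma memLp_grad (w : W1 Ω p) : MemLp (grad w) p (volume.restrict Ω) := Lp.memLp w.1.2

lemma fn_add (w z : W1 Ω p) : fn (w + z) =ᵐ[volume.restrict Ω] fn w + fn z :=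
  Lp.coeFn_add w.1.1 z.1.1

lemma fn_smul (c : ℝ) (w : W1 Ω p) : fn (c • w) =ᵐ[volume.restrict Ω] c • fn w :=
  Lp.coeFn_smul c w.1.1

lemma eLpNorm_grad_le (w : W1 Ω p) :
    eLpNorm (grad w) p (volume.restrict Ω) ≤ ENNReal.ofReal ‖w‖ := by
  have h : ‖w.1.2‖ ≤ ‖w‖ := le_max_right _ _
  rw [Lp.norm_def] at h
  exact (ENNReal.le_ofReal_iff_toReal_le (memLp_grad w).2.ne (norm_nonneg _)).2 h

lemma HasWeakGradient.congr {f f' : E3 → ℝ} {g g' : E3 → E3} (h : HasWeakGradient Ω f g)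
    (hf : f =ᵐ[volume.restrict Ω] f') (hg : g =ᵐ[volume.restrict Ω] g') :
    HasWeakGradient Ω f' g' := by
  intro ψ h1 h2 h3 v
  have e1 : ∫ x in Ω, fderiv ℝ ψ x v * f' x = ∫ x in Ω, fderiv ℝ ψ x v * f x := by
    refine integral_congr_ae ?_
    filter_upwards [hf] with x hx
    rw [hx]
  have e2 : ∫ x in Ω, ψ x * inner ℝ (g' x) v = ∫ x in Ω, ψ x * inner ℝ (g x) v := by
    refine integral_congr_ae ?_
    filter_upwards [hg] with x hx
    rw [hx]
  rw [e1, e2, h ψ h1 h2 h3 v]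

/-- The element of `W^{1,p}(Ω)` given by a function and its weak gradient. -/
noncomputable def W1.mk {f : E3 → ℝ} {g : E3 → E3} (hf : MemLp f p (volume.restrict Ω))
    (hg : MemLp g p (volume.restrict Ω)) (h : HasWeakGradient Ω f g) : W1 Ω p :=
  ⟨(hf.toLp f, hg.toLp g), h.congr hf.coeFn_toLp.symm hg.coeFn_toLp.symm⟩

section Mk

variable {f : E3 → ℝ} {g : E3 → E3} (hf : MemLp f p (volume.restrict Ω))
    (hg : MemLp g p (volume.restrict Ω)) (h : HasWeakGradient Ω f g)

lemma fn_mk : fn (W1.mk hf hg h) =ᵐ[volume.restrict Ω] f := hf.coeFn_toLp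

lemma grad_mk : grad (W1.mk hf hg h) =ᵐ[volume.restrict Ω] g := hg.coeFn_toLp

lemma norm_mk_le {C : ℝ} (h1 : eLpNorm f p (volume.restrict Ω) ≤ ENNReal.ofReal C)
    (h2 : eLpNorm g p (volume.restrict Ω) ≤ ENNReal.ofReal C) (hC : 0 ≤ C) :
    ‖W1.mk hf hg h‖ ≤ C := by
  refine max_le ?_ ?_
  · change ‖hf.toLp f‖ ≤ C
    rw [Lp.norm_toLp]
    exact ENNReal.toReal_le_of_le_ofReal hC h1
  · change ‖hg.toLp g‖ ≤ C
    rw [Lp.norm_toLp]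
    exact ENNReal.toReal_le_of_le_ofReal hC h2

end Mk

/-- The gradient of a function as a vector field. -/
noncomputable def gradient' (ψ : E3 → ℝ) (x : E3) : E3 :=
  (InnerProductSpace.toDual ℝ E3).symm (fderiv ℝ ψ x)

lemma inner_gradient' (ψ : E3 → ℝ) (x v : E3) : inner ℝ (gradient' ψ x) v = fderiv ℝ ψ x v := by
  simp [gradient']

lemma norm_gradient' (ψ : E3 → ℝ) (x : E3) : ‖gradient' ψ x‖ = ‖fderiv ℝ ψ x‖ := by
  simp [gradient']

/-- Integration by parts against a function with compact support in `Ω`. -/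
lemma setIntegral_fderiv_mul {Ω : Set E3} {ψ h : E3 → ℝ} (hψ : ContDiff ℝ ∞ ψ)
    (hc : HasCompactSupport ψ) (hs : tsupport ψ ⊆ Ω) (hh : ContDiff ℝ 1 h) (v : E3) :
    ∫ x in Ω, fderiv ℝ ψ x v * h x = - ∫ x in Ω, ψ x * fderiv ℝ h x v := by
  have hz : ∀ x, x ∉ Ω → ψ x = 0 := fun x hx =>
    image_eq_zero_of_notMem_tsupport fun hx' => hx (hs hx')
  have hz' : ∀ x, x ∉ Ω → fderiv ℝ ψ x v = 0 := fun x hx => by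
    have : x ∉ tsupport (fderiv ℝ ψ) := fun hx' => hx (hs (tsupport_fderiv_subset ℝ hx'))
    rw [image_eq_zero_of_notMem_tsupport this]; rfl
  rw [setIntegral_eq_integral_of_forall_compl_eq_zero (fun x hx => by simp [hz' x hx]),
    setIntegral_eq_integral_of_forall_compl_eq_zero (fun x hx => by simp [hz x hx])]
  have c1 : Continuous fun x => fderiv ℝ ψ x v :=
    (hψ.continuous_fderiv (by simp)).clm_apply continuous_const
  have c2 : Continuous fun x => fderiv ℝ h x v :=
    (hh.continuous_fderiv (by simp)).clm_apply continuous_const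
  have := integral_mul_fderiv_eq_neg_fderiv_mul_of_integrable (μ := (volume : Measure E3))
    (f := h) (g := ψ) (v := v)
    ((c2.mul hψ.continuous).integrable_of_hasCompactSupport hc.mul_left)
    ((hh.continuous.mul c1).integrable_of_hasCompactSupport (hc.fderiv_apply ℝ v).mul_left)
    ((hh.continuous.mul hψ.continuous).integrable_of_hasCompactSupport hc.mul_left)
    (fun x _ => (hh.differentiable (by simp)).differentiableAt)
    (fun x _ => (hψ.differentiable (by simp)).differentiableAt)
  simpa only [mul_comm] using this

lemma hasWeakGradient_of_contDiff {h : E3 → ℝ} (hh : ContDiff ℝ 1 h) :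
    HasWeakGradient Ω h (gradient' h) := by
  intro ψ hψ hc hs v
  simp_rw [inner_gradient']
  exact setIntegral_fderiv_mul hψ hc hs hh v

lemma continuous_gradient' {ψ : E3 → ℝ} (hψ : ContDiff ℝ 1 ψ) : Continuous (gradient' ψ) :=
  (InnerProductSpace.toDual ℝ E3).symm.continuous.comp (hψ.continuous_fderiv (by simp))

/-- A smooth function with small support acts on `W^{1,q}(Ω)`, embedded in the dual of
`W^{1,q'}(Ω)`, with a norm bounded through its size and the size of the support. -/
lemma abs_setIntegral_mul_le {q q' : ℝ≥0∞} [Fact (1 ≤ q)] [hq' : Fact (1 ≤ q')]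
    [ENNReal.HolderConjugate q q'] {ψ : E3 → ℝ} (hψ : ContDiff ℝ 1 ψ)
    (hc : HasCompactSupport ψ) {S : Set E3} (hS : volume S ≠ ⊤) (hψS : tsupport ψ ⊆ S)
    {M : ℝ} (hM : ∀ x, |ψ x| ≤ M) (hM' : ∀ x, ‖fderiv ℝ ψ x‖ ≤ M) (w : W1 Ω q) :
    |∫ x in Ω, fn w x * ψ x| ≤ ‖embed Ω q q' w‖ * (M * (volume S).toReal ^ (1 / q'.toReal)) := by
  have hM0 : 0 ≤ M := (abs_nonneg _).trans (hM 0)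
  have hf : MemLp ψ q' (volume.restrict Ω) := hψ.continuous.memLp_of_hasCompactSupport hc
  have hgs : tsupport (gradient' ψ) ⊆ S := by
    refine (closure_mono ?_).trans ((tsupport_fderiv_subset ℝ (f := ψ)).trans hψS)
    intro x hx hx'
    apply hx
    rw [← norm_eq_zero, norm_gradient', hx', norm_zero]
  have hgc : HasCompactSupport (gradient' ψ) := by
    refine (hc.fderiv ℝ).mono fun x hx hx' => hx ?_
    rw [← norm_eq_zero, norm_gradient', hx', norm_zero]
  have hg : MemLp (gradient' ψ) q' (volume.restrict Ω) :=
    (continuous_gradient' hψ).memLp_of_hasCompactSupport hgc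
  have hw := hasWeakGradient_of_contDiff (Ω := Ω) hψ
  have key : ∀ {F : Type} [NormedAddCommGroup F] (u : E3 → F), tsupport u ⊆ S →
      (∀ x, ‖u x‖ ≤ M) → eLpNorm u q' (volume.restrict Ω)
        ≤ ENNReal.ofReal (M * (volume S).toReal ^ (1 / q'.toReal)) := by
    intro F _ u hu hb
    refine (eLpNorm_mono_measure u Measure.restrict_le_self).trans ?_
    rw [← eLpNorm_restrict_eq_of_support_subset ((subset_tsupport u).trans hu)]
    refine (eLpNorm_le_of_ae_bound (Eventually.of_forall hb)).trans (le_of_eq ?_)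
    rw [Measure.restrict_apply_univ, ENNReal.ofReal_mul hM0, mul_comm,
      ← ENNReal.ofReal_rpow_of_nonneg ENNReal.toReal_nonneg (by positivity),
      ENNReal.ofReal_toReal hS, one_div]
  have hn := norm_mk_le hf hg hw (key ψ hψS hM) (key _ hgs fun x => by
    rw [norm_gradient']; exact hM' x) (by positivity)
  have he : embed Ω q q' w (W1.mk hf hg hw) = ∫ x in Ω, fn w x * ψ x := by
    rw [embed_apply]
    refine integral_congr_ae ?_
    filter_upwards [fn_mk hf hg hw] with x hx
    rw [hx]
  rw [← he, ← Real.norm_eq_abs]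
  exact ((embed Ω q q' w).le_opNorm _).trans (mul_le_mul_of_nonneg_left hn (norm_nonneg _))

end Sobolev

/-! ### Change of variables and estimates along curves -/

/-- The image measure of a set under a map with Lipschitz inverse is controlled by the volume. -/
lemma lintegral_comp_le_of_dist_le {B : Set E3} (hB : MeasurableSet B) {T : E3 → E3}
    (hT : ContinuousOn T B) {K : ℝ≥0} (hK : ∀ y ∈ B, ∀ z ∈ B, dist y z ≤ K * dist (T y) (T z))
    {F : E3 → ℝ≥0∞} (hF : Measurable F) :
    ∫⁻ y in B, F (T y) ≤ (K : ℝ≥0∞) ^ 3 * ∫⁻ z, F z := by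
  have hTm : AEMeasurable T (volume.restrict B) := hT.aemeasurable hB
  -- The claim becomes an inequality of measures: the image of volume on `B` under `T` is at most `K
  -- ^ 3` times volume.
  rw [← lintegral_map' hF.aemeasurable hTm, ← lintegral_const_mul _ hF, lintegral_const_mul _ hF,
    ← smul_eq_mul, ← lintegral_smul_measure]
  refine lintegral_mono' ?_ le_rfl
  refine Measure.le_iff.2 fun E hE => ?_
  rw [Measure.map_apply_of_aemeasurable hTm hE, Measure.restrict_apply' hB, Measure.smul_apply,
    smul_eq_mul]
  set S := T ⁻¹' E ∩ B with hS
  have hinj : InjOn T B := fun y hy z hz h => by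
    have := hK y hy z hz
    rw [h, dist_self, mul_zero] at this
    exact dist_le_zero.1 this
  have hlip : LipschitzOnWith K (Function.invFunOn T B) (T '' S) := by
    refine LipschitzOnWith.of_dist_le_mul ?_
    rintro _ ⟨y, hy, rfl⟩ _ ⟨z, hz, rfl⟩
    rw [hinj.leftInvOn_invFunOn hy.2, hinj.leftInvOn_invFunOn hz.2]
    exact hK y hy.2 z hz.2
  have himg : Function.invFunOn T B '' (T '' S) = S := by
    rw [image_image]
    exact (image_congr fun y hy => hinj.leftInvOn_invFunOn hy.2).trans (image_id' S)
  have h3 := hlip.hausdorffMeasure_image_le (d := 3) (by norm_num)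
  rw [himg] at h3
  have hH : (μH[3] : Measure E3).IsAddHaarMeasure := by
    have := isAddHaarMeasure_hausdorffMeasure (E := E3)
    simpa using this
  -- Volume is a constant multiple of `μH[3]`; the constant occurs on both sides, so only the
  -- Lipschitz factor `K ^ 3` of the inverse map remains.
  have hv := Measure.isAddLeftInvariant_eq_smul (volume : Measure E3) μH[3]
  rw [hv]
  simp only [Measure.smul_apply, ENNReal.smul_def, smul_eq_mul]
  rw [← mul_assoc, mul_comm ((K : ℝ≥0∞) ^ 3), mul_assoc]
  refine mul_le_mul_right ?_ _
  refine h3.trans ?_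
  have : (K : ℝ≥0∞) ^ (3 : ℝ) = (K : ℝ≥0∞) ^ 3 := by
    rw [← ENNReal.rpow_natCast]; norm_num
  rw [this]
  refine mul_le_mul_right (measure_mono ?_) _
  rintro _ ⟨y, hy, rfl⟩
  exact hy.1

/-- The increment of a `C¹` function along a Lipschitz curve is bounded by the integral of the
norm of its derivative. -/
lemma enorm_sub_le_lintegral_fderiv {f : E3 → ℝ} (hf : ContDiff ℝ 1 f) {γ : ℝ → E3} {K : ℝ≥0}
    (hγ : LipschitzOnWith K γ (Icc 0 1)) :
    ‖f (γ 1) - f (γ 0)‖ₑ ≤ K * ∫⁻ s in Ioc (0 : ℝ) 1, ‖fderiv ℝ f (γ s)‖ₑ := by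
  set e : ℝ → E3 := fun s => γ (projIcc 0 1 zero_le_one s) with he
  have hproj : ∀ s ∈ Icc (0 : ℝ) 1, e s = γ s := fun s hs => by
    simp [he, projIcc_of_mem zero_le_one hs]
  have hel : LipschitzWith K e := by
    have h1 : LipschitzWith K ((Icc (0 : ℝ) 1).domRestrict γ) := lipschitzOnWith_iff_restrict.1 hγ
    have := h1.comp (LipschitzWith.projIcc (zero_le_one (α := ℝ)))
    rwa [mul_one] at this
  set b : ℝ → ℝ := fun s => K * ‖fderiv ℝ f (e s)‖ with hb
  have hbc : Continuous b :=
    continuous_const.mul ((hf.continuous_fderiv (by simp)).comp hel.continuous).norm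
  have hB : ∀ s, HasDerivAt (fun s => ∫ u in (0 : ℝ)..s, b u) (b s) s := fun s =>
    intervalIntegral.integral_hasDerivAt_right (hbc.intervalIntegrable _ _)
      (hbc.stronglyMeasurableAtFilter _ _) hbc.continuousAt
  have hmain : |f (e 1) - f (e 0)| ≤ ∫ u in (0 : ℝ)..1, b u := by
    -- The curve is only Lipschitz, so the chain rule is replaced by a comparison of right slopes:
    -- near `e s` the function `f` is Lipschitz with any constant above the norm of its derivative
    -- there.
    refine image_le_of_liminf_slope_right_le_deriv_boundary (a := 0) (b := 1)
      (f := fun s => |f (e s) - f (e 0)|) (B := fun s => ∫ u in (0 : ℝ)..s, b u) (B' := b)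
      ?_ (by simp) (fun s _ => (hB s).continuousAt.continuousWithinAt)
      (fun s _ => (hB s).hasDerivWithinAt) ?_ (right_mem_Icc.2 zero_le_one)
    · exact ((hf.continuous.comp hel.continuous).sub continuous_const).abs.continuousOn
    · intro s _ r hr
      obtain ⟨M, hM1, hM2⟩ : ∃ M : ℝ≥0, ‖fderiv ℝ f (e s)‖₊ < M ∧ (K : ℝ) * M < r := by
        -- The increment is chosen so that multiplication by `K` uses at most half of the gap `r - b
        -- s`; the `+ 1` covers `K = 0`.
        refine ⟨‖fderiv ℝ f (e s)‖₊ + Real.toNNReal ((r - b s) / (2 * (K + 1))), ?_, ?_⟩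
        · refine lt_add_of_pos_right _ (Real.toNNReal_pos.2 ?_)
          have := sub_pos.2 hr
          positivity
        · have h0 : 0 < r - b s := sub_pos.2 hr
          have h1 : 0 ≤ (r - b s) / (2 * ((K : ℝ) + 1)) := by positivity
          rw [NNReal.coe_add, Real.coe_toNNReal _ h1, coe_nnnorm, mul_add]
          have h2 : (K : ℝ) * ((r - b s) / (2 * (K + 1))) ≤ (r - b s) / 2 := by
            rw [mul_div_assoc', div_le_div_iff₀ (by positivity) (by norm_num)]
            nlinarith [K.coe_nonneg]
          have h3 : (K : ℝ) * ‖fderiv ℝ f (e s)‖ = b s := rfl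
          linarith
      obtain ⟨U, hU, hUl⟩ :=
        ((hf.contDiffAt (x := e s)).hasStrictFDerivAt (by simp)).exists_lipschitzOnWith_of_nnnorm_lt
          M hM1
      have hev : ∀ᶠ z in 𝓝[>] s, e z ∈ U :=
        (hel.continuous.continuousAt.eventually hU).filter_mono nhdsWithin_le_nhds
      refine Eventually.frequently ?_
      filter_upwards [hev, self_mem_nhdsWithin] with z hz hzs
      have hzs : 0 < z - s := sub_pos.2 hzs
      rw [slope_def_field, div_lt_iff₀ hzs]
      have h1 : |f (e z) - f (e s)| ≤ M * (K * (z - s)) := by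
        have := hUl.dist_le_mul _ hz _ (mem_of_mem_nhds hU)
        rw [Real.dist_eq] at this
        refine this.trans (mul_le_mul_of_nonneg_left ?_ M.coe_nonneg)
        have := hel.dist_le_mul z s
        rwa [Real.dist_eq, abs_of_pos hzs] at this
      have h2 : |f (e z) - f (e 0)| - |f (e s) - f (e 0)| ≤ |f (e z) - f (e s)| := by
        have := abs_sub_abs_le_abs_sub (f (e z) - f (e 0)) (f (e s) - f (e 0))
        simpa using this
      calc _ ≤ M * (K * (z - s)) := h2.trans h1
        _ = (K * M) * (z - s) := by ring
        _ < r * (z - s) := mul_lt_mul_of_pos_right hM2 hzs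
  rw [hproj 1 (right_mem_Icc.2 zero_le_one), hproj 0 (left_mem_Icc.2 zero_le_one)] at hmain
  rw [← Real.norm_eq_abs, intervalIntegral.integral_of_le zero_le_one] at hmain
  have hbi : Integrable b (volume.restrict (Ioc 0 1)) := (hbc.integrableOn_Icc).mono_set Ioc_subset_Icc_self
  have h5 : ‖f (γ 1) - f (γ 0)‖ₑ ≤ ENNReal.ofReal (∫ u in Ioc (0 : ℝ) 1, b u) := by
    rw [← ofReal_norm]; exact ENNReal.ofReal_le_ofReal hmain
  rw [ofReal_integral_eq_lintegral_ofReal hbi (Eventually.of_forall fun u => by positivity)] at h5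
  refine h5.trans (le_of_eq ?_)
  rw [← lintegral_const_mul' _ _ ENNReal.coe_ne_top]
  refine setLIntegral_congr_fun measurableSet_Ioc fun s hs => ?_
  simp only [hb]
  rw [ENNReal.ofReal_mul K.coe_nonneg, ENNReal.ofReal_coe_nnreal, ofReal_norm,
    hproj s (Ioc_subset_Icc_self hs)]

/-! ### Convex charts -/

/-- A bi-Lipschitz map `φ` of an open set `V` onto a bounded convex set that contains the ball
`B(c, r)`. -/
structure IsConvexChart (V : Set E3) (φ : E3 → E3) (L : ℝ≥0) (c : E3) (r R : ℝ) : Prop where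
  isOpen : IsOpen V
  one_le : 1 ≤ L
  lip : LipschitzOnWith L φ V
  antilip : ∀ y ∈ V, ∀ z ∈ V, dist y z ≤ L * dist (φ y) (φ z)
  convex : Convex ℝ (φ '' V)
  r_pos : 0 < r
  ball_subset : Metric.ball c r ⊆ φ '' V
  bound : ∀ x ∈ V, dist (φ x) c ≤ R

/-- The preimage in `V` of the segment from `φ x` to `p`. -/
noncomputable def chartCurve (V : Set E3) (φ : E3 → E3) (x p : E3) (s : ℝ) : E3 :=
  Function.invFunOn φ V (AffineMap.lineMap (φ x) p s)

namespace IsConvexChart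

variable {V : Set E3} {φ : E3 → E3} {L : ℝ≥0} {c : E3} {r R : ℝ}

lemma injOn (h : IsConvexChart V φ L c r R) : InjOn φ V := fun y hy z hz e => by
  have := h.antilip y hy z hz
  rw [e, dist_self, mul_zero] at this
  exact dist_le_zero.1 this

lemma L_pos (h : IsConvexChart V φ L c r R) : (0 : ℝ) < L :=
  lt_of_lt_of_le one_pos (by exact_mod_cast h.one_le)

lemma inv_mem (_ : IsConvexChart V φ L c r R) {p : E3} (hp : p ∈ φ '' V) :
    Function.invFunOn φ V p ∈ V := Function.invFunOn_mem hp

lemma map_inv (_ : IsConvexChart V φ L c r R) {p : E3} (hp : p ∈ φ '' V) :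
    φ (Function.invFunOn φ V p) = p := Function.invFunOn_eq hp

lemma inv_map (h : IsConvexChart V φ L c r R) {x : E3} (hx : x ∈ V) :
    Function.invFunOn φ V (φ x) = x := h.injOn.leftInvOn_invFunOn hx

lemma lip_inv (h : IsConvexChart V φ L c r R) :
    LipschitzOnWith L (Function.invFunOn φ V) (φ '' V) := by
  refine LipschitzOnWith.of_dist_le_mul ?_
  rintro p hp p' hp'
  have := h.antilip _ (h.inv_mem hp) _ (h.inv_mem hp')
  rwa [h.map_inv hp, h.map_inv hp'] at this

lemma lineMap_mem (h : IsConvexChart V φ L c r R) {p p' : E3} (hp : p ∈ φ '' V)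
    (hp' : p' ∈ φ '' V) {s : ℝ} (hs : s ∈ Icc (0 : ℝ) 1) :
    AffineMap.lineMap p p' s ∈ φ '' V :=
  h.convex.segment_subset hp hp' (segment_eq_image_lineMap ℝ p p' ▸ mem_image_of_mem _ hs)

lemma center_mem (h : IsConvexChart V φ L c r R) : c ∈ φ '' V :=
  h.ball_subset (Metric.mem_ball_self h.r_pos)

lemma R_nonneg (h : IsConvexChart V φ L c r R) : 0 ≤ R := by
  obtain ⟨x, hx, _⟩ := h.center_mem
  exact dist_nonneg.trans (h.bound x hx)

/-- A connectedness argument, since nothing is known about `φ` outside `V`. In the ball around `y₀`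
the set `V` is open, and it is relatively closed: along a sequence in `V` converging in the ball the
images are Cauchy, their limit lies within `s` of `φ y₀` and hence in the image, and the Lipschitz
inverse carries it back into `V`. -/
lemma ball_subset_of_image (h : IsConvexChart V φ L c r R) {y₀ : E3} (hy₀ : y₀ ∈ V) {s : ℝ}
    (hs : 0 < s) (hb : Metric.ball (φ y₀) s ⊆ φ '' V) : Metric.ball y₀ (s / L) ⊆ V := by
  have hLp := h.L_pos
  have hpre : IsPreconnected (Metric.ball y₀ (s / L)) :=
    (convex_ball y₀ (s / L)).isPreconnected
  have hsub := hpre.subset_of_closure_inter_subset (u := V ∩ Metric.ball y₀ (s / L))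
    (h.isOpen.inter Metric.isOpen_ball)
    ⟨y₀, Metric.mem_ball_self (by positivity), hy₀, Metric.mem_ball_self (by positivity)⟩ ?_
  · exact hsub.trans inter_subset_left
  · rintro y ⟨hy, hyb⟩
    refine ⟨?_, hyb⟩
    obtain ⟨u, hu, hut⟩ := mem_closure_iff_seq_limit.1 hy
    have hc : CauchySeq (fun n => φ (u n)) := by
      have := hut.cauchySeq
      rw [Metric.cauchySeq_iff] at this ⊢
      intro ε hε
      obtain ⟨N, hN⟩ := this (ε / L) (by positivity)
      refine ⟨N, fun m hm n hn => ?_⟩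
      refine (h.lip.dist_le_mul _ (hu m).1 _ (hu n).1).trans_lt ?_
      have := hN m hm n hn
      rwa [lt_div_iff₀ hLp, mul_comm] at this
    obtain ⟨p, hp⟩ := cauchySeq_tendsto_of_complete hc
    have hpd : dist p (φ y₀) ≤ L * dist y y₀ :=
      le_of_tendsto_of_tendsto' (hp.dist tendsto_const_nhds)
        ((hut.dist tendsto_const_nhds).const_mul _) fun n => h.lip.dist_le_mul _ (hu n).1 _ hy₀
    have hpm : p ∈ φ '' V := hb (Metric.mem_ball.2 (hpd.trans_lt (by
      have := Metric.mem_ball.1 hyb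
      rwa [lt_div_iff₀ hLp, mul_comm] at this)))
    have hlim : Tendsto u atTop (𝓝 (Function.invFunOn φ V p)) := by
      rw [tendsto_iff_dist_tendsto_zero]
      refine squeeze_zero (fun _ => dist_nonneg) (fun n => ?_)
        (by simpa using (tendsto_iff_dist_tendsto_zero.1 hp).const_mul (L : ℝ))
      have := h.lip_inv.dist_le_mul _ (mem_image_of_mem φ (hu n).1) _ hpm
      rwa [h.inv_map (hu n).1] at this
    rw [tendsto_nhds_unique hut hlim]
    exact h.inv_mem hpm

/-- A point of `V` at distance of order `l` from `x` and from the complement of `V`. -/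
lemma cork_mem (h : IsConvexChart V φ L c r R) {x : E3} (hx : x ∈ V) {l : ℝ}
    (hl : l ∈ Ioc (0 : ℝ) 1) :
    chartCurve V φ x c l ∈ V ∧ φ (chartCurve V φ x c l) = AffineMap.lineMap (φ x) c l := by
  have := h.lineMap_mem (mem_image_of_mem φ hx) h.center_mem (Ioc_subset_Icc_self hl)
  exact ⟨h.inv_mem this, h.map_inv this⟩

/-- The homothety with centre `φ x` and ratio `l` maps `B(c, r)` onto the ball of radius `l * r`
around the image of the cork point, and convexity keeps that ball inside the image of `V`. Pulling
back costs the factor `L`. -/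
lemma cork_ball_subset (h : IsConvexChart V φ L c r R) {x : E3} (hx : x ∈ V) {l : ℝ}
    (hl : l ∈ Ioc (0 : ℝ) 1) :
    Metric.ball (chartCurve V φ x c l) (l * (r / L)) ⊆ V := by
  rw [← mul_div_assoc]
  refine h.ball_subset_of_image (h.cork_mem hx hl).1 (mul_pos hl.1 h.r_pos) ?_
  rw [(h.cork_mem hx hl).2]
  intro p hp
  rw [Metric.mem_ball, dist_eq_norm] at hp
  have hl0 : l ≠ 0 := hl.1.ne'
  set p' : E3 := c + l⁻¹ • (p - AffineMap.lineMap (φ x) c l) with hp'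
  have hp'm : p' ∈ φ '' V := by
    refine h.ball_subset ?_
    rw [Metric.mem_ball, dist_eq_norm, hp', add_sub_cancel_left, norm_smul, norm_inv,
      Real.norm_of_nonneg hl.1.le, inv_mul_lt_iff₀ hl.1]
    exact hp
  have : p = AffineMap.lineMap (φ x) p' l := by
    rw [hp']
    simp only [AffineMap.lineMap_apply_module, smul_add, smul_inv_smul₀ hl0]
    abel
  rw [this]
  exact h.lineMap_mem (mem_image_of_mem φ hx) hp'm (Ioc_subset_Icc_self hl)

/-- For fixed `l` the centre of averaging moves in a Lipschitz way with `x`; this gives the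
Lipschitz continuity of the averages in `estimate`. -/
lemma dist_cork_le (h : IsConvexChart V φ L c r R) {x y : E3} (hx : x ∈ V) (hy : y ∈ V) {l : ℝ}
    (hl : l ∈ Ioc (0 : ℝ) 1) :
    dist (chartCurve V φ x c l) (chartCurve V φ y c l) ≤ L * (L * dist x y) := by
  have hl' := Ioc_subset_Icc_self hl
  refine (h.lip_inv.dist_le_mul _ (h.lineMap_mem (mem_image_of_mem φ hx) h.center_mem hl') _
    (h.lineMap_mem (mem_image_of_mem φ hy) h.center_mem hl')).trans ?_
  refine mul_le_mul_of_nonneg_left ?_ h.L_pos.le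
  refine le_trans ?_ (h.lip.dist_le_mul x hx y hy)
  rw [dist_eq_norm, dist_eq_norm]
  have : AffineMap.lineMap (φ x) c l - AffineMap.lineMap (φ y) c l = (1 - l) • (φ x - φ y) := by
    simp only [AffineMap.lineMap_apply_module, smul_sub]
    abel
  rw [this, norm_smul, Real.norm_of_nonneg (by linarith [hl.2])]
  exact mul_le_of_le_one_left (norm_nonneg _) (by linarith [hl.1])

/-- The curves joining `x` to the points of the cork ball have speed of order `l`; this is one of
the powers of `l` in Morrey's estimate. -/
lemma dist_map_cork_le (h : IsConvexChart V φ L c r R) {x y : E3} (hx : x ∈ V) {l : ℝ}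
    (hl : l ∈ Ioc (0 : ℝ) 1) (hy : y ∈ Metric.ball (chartCurve V φ x c l) (l * (r / L))) :
    dist (φ x) (φ y) ≤ l * (R + r) := by
  have h1 : dist (φ x) (AffineMap.lineMap (φ x) c l) ≤ l * R := by
    rw [dist_left_lineMap, Real.norm_of_nonneg hl.1.le]
    exact mul_le_mul_of_nonneg_left (h.bound x hx) hl.1.le
  have h2 : dist (AffineMap.lineMap (φ x) c l) (φ y) ≤ l * r := by
    rw [← (h.cork_mem hx hl).2]
    refine (h.lip.dist_le_mul _ (h.cork_mem hx hl).1 _ (h.cork_ball_subset hx hl hy)).trans ?_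
    have := (Metric.mem_ball'.1 hy).le
    calc (L : ℝ) * _ ≤ L * (l * (r / L)) := mul_le_mul_of_nonneg_left this h.L_pos.le
      _ = l * r := by have := h.L_pos.ne'; field_simp
  calc _ ≤ _ := dist_triangle _ (AffineMap.lineMap (φ x) c l) _
    _ ≤ l * (R + r) := by rw [mul_add]; exact add_le_add h1 h2

lemma curve_mem (h : IsConvexChart V φ L c r R) {x y : E3} (hx : x ∈ V) (hy : y ∈ V) {s : ℝ}
    (hs : s ∈ Icc (0 : ℝ) 1) : chartCurve V φ x (φ y) s ∈ V :=
  h.inv_mem (h.lineMap_mem (mem_image_of_mem φ hx) (mem_image_of_mem φ hy) hs)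

lemma curve_zero (h : IsConvexChart V φ L c r R) {x : E3} (hx : x ∈ V) (y : E3) :
    chartCurve V φ x (φ y) 0 = x := by
  simp [chartCurve, h.inv_map hx]

lemma curve_one (h : IsConvexChart V φ L c r R) (x : E3) {y : E3} (hy : y ∈ V) :
    chartCurve V φ x (φ y) 1 = y := by
  simp [chartCurve, h.inv_map hy]

lemma lipschitzOnWith_curve (h : IsConvexChart V φ L c r R) {x y : E3} (hx : x ∈ V) (hy : y ∈ V)
    {D : ℝ≥0} (hD : dist (φ x) (φ y) ≤ D) :
    LipschitzOnWith (L * D) (chartCurve V φ x (φ y)) (Icc 0 1) := by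
  refine LipschitzOnWith.of_dist_le_mul fun s hs t ht => ?_
  refine (h.lip_inv.dist_le_mul _ (h.lineMap_mem (mem_image_of_mem φ hx) (mem_image_of_mem φ hy) hs)
    _ (h.lineMap_mem (mem_image_of_mem φ hx) (mem_image_of_mem φ hy) ht)).trans ?_
  rw [dist_lineMap_lineMap, NNReal.coe_mul, mul_assoc]
  refine mul_le_mul_of_nonneg_left ?_ h.L_pos.le
  rw [mul_comm]
  exact mul_le_mul_of_nonneg_right hD dist_nonneg

/-- In the chart, the map from the end point to the position at parameter `s` is a homothety of
ratio `s`. Its inverse has Lipschitz constant `L * L / s`, which controls the change of variables.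
-/
lemma dist_le_curve (h : IsConvexChart V φ L c r R) {x y z : E3} (hx : x ∈ V) (hy : y ∈ V)
    (hz : z ∈ V) {s : ℝ} (hs : s ∈ Ioc (0 : ℝ) 1) :
    dist y z ≤ (L * L / s) * dist (chartCurve V φ x (φ y) s) (chartCurve V φ x (φ z) s) := by
  have hs' := Ioc_subset_Icc_self hs
  have hmy := h.lineMap_mem (mem_image_of_mem φ hx) (mem_image_of_mem φ hy) hs'
  have hmz := h.lineMap_mem (mem_image_of_mem φ hx) (mem_image_of_mem φ hz) hs'
  have h1 := h.lip.dist_le_mul _ (h.inv_mem hmy) _ (h.inv_mem hmz)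
  rw [h.map_inv hmy, h.map_inv hmz] at h1
  have e : dist (AffineMap.lineMap (φ x) (φ y) s : E3) (AffineMap.lineMap (φ x) (φ z) s)
      = s * dist (φ y) (φ z) := by
    rw [dist_eq_norm, dist_eq_norm]
    have : (AffineMap.lineMap (φ x) (φ y) s : E3) - AffineMap.lineMap (φ x) (φ z) s
        = s • (φ y - φ z) := by
      simp only [AffineMap.lineMap_apply_module, smul_sub]
      abel
    rw [this, norm_smul, Real.norm_of_nonneg hs.1.le]
  rw [e] at h1
  calc dist y z ≤ L * dist (φ y) (φ z) := h.antilip y hy z hz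
    _ = (L / s) * (s * dist (φ y) (φ z)) := by have := hs.1.ne'; field_simp
    _ ≤ (L / s) * (L * dist (chartCurve V φ x (φ y) s) (chartCurve V φ x (φ z) s)) :=
        mul_le_mul_of_nonneg_left h1 (div_nonneg h.L_pos.le hs.1.le)
    _ = _ := by ring

lemma continuousOn_curve (h : IsConvexChart V φ L c r R) {x : E3} (hx : x ∈ V) :
    ContinuousOn (fun z : E3 × ℝ => chartCurve V φ x (φ z.1) z.2) (V ×ˢ Icc 0 1) := by
  have h1 : ContinuousOn (fun z : E3 × ℝ => (AffineMap.lineMap (φ x) (φ z.1) z.2 : E3))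
      (V ×ˢ Icc 0 1) := by
    have h2 : ContinuousOn (fun z : E3 × ℝ => φ z.1) (V ×ˢ Icc 0 1) :=
      h.lip.continuousOn.comp continuousOn_fst fun z hz => hz.1
    simp only [AffineMap.lineMap_apply_module]
    exact ((continuousOn_const.sub continuousOn_snd).smul continuousOn_const).add
      (continuousOn_snd.smul h2)
  exact h.lip_inv.continuousOn.comp h1 fun z hz =>
    h.lineMap_mem (mem_image_of_mem φ hx) (mem_image_of_mem φ hz.1) hz.2

end IsConvexChart

/-! ### Morrey's estimate in a convex chart -/

lemma lintegral_le_rpow_mul_measure {α : Type*} [MeasurableSpace α] {μ : Measure α} {F : α → ℝ≥0∞}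
    (hF : AEMeasurable F μ) {p : ℝ} (hp : 1 ≤ p) :
    ∫⁻ x, F x ∂μ ≤ (∫⁻ x, F x ^ p ∂μ) ^ (1 / p) * μ univ ^ (1 - 1 / p) := by
  have h := eLpNorm_le_eLpNorm_mul_rpow_measure_univ (μ := μ) (p := 1) (q := ENNReal.ofReal p)
    (f := F) (by simpa using hp) hF.aestronglyMeasurable
  rw [eLpNorm_one_eq_lintegral_enorm,
    eLpNorm_eq_lintegral_rpow_enorm_toReal (by simp; linarith) (by simp),
    ENNReal.toReal_ofReal (by linarith)] at h
  simpa using h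

lemma lintegral_rpow_neg_lt_top {a : ℝ} (ha : a < 1) :
    ∫⁻ s in Ioc (0 : ℝ) 1, ENNReal.ofReal (s ^ (-a)) < ⊤ := by
  have h := (intervalIntegral.intervalIntegrable_rpow' (a := 0) (b := 1) (r := -a) (by linarith)).1
  refine lt_of_le_of_lt (lintegral_mono fun s => ?_) h.2
  exact Real.ofReal_le_enorm _

lemma volume_ball_mul (x : E3) {l δ : ℝ} (hl : 0 ≤ l) (hδ : 0 ≤ δ) :
    volume (Metric.ball x (l * δ)) = ENNReal.ofReal (l ^ 3) *
      (ENNReal.ofReal (δ ^ 3) * volume (Metric.ball (0 : E3) 1)) := by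
  rw [Measure.addHaar_ball _ _ (mul_nonneg hl hδ), ← mul_assoc,
    ← ENNReal.ofReal_mul (by positivity), ← mul_pow]
  simp

namespace IsConvexChart

variable {V : Set E3} {φ : E3 → E3} {L : ℝ≥0} {c : E3} {r R : ℝ}

lemma closedBall_subset (h : IsConvexChart V φ L c r R) {x : E3} {l : ℝ}
    (hl : l ∈ Ioc (0 : ℝ) 1) :
    Metric.closedBall (chartCurve V φ x c l) (l * (r / (2 * L))) ⊆
      Metric.ball (chartCurve V φ x c l) (l * (r / L)) := by
  refine Metric.closedBall_subset_ball (mul_lt_mul_of_pos_left ?_ hl.1)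
  have := h.L_pos
  have := h.r_pos
  apply div_lt_div_of_pos_left <;> linarith

/-- The increment `f y - f x` is at most a multiple of `l` times the integral of the derivative
along the chart curve. For fixed `s`, Hölder's inequality in `y` gives the volume factor `l ^ (3 - 3
/ p)`, and the change of variables with constant `L * L / s` costs `s ^ (-(3 / p))`, which is
integrable on `(0, 1]` because `p > 3`. The majorant `g` is required only along the curves, since
the derivative of a mollification is controlled by the mollified weak gradient only away from the
boundary. -/
lemma morrey_contDiff (h : IsConvexChart V φ L c r R) {p : ℝ} (hp : 3 < p) :
    ∃ C : ℝ≥0, ∀ x ∈ V, ∀ l ∈ Ioc (0 : ℝ) 1, ∀ f : E3 → ℝ, ContDiff ℝ 1 f →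
      ∀ g : E3 → ℝ≥0∞, Measurable g →
      (∀ y ∈ Metric.ball (chartCurve V φ x c l) (l * (r / (2 * L))), ∀ s ∈ Ioc (0 : ℝ) 1,
        ‖fderiv ℝ f (chartCurve V φ x (φ y) s)‖ₑ ≤ g (chartCurve V φ x (φ y) s)) →
      ∫⁻ y in Metric.ball (chartCurve V φ x c l) (l * (r / (2 * L))), ‖f y - f x‖ₑ
        ≤ C * ENNReal.ofReal (l ^ (4 - 3 / p)) * (∫⁻ z, g z ^ p) ^ (1 / p) := by
  have hp0 : 0 < p := by linarith
  set δ := r / (2 * L) with hδ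
  have hδ0 : 0 < δ := div_pos h.r_pos (by have := h.L_pos; linarith)
  have hRr : 0 ≤ R + r := add_nonneg h.R_nonneg h.r_pos.le
  set I : ℝ≥0∞ := ∫⁻ s in Ioc (0 : ℝ) 1, ENNReal.ofReal (s ^ (-(3 / p))) with hI
  have hItop : I < ⊤ := lintegral_rpow_neg_lt_top (by rw [div_lt_one hp0]; exact hp)
  set w : ℝ≥0∞ := ENNReal.ofReal (δ ^ 3) * volume (Metric.ball (0 : E3) 1) with hw
  have hwtop : w ≠ ⊤ := ENNReal.mul_ne_top ENNReal.ofReal_ne_top measure_ball_lt_top.ne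
  have hexp : 0 ≤ 1 - 1 / p := by
    rw [sub_nonneg, div_le_one hp0]; linarith
  set C : ℝ≥0∞ := (L * ENNReal.ofReal (R + r)) * (ENNReal.ofReal ((L * L : ℝ) ^ (3 / p)) *
    w ^ (1 - 1 / p)) * I with hC
  have hCtop : C ≠ ⊤ := ENNReal.mul_ne_top (ENNReal.mul_ne_top
    (ENNReal.mul_ne_top ENNReal.coe_ne_top ENNReal.ofReal_ne_top)
    (ENNReal.mul_ne_top ENNReal.ofReal_ne_top (ENNReal.rpow_ne_top_of_nonneg hexp hwtop)))
    hItop.ne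
  refine ⟨C.toNNReal, fun x hx l hl f hf g hg hfg => ?_⟩
  rw [ENNReal.coe_toNNReal hCtop]
  set B := Metric.ball (chartCurve V φ x c l) (l * δ) with hB
  have hBV : B ⊆ V := (Metric.ball_subset_closedBall.trans (h.closedBall_subset hl)).trans
    (h.cork_ball_subset hx hl)
  have hBm : MeasurableSet B := Metric.isOpen_ball.measurableSet
  set G := (∫⁻ z, g z ^ p) ^ (1 / p) with hG
  set D : ℝ≥0 := Real.toNNReal (l * (R + r)) with hD
  have hDc : (D : ℝ) = l * (R + r) := Real.coe_toNNReal _ (mul_nonneg hl.1.le hRr)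
  set S : E3 → ℝ → E3 := fun y s => chartCurve V φ x (φ y) s with hS
  have h1 : ∀ y ∈ B, ‖f y - f x‖ₑ ≤ ((L * D : ℝ≥0) : ℝ≥0∞) * ∫⁻ s in Ioc (0 : ℝ) 1, g (S y s) := by
    intro y hy
    have hdist : dist (φ x) (φ y) ≤ D := by
      rw [hDc]
      exact h.dist_map_cork_le hx hl (h.closedBall_subset hl (Metric.ball_subset_closedBall hy))
    have := enorm_sub_le_lintegral_fderiv hf (h.lipschitzOnWith_curve hx (hBV hy) hdist)
    rw [h.curve_one x (hBV hy), h.curve_zero hx] at this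
    refine this.trans (mul_le_mul_right ?_ _)
    exact setLIntegral_mono' measurableSet_Ioc fun s hs => hfg y hy s hs
  have hSc : ContinuousOn (Function.uncurry S) (B ×ˢ Ioc 0 1) :=
    (h.continuousOn_curve hx).mono (prod_mono hBV Ioc_subset_Icc_self)
  have hSm : AEMeasurable (Function.uncurry fun y s => g (S y s))
      ((volume.restrict B).prod (volume.restrict (Ioc (0 : ℝ) 1))) := by
    rw [Measure.prod_restrict]
    exact hg.comp_aemeasurable (hSc.aemeasurable (hBm.prod measurableSet_Ioc))
  have hvB : volume B = ENNReal.ofReal (l ^ 3) * w := volume_ball_mul _ hl.1.le hδ0.le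
  have h2 : ∀ s ∈ Ioc (0 : ℝ) 1, ∫⁻ y in B, g (S y s) ≤
      ENNReal.ofReal (s ^ (-(3 / p))) * (ENNReal.ofReal ((L * L : ℝ) ^ (3 / p)) * G *
        (ENNReal.ofReal (l ^ 3) * w) ^ (1 - 1 / p)) := by
    intro s hs
    have hcs : ContinuousOn (fun y => S y s) B :=
      hSc.comp (f := fun y : E3 => (y, s)) (s := B) (by fun_prop) fun y hy => mk_mem_prod hy hs
    have hm : AEMeasurable (fun y => g (S y s)) (volume.restrict B) :=
      hg.comp_aemeasurable (hcs.aemeasurable hBm)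
    have h3 := lintegral_le_rpow_mul_measure hm (p := p) (by linarith)
    rw [Measure.restrict_apply_univ, hvB] at h3
    set K : ℝ≥0 := L * L / ⟨s, hs.1.le⟩ with hK
    have h4 := lintegral_comp_le_of_dist_le hBm hcs (K := K)
      (fun y hy z hz => h.dist_le_curve hx (hBV hy) (hBV hz) hs) (hg.pow_const p)
    have h5 : ((K : ℝ≥0∞) ^ 3 * ∫⁻ z, g z ^ p) ^ (1 / p)
        = ENNReal.ofReal (s ^ (-(3 / p))) * (ENNReal.ofReal ((L * L : ℝ) ^ (3 / p)) * G) := by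
      rw [ENNReal.mul_rpow_of_nonneg _ _ (by positivity), ← hG, ← mul_assoc]
      congr 1
      rw [← ENNReal.rpow_natCast, ← ENNReal.rpow_mul, ← ENNReal.ofReal_coe_nnreal,
        ENNReal.ofReal_rpow_of_nonneg K.coe_nonneg (by positivity),
        ← ENNReal.ofReal_mul (Real.rpow_nonneg hs.1.le _)]
      congr 1
      have : (K : ℝ) = L * L / s := rfl
      rw [this, Real.div_rpow (by positivity) hs.1.le, Real.rpow_neg hs.1.le]
      have e : ((3 : ℕ) : ℝ) * (1 / p) = 3 / p := by push_cast; ring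
      rw [e]
      ring
    refine h3.trans ?_
    refine (mul_le_mul_left (ENNReal.rpow_le_rpow h4 (by positivity)) _).trans (le_of_eq ?_)
    rw [h5]
    ring
  calc ∫⁻ y in B, ‖f y - f x‖ₑ
      ≤ ∫⁻ y in B, ((L * D : ℝ≥0) : ℝ≥0∞) * ∫⁻ s in Ioc (0 : ℝ) 1, g (S y s) :=
        setLIntegral_mono' hBm h1
    _ = ((L * D : ℝ≥0) : ℝ≥0∞) * ∫⁻ s in Ioc (0 : ℝ) 1, ∫⁻ y in B, g (S y s) := by
        rw [lintegral_const_mul' _ _ ENNReal.coe_ne_top, lintegral_lintegral_swap hSm]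
    _ ≤ ((L * D : ℝ≥0) : ℝ≥0∞) * ∫⁻ s in Ioc (0 : ℝ) 1, ENNReal.ofReal (s ^ (-(3 / p))) *
          (ENNReal.ofReal ((L * L : ℝ) ^ (3 / p)) * G *
            (ENNReal.ofReal (l ^ 3) * w) ^ (1 - 1 / p)) :=
        mul_le_mul_right (setLIntegral_mono' measurableSet_Ioc h2) _
    _ = ((L * D : ℝ≥0) : ℝ≥0∞) * (I * (ENNReal.ofReal ((L * L : ℝ) ^ (3 / p)) * G *
            (ENNReal.ofReal (l ^ 3) * w) ^ (1 - 1 / p))) := by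
        rw [lintegral_mul_const _ (by fun_prop)]
    _ = C * ENNReal.ofReal (l ^ (4 - 3 / p)) * G := by
        have e1 : ((L * D : ℝ≥0) : ℝ≥0∞) = L * (ENNReal.ofReal l * ENNReal.ofReal (R + r)) := by
          rw [ENNReal.coe_mul, ← ENNReal.ofReal_mul hl.1.le]
          rfl
        have e2 : (ENNReal.ofReal (l ^ 3) * w) ^ (1 - 1 / p)
            = ENNReal.ofReal (l ^ (3 - 3 / p)) * w ^ (1 - 1 / p) := by
          rw [ENNReal.mul_rpow_of_nonneg _ _ hexp,
            ENNReal.ofReal_rpow_of_nonneg (by have := hl.1; positivity) hexp,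
            ← Real.rpow_natCast, ← Real.rpow_mul hl.1.le]
          congr 3
          push_cast
          ring
        have e3 : ENNReal.ofReal (l ^ (4 - 3 / p))
            = ENNReal.ofReal l * ENNReal.ofReal (l ^ (3 - 3 / p)) := by
          rw [← ENNReal.ofReal_mul hl.1.le]
          congr 1
          rw [show 4 - 3 / p = 1 + (3 - 3 / p) by ring, Real.rpow_add hl.1, Real.rpow_one]
        rw [e1, e2, e3, hC]
        ring

/-- Morrey's estimate for Sobolev functions, at the points where the mollifications converge. -/
lemma morrey (h : IsConvexChart V φ L c r R) {Ω : Set E3} (hΩ : IsOpen Ω) (hΩv : volume Ω ≠ ⊤)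
    (hV : V ⊆ Ω) {q : ℝ≥0∞} [hq1 : Fact (1 ≤ q)] (hq : 3 < q) (hqt : q ≠ ⊤) :
    ∃ C : ℝ≥0, ∀ v : W1 Ω q, ∀ x ∈ V,
      Tendsto (fun n => mollify n (Ω.indicator (fn v)) x) atTop (𝓝 (fn v x)) →
      ∀ l ∈ Ioc (0 : ℝ) 1,
      ∫⁻ y in Metric.ball (chartCurve V φ x c l) (l * (r / (2 * L))), ‖fn v y - fn v x‖ₑ
        ≤ ENNReal.ofReal (C * l ^ (4 - 3 / q.toReal) * ‖v‖) := by
  have hp : 3 < q.toReal := by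
    have := (ENNReal.toReal_lt_toReal (by norm_num) hqt).2 hq
    simpa using this
  obtain ⟨C, hC⟩ := h.morrey_contDiff hp
  refine ⟨C, fun v x hx hlim l hl => ?_⟩
  have hfin : IsFiniteMeasure (volume.restrict Ω) := ⟨by
    rw [Measure.restrict_apply_univ]; exact hΩv.lt_top⟩
  have hfi : IntegrableOn (fn v) Ω := (memLp_fn v).integrable hq1.out
  have hgi : IntegrableOn (grad v) Ω := (memLp_grad v).integrable hq1.out
  have hfl : LocallyIntegrable (Ω.indicator (fn v)) volume :=
    ((integrable_indicator_iff hΩ.measurableSet).2 hfi).locallyIntegrable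
  have hgl : LocallyIntegrable (Ω.indicator (grad v)) volume :=
    ((integrable_indicator_iff hΩ.measurableSet).2 hgi).locallyIntegrable
  set B := Metric.ball (chartCurve V φ x c l) (l * (r / (2 * L))) with hB
  set Bc := Metric.closedBall (chartCurve V φ x c l) (l * (r / (2 * L))) with hBc
  have hBcV : Bc ⊆ V := (h.closedBall_subset hl).trans (h.cork_ball_subset hx hl)
  -- The compact set swept by all curves from `x` to the closed cork ball. It has a positive
  -- distance to the complement of `Ω`, so for large `n` the mollified gradient is the gradient of
  -- the mollification on every curve.
  set Kc := (fun z : E3 × ℝ => chartCurve V φ x (φ z.1) z.2) '' (Bc ×ˢ Icc 0 1) with hKc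
  have hKcc : IsCompact Kc := ((isCompact_closedBall _ _).prod isCompact_Icc).image_of_continuousOn
    ((h.continuousOn_curve hx).mono (prod_mono hBcV subset_rfl))
  have hKcΩ : Kc ⊆ Ω := by
    rintro _ ⟨z, hz, rfl⟩
    exact hV (h.curve_mem hx (hBcV hz.1) hz.2)
  obtain ⟨d, hd, hdΩ⟩ := hKcc.exists_cthickening_subset_open hΩ hKcΩ
  have hev : ∀ᶠ n in atTop, (mollifier n).rOut ≤ d :=
    (tendsto_mollifier_rOut.eventually (ge_mem_nhds hd))
  have hbound : ∀ᶠ n in atTop, ∫⁻ y in B, ‖mollify n (Ω.indicator (fn v)) y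
      - mollify n (Ω.indicator (fn v)) x‖ₑ ≤ ENNReal.ofReal (C * l ^ (4 - 3 / q.toReal) * ‖v‖) := by
    filter_upwards [hev] with n hn
    have hcd : ContDiff ℝ 1 (mollify n (Ω.indicator (fn v))) :=
      (contDiff_mollify n hfl).of_le (by simp)
    have hgm : Measurable fun z => ‖mollify n (Ω.indicator (grad v)) z‖ₑ :=
      (contDiff_mollify n hgl).continuous.enorm.measurable
    have h1 := hC x hx l hl _ hcd _ hgm (fun y hy s hs => ?_)
    · refine h1.trans ?_
      have h2 : (∫⁻ z, ‖mollify n (Ω.indicator (grad v)) z‖ₑ ^ q.toReal) ^ (1 / q.toReal)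
          ≤ ENNReal.ofReal ‖v‖ := by
        refine le_trans ?_ (eLpNorm_grad_le v)
        rw [← eLpNorm_indicator_eq_eLpNorm_restrict hΩ.measurableSet,
          eLpNorm_eq_lintegral_rpow_enorm_toReal (by rintro rfl; simp at hq) hqt]
        exact ENNReal.rpow_le_rpow (lintegral_mollify_rpow_le hgl.aestronglyMeasurable
          (by linarith) n) (by positivity)
      refine (mul_le_mul_right h2 _).trans (le_of_eq ?_)
      have := hl.1
      rw [ENNReal.ofReal_mul (by positivity), ENNReal.ofReal_mul (by positivity),
        ENNReal.ofReal_coe_nnreal]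
    · have hz : chartCurve V φ x (φ y) s ∈ Kc :=
        ⟨(y, s), ⟨Metric.ball_subset_closedBall hy, Ioc_subset_Icc_self hs⟩, rfl⟩
      have hsub : Metric.closedBall (chartCurve V φ x (φ y) s) (mollifier n).rOut ⊆ Ω :=
        (Metric.closedBall_subset_closedBall hn).trans
          ((Metric.closedBall_subset_cthickening hz d).trans hdΩ)
      rw [← ofReal_norm, ← ofReal_norm]
      refine ENNReal.ofReal_le_ofReal (ContinuousLinearMap.opNorm_le_bound _ (norm_nonneg _)
        fun w => ?_)
      rw [fderiv_mollify hΩ.measurableSet hfi hgi (hasWeakGradient_fn v) hsub]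
      exact norm_inner_le_norm _ _
  -- Convergence at `x` is assumed, at `y` it holds almost everywhere; Fatou's lemma then transfers
  -- the bound from the mollifications.
  have hae : ∀ᵐ y ∂volume.restrict B, Tendsto (fun n => ‖mollify n (Ω.indicator (fn v)) y
      - mollify n (Ω.indicator (fn v)) x‖ₑ) atTop (𝓝 ‖fn v y - fn v x‖ₑ) := by
    filter_upwards [ae_restrict_of_ae (ae_tendsto_mollify hfl),
      ae_restrict_mem Metric.isOpen_ball.measurableSet] with y hy hyB
    rw [indicator_of_mem (hV (hBcV (Metric.ball_subset_closedBall hyB)))] at hy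
    exact (hy.sub hlim).enorm
  calc ∫⁻ y in B, ‖fn v y - fn v x‖ₑ
      = ∫⁻ y in B, liminf (fun n => ‖mollify n (Ω.indicator (fn v)) y
          - mollify n (Ω.indicator (fn v)) x‖ₑ) atTop := by
        refine lintegral_congr_ae ?_
        filter_upwards [hae] with y hy using hy.liminf_eq.symm
    _ ≤ liminf (fun n => ∫⁻ y in B, ‖mollify n (Ω.indicator (fn v)) y
          - mollify n (Ω.indicator (fn v)) x‖ₑ) atTop :=
        lintegral_liminf_le fun n =>
          ((contDiff_mollify n hfl).continuous.sub continuous_const).enorm.measurable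
    _ ≤ _ := liminf_le_of_frequently_le' hbound.frequently

end IsConvexChart

/-! ### Averages against a scaled kernel -/

lemma exists_kernel {δ : ℝ} (hδ : 0 < δ) : ∃ (ζ : E3 → ℝ) (M : ℝ≥0), ContDiff ℝ ∞ ζ ∧
    tsupport ζ ⊆ Metric.closedBall 0 δ ∧ ∫ y, ζ y = 1 ∧ (∀ y, |ζ y| ≤ M) ∧ LipschitzWith M ζ := by
  let b : ContDiffBump (0 : E3) := ⟨δ / 2, δ, by positivity, by linarith⟩
  have hs : ContDiff ℝ ∞ (b.normed (volume : Measure E3)) := b.contDiff_normed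
  have hc := b.hasCompactSupport_normed (μ := (volume : Measure E3))
  obtain ⟨M1, hM1⟩ := hc.exists_bound_of_continuous hs.continuous
  obtain ⟨M2, hM2⟩ := (hs.of_le (by simp)).lipschitzWith_of_hasCompactSupport hc one_ne_zero
  have hM1' : 0 ≤ M1 := (norm_nonneg _).trans (hM1 0)
  refine ⟨b.normed volume, max M2 ⟨M1, hM1'⟩, hs, ?_, b.integral_normed, fun y => ?_,
    hM2.weaken (le_max_left _ _)⟩
  · rw [b.tsupport_normed_eq]
  · exact (hM1 y).trans (NNReal.coe_le_coe.2 (le_max_right M2 ⟨M1, hM1'⟩))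

/-- The kernel `ζ`, centered at `y₀` and scaled by `l`. -/
noncomputable def scaledKernel (ζ : E3 → ℝ) (l : ℝ) (y₀ y : E3) : ℝ :=
  l⁻¹ ^ 3 * ζ (l⁻¹ • (y - y₀))

section ScaledKernel

variable {ζ : E3 → ℝ} {M : ℝ≥0} {l δ : ℝ}

lemma contDiff_scaledKernel (hζ : ContDiff ℝ ∞ ζ) (y₀ : E3) :
    ContDiff ℝ ∞ (scaledKernel ζ l y₀) :=
  contDiff_const.mul (hζ.comp ((contDiff_id.sub contDiff_const).const_smul l⁻¹))

lemma tsupport_scaledKernel (hl : 0 < l) (hs : tsupport ζ ⊆ Metric.closedBall 0 δ) (y₀ : E3) :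
    tsupport (scaledKernel ζ l y₀) ⊆ Metric.closedBall y₀ (l * δ) := by
  refine closure_minimal (fun y hy => ?_) Metric.isClosed_closedBall
  have h1 : l⁻¹ • (y - y₀) ∈ tsupport ζ := subset_tsupport _ fun h0 => hy (by
    simp [scaledKernel, h0])
  have h2 := hs h1
  rw [mem_closedBall_zero_iff, norm_smul, norm_inv, Real.norm_of_nonneg hl.le,
    inv_mul_le_iff₀ hl] at h2
  rwa [Metric.mem_closedBall, dist_eq_norm]

lemma integral_scaledKernel (hl : 0 < l) (hζ : ∫ y, ζ y = 1) (y₀ : E3) :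
    ∫ y, scaledKernel ζ l y₀ y = 1 := by
  unfold scaledKernel
  rw [integral_const_mul, integral_sub_right_eq_self (fun y => ζ (l⁻¹ • y)) y₀,
    Measure.integral_comp_inv_smul, hζ]
  simp only [finrank_euclideanSpace, Fintype.card_fin, smul_eq_mul, mul_one]
  rw [abs_of_pos (by positivity), ← mul_pow, inv_mul_cancel₀ hl.ne', one_pow]

lemma abs_scaledKernel_le (hl : 0 < l) (hM : ∀ y, |ζ y| ≤ M) (y₀ y : E3) :
    |scaledKernel ζ l y₀ y| ≤ M * l⁻¹ ^ 3 := by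
  unfold scaledKernel
  rw [abs_mul, abs_of_pos (by positivity : (0 : ℝ) < l⁻¹ ^ 3), mul_comm]
  exact mul_le_mul_of_nonneg_right (hM _) (by positivity)

lemma abs_scaledKernel_sub_le (hl : 0 < l) (hM : LipschitzWith M ζ) (y₀ y y₀' y' : E3) :
    |scaledKernel ζ l y₀ y - scaledKernel ζ l y₀' y'| ≤ M * l⁻¹ ^ 4 * ‖(y - y₀) - (y' - y₀')‖ := by
  unfold scaledKernel
  rw [← mul_sub, abs_mul, abs_of_pos (by positivity : (0 : ℝ) < l⁻¹ ^ 3)]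
  have h1 := hM.dist_le_mul (l⁻¹ • (y - y₀)) (l⁻¹ • (y' - y₀'))
  rw [Real.dist_eq, dist_eq_norm, ← smul_sub, norm_smul, norm_inv, Real.norm_of_nonneg hl.le] at h1
  calc _ ≤ l⁻¹ ^ 3 * (M * (l⁻¹ * ‖(y - y₀) - (y' - y₀')‖)) :=
        mul_le_mul_of_nonneg_left h1 (by positivity)
    _ = _ := by ring

lemma norm_fderiv_scaledKernel_le (hl : 0 < l) (hM : LipschitzWith M ζ) (y₀ y : E3) :
    ‖fderiv ℝ (scaledKernel ζ l y₀) y‖ ≤ M * l⁻¹ ^ 4 := by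
  have h0 : 0 ≤ l⁻¹ ^ 4 := by positivity
  have : LipschitzWith (M * ⟨l⁻¹ ^ 4, h0⟩) (scaledKernel ζ l y₀) := by
    refine LipschitzWith.of_dist_le_mul fun y y' => ?_
    rw [Real.dist_eq, dist_eq_norm]
    refine (abs_scaledKernel_sub_le hl hM y₀ y y₀ y').trans (le_of_eq ?_)
    rw [sub_sub_sub_cancel_right]
    rfl
  exact norm_fderiv_le_of_lipschitz ℝ this

end ScaledKernel

/-! ### Continuity of Sobolev functions up to the boundary -/

/-- The points of `Ω` at which the mollifications of a Sobolev function converge to it. -/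
def goodSet {Ω : Set E3} {q : ℝ≥0∞} [Fact (1 ≤ q)] (v : W1 Ω q) : Set E3 :=
  {x | x ∈ Ω ∧ Tendsto (fun n => mollify n (Ω.indicator (fn v)) x) atTop (𝓝 (fn v x))}

lemma ae_mem_goodSet {Ω : Set E3} (hΩ : IsOpen Ω) (hΩv : volume Ω ≠ ⊤) {q : ℝ≥0∞}
    [hq1 : Fact (1 ≤ q)] (v : W1 Ω q) : ∀ᵐ x ∂volume.restrict Ω, x ∈ goodSet v := by
  have hfin : IsFiniteMeasure (volume.restrict Ω) := ⟨by
    rw [Measure.restrict_apply_univ]; exact hΩv.lt_top⟩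
  have hfi : IntegrableOn (fn v) Ω := (memLp_fn v).integrable hq1.out
  have hfl : LocallyIntegrable (Ω.indicator (fn v)) volume :=
    ((integrable_indicator_iff hΩ.measurableSet).2 hfi).locallyIntegrable
  filter_upwards [ae_restrict_of_ae (ae_tendsto_mollify hfl), ae_restrict_mem hΩ.measurableSet]
    with x hx hxΩ
  rw [indicator_of_mem hxΩ] at hx
  exact ⟨hxΩ, hx⟩

lemma one_div_toReal_conj {q q' : ℝ≥0∞} [ENNReal.HolderConjugate q q'] (hq : 1 < q) (hqt : q ≠ ⊤) :
    1 / q'.toReal = 1 - 1 / q.toReal := by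
  have h := ENNReal.HolderConjugate.inv_add_inv_eq_one q q'
  have h0 : q⁻¹ ≠ ⊤ := ENNReal.inv_ne_top.2 (by rintro rfl; simp at hq)
  have h1 : q'⁻¹ ≠ ⊤ := fun e => by rw [e] at h; simp at h
  have := congrArg ENNReal.toReal h
  rw [ENNReal.toReal_add h0 h1, ENNReal.toReal_inv, ENNReal.toReal_inv, ENNReal.toReal_one] at this
  rw [one_div, one_div]
  linarith

/-- The value at `x` is compared with the average `A v l x` against a kernel of scale `l` at the
cork point. By Morrey's estimate the difference is of order `l ^ (1 - 3/q) * ‖v‖`. The average is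
the functional `embed v` applied to a smooth function whose W^{1,q'} norm is of order `l⁻¹ ^ 4 * (l
^ 3) ^ (1/q') = l ^ (-1 - 3/q)`. For the uniform continuity, `l` is fixed so that the first error is
small; the averages are then Lipschitz in `x`. -/
lemma IsConvexChart.estimate {V : Set E3} {φ : E3 → E3} {L : ℝ≥0} {c : E3} {r R : ℝ}
    (h : IsConvexChart V φ L c r R) {Ω : Set E3} (hΩ : IsOpen Ω) (hΩv : volume Ω ≠ ⊤)
    (hV : V ⊆ Ω) {q q' : ℝ≥0∞} [hq1 : Fact (1 ≤ q)] [Fact (1 ≤ q')] [ENNReal.HolderConjugate q q']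
    (hq : 3 < q) (hqt : q ≠ ⊤) :
    ∃ C : ℝ, 0 ≤ C ∧ ∀ v : W1 Ω q,
      (∀ x ∈ V ∩ goodSet v, ∀ l ∈ Ioc (0 : ℝ) 1, |fn v x| ≤
        C * (l ^ (1 - 3 / q.toReal) * ‖v‖ + l ^ (-1 - 3 / q.toReal) * ‖embed Ω q q' v‖)) ∧
      UniformContinuousOn (fn v) (V ∩ goodSet v) := by
  have hp : 3 < q.toReal := by
    have := (ENNReal.toReal_lt_toReal (by norm_num) hqt).2 hq
    simpa using this
  have hfin : IsFiniteMeasure (volume.restrict Ω) := ⟨by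
    rw [Measure.restrict_apply_univ]; exact hΩv.lt_top⟩
  have hq1' : 1 / q'.toReal = 1 - 1 / q.toReal :=
    one_div_toReal_conj (lt_trans (by norm_num) hq) hqt
  obtain ⟨C₁, hC₁⟩ := h.morrey hΩ hΩv hV hq hqt
  set δ := r / (2 * L) with hδ
  have hδ0 : 0 < δ := div_pos h.r_pos (by have := h.L_pos; linarith)
  -- Half of the radius, so that the closed support of the scaled kernel stays in the open ball of
  -- Morrey's estimate.
  obtain ⟨ζ, M, hζs, hζt, hζi, hζb, hζl⟩ := exists_kernel (half_pos hδ0)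
  set k : ℝ → E3 → E3 → ℝ := fun l x => scaledKernel ζ l (chartCurve V φ x c l) with hk
  have hsupp : ∀ l ∈ Ioc (0 : ℝ) 1, ∀ x ∈ V, tsupport (k l x) ⊆
      Metric.ball (chartCurve V φ x c l) (l * δ) := by
    intro l hl x _
    refine (tsupport_scaledKernel hl.1 hζt _).trans (Metric.closedBall_subset_ball ?_)
    exact mul_lt_mul_of_pos_left (half_lt_self hδ0) hl.1
  have hBV : ∀ l ∈ Ioc (0 : ℝ) 1, ∀ x ∈ V, Metric.ball (chartCurve V φ x c l) (l * δ) ⊆ V := by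
    intro l hl x hx
    exact (Metric.ball_subset_closedBall.trans (h.closedBall_subset hl)).trans
      (h.cork_ball_subset hx hl)
  have hkc : ∀ l ∈ Ioc (0 : ℝ) 1, ∀ x ∈ V, HasCompactSupport (k l x) := fun l hl x hx =>
    (isCompact_closedBall _ _).of_isClosed_subset (isClosed_tsupport _)
      (tsupport_scaledKernel hl.1 hζt _)
  have hks : ∀ l x, ContDiff ℝ ∞ (k l x) := fun l x => contDiff_scaledKernel hζs _
  have hfi : ∀ v : W1 Ω q, IntegrableOn (fn v) Ω := fun v => (memLp_fn v).integrable hq1.out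
  have hint : ∀ v : W1 Ω q, ∀ l ∈ Ioc (0 : ℝ) 1, ∀ x,
      Integrable (fun y => fn v y * k l x y) (volume.restrict Ω) := fun v l hl x =>
    (hfi v).mul_bdd (hks l x).continuous.aestronglyMeasurable
      (Eventually.of_forall fun y => abs_scaledKernel_le hl.1 hζb _ y)
  set A : W1 Ω q → ℝ → E3 → ℝ := fun v l x => ∫ y in Ω, fn v y * k l x y with hA
  have hone : ∀ l ∈ Ioc (0 : ℝ) 1, ∀ x ∈ V, ∫ y in Ω, k l x y = 1 := by
    intro l hl x hx
    rw [setIntegral_eq_integral_of_forall_compl_eq_zero fun y hy =>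
      image_eq_zero_of_notMem_tsupport fun hy' => hy (hV (hBV l hl x hx (hsupp l hl x hx hy')))]
    exact integral_scaledKernel hl.1 hζi _
  have step1 : ∀ v : W1 Ω q, ∀ x ∈ V ∩ goodSet v, ∀ l ∈ Ioc (0 : ℝ) 1,
      |fn v x - A v l x| ≤ M * C₁ * (l ^ (1 - 3 / q.toReal) * ‖v‖) := by
    intro v x hx l hl
    have hl0 := hl.1
    have e : fn v x - A v l x = ∫ y in Ω, (fn v x - fn v y) * k l x y := by
      have hki : Integrable (fun y => k l x y) (volume.restrict Ω) :=
        ((hks l x).continuous.integrable_of_hasCompactSupport (hkc l hl x hx.1)).integrableOn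
      simp_rw [sub_mul]
      rw [integral_sub (hki.const_mul _) (hint v l hl x), integral_const_mul, hone l hl x hx.1,
        mul_one]
    have h1 : ‖fn v x - A v l x‖ₑ ≤ ENNReal.ofReal (M * l⁻¹ ^ 3) *
        ENNReal.ofReal (C₁ * l ^ (4 - 3 / q.toReal) * ‖v‖) := by
      rw [e]
      refine (enorm_integral_le_lintegral_enorm _).trans ?_
      refine le_trans ?_ (mul_le_mul_right (hC₁ v x hx.1 hx.2.2 l hl) _)
      rw [← lintegral_const_mul' _ _ ENNReal.ofReal_ne_top,
        ← lintegral_indicator Metric.isOpen_ball.measurableSet]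
      refine (lintegral_mono' Measure.restrict_le_self le_rfl).trans (lintegral_mono fun y => ?_)
      by_cases hy : y ∈ Metric.ball (chartCurve V φ x c l) (l * δ)
      · rw [indicator_of_mem hy, enorm_mul, mul_comm, ← enorm_neg (fn v x - fn v y), neg_sub]
        refine mul_le_mul_left ?_ _
        rw [← ofReal_norm]
        exact ENNReal.ofReal_le_ofReal (abs_scaledKernel_le hl.1 hζb _ y)
      · have : k l x y = 0 := image_eq_zero_of_notMem_tsupport fun hy' => hy (hsupp l hl x hx.1 hy')
        simp [this]
    rw [← ofReal_norm, ← ENNReal.ofReal_mul (by positivity),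
      ENNReal.ofReal_le_ofReal_iff (by positivity)] at h1
    refine h1.trans (le_of_eq ?_)
    have e4 : l ^ (4 - 3 / q.toReal) = l ^ 3 * l ^ (1 - 3 / q.toReal) := by
      rw [← Real.rpow_natCast, ← Real.rpow_add hl.1]
      congr 1
      push_cast
      ring
    rw [e4]
    field_simp
  set w : ℝ := (δ / 2) ^ 3 * (volume (Metric.ball (0 : E3) 1)).toReal with hw
  have hw0 : 0 ≤ w := by positivity
  have step2 : ∀ v : W1 Ω q, ∀ x ∈ V, ∀ l ∈ Ioc (0 : ℝ) 1,
      |A v l x| ≤ M * w ^ (1 / q'.toReal) * (l ^ (-1 - 3 / q.toReal) * ‖embed Ω q q' v‖) := by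
    intro v x hx l hl
    have hl0 := hl.1
    have hvol : (volume (Metric.closedBall (chartCurve V φ x c l) (l * (δ / 2)))).toReal
        = l ^ 3 * w := by
      rw [Measure.addHaar_closedBall_eq_addHaar_ball, volume_ball_mul _ hl0.le (by positivity),
        ENNReal.toReal_mul, ENNReal.toReal_mul, ENNReal.toReal_ofReal (by positivity),
        ENNReal.toReal_ofReal (by positivity)]
    -- One bound `M * l⁻¹ ^ 4` serves for the kernel and its derivative: the kernel itself is
    -- bounded by `M * l⁻¹ ^ 3`, and `l ≤ 1`.
    have h1 := abs_setIntegral_mul_le (q' := q') (ψ := k l x) ((hks l x).of_le (by simp))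
      (hkc l hl x hx) (S := Metric.closedBall (chartCurve V φ x c l) (l * (δ / 2)))
      measure_closedBall_lt_top.ne (tsupport_scaledKernel hl.1 hζt _) (M := M * l⁻¹ ^ 4)
      (fun y => (abs_scaledKernel_le hl.1 hζb _ y).trans (mul_le_mul_of_nonneg_left
        (pow_le_pow_right₀ ((one_le_inv₀ hl0).2 hl.2) (by norm_num)) M.coe_nonneg))
      (fun y => norm_fderiv_scaledKernel_le hl.1 hζl _ y) v
    rw [hvol] at h1
    refine h1.trans (le_of_eq ?_)
    have e4 : l⁻¹ ^ 4 * (l ^ 3) ^ (1 / q'.toReal) = l ^ (-1 - 3 / q.toReal) := by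
      rw [hq1', ← Real.rpow_natCast l 3, ← Real.rpow_mul hl0.le, inv_pow, ← Real.rpow_natCast l 4,
        ← Real.rpow_neg hl0.le, ← Real.rpow_add hl0]
      congr 1
      push_cast
      ring
    rw [Real.mul_rpow (by positivity) hw0, ← e4]
    ring
  refine ⟨max (M * C₁) (M * w ^ (1 / q'.toReal)), le_max_of_le_left (by positivity),
    fun v => ⟨fun x hx l hl => ?_, ?_⟩⟩
  · have hl0 := hl.1
    have h1 := step1 v x hx l hl
    have h2 := step2 v x hx.1 l hl
    have h3 : |fn v x| ≤ |fn v x - A v l x| + |A v l x| := by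
      have := abs_add_le (fn v x - A v l x) (A v l x)
      rwa [sub_add_cancel] at this
    rw [mul_add]
    refine h3.trans (add_le_add (h1.trans ?_) (h2.trans ?_))
    · exact mul_le_mul_of_nonneg_right (le_max_left _ _) (by positivity)
    · exact mul_le_mul_of_nonneg_right (le_max_right _ _) (by positivity)
  · rw [Metric.uniformContinuousOn_iff]
    intro ε hε
    obtain ⟨l, hl, hlε⟩ : ∃ l ∈ Ioc (0 : ℝ) 1,
        M * C₁ * (l ^ (1 - 3 / q.toReal) * ‖v‖) < ε / 3 := by
      have hβ : 0 < 1 - 3 / q.toReal := by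
        rw [sub_pos, div_lt_one (by linarith)]; exact hp
      have ht : Tendsto (fun l : ℝ => M * C₁ * (l ^ (1 - 3 / q.toReal) * ‖v‖)) (𝓝[>] 0)
          (𝓝 (M * C₁ * (0 * ‖v‖))) := by
        refine (Tendsto.mul_const _ ?_).const_mul _
        have := (Real.continuousAt_rpow_const 0 (1 - 3 / q.toReal) (Or.inr hβ.le)).tendsto
        rw [Real.zero_rpow hβ.ne'] at this
        exact this.mono_left nhdsWithin_le_nhds
      have hlt : M * C₁ * (0 * ‖v‖) < ε / 3 := by rw [zero_mul, mul_zero]; positivity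
      have h1 := ht.eventually (gt_mem_nhds hlt)
      obtain ⟨l, hl1, hl2⟩ := (h1.and (Ioc_mem_nhdsGT one_pos)).exists
      exact ⟨l, hl2, hl1⟩
    have hl0 := hl.1
    set I := ∫ y in Ω, |fn v y| with hI
    have hI0 : 0 ≤ I := integral_nonneg fun _ => abs_nonneg _
    set K := M * l⁻¹ ^ 4 * (L * L) * I with hK
    have hK0 : 0 ≤ K := by positivity
    have hAl : ∀ x ∈ V, ∀ y ∈ V, |A v l x - A v l y| ≤ K * dist x y := by
      intro x hx y hy
      rw [hA]
      simp only
      rw [← integral_sub (hint v l hl x) (hint v l hl y), ← Real.norm_eq_abs]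
      have hb : ∀ z, ‖fn v z * k l x z - fn v z * k l y z‖
          ≤ |fn v z| * (M * l⁻¹ ^ 4 * (L * L) * dist x y) := by
        intro z
        rw [← mul_sub, norm_mul, Real.norm_eq_abs, Real.norm_eq_abs]
        refine mul_le_mul_of_nonneg_left ?_ (abs_nonneg _)
        refine (abs_scaledKernel_sub_le hl0 hζl _ z _ z).trans ?_
        rw [sub_sub_sub_cancel_left, ← dist_eq_norm, dist_comm, mul_assoc _ (_ * _ : ℝ) (dist x y)]
        refine mul_le_mul_of_nonneg_left ?_ (by positivity)
        exact (h.dist_cork_le hx hy hl).trans_eq (by ring)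
      refine (norm_integral_le_of_norm_le ((hfi v).abs.mul_const _)
        (Eventually.of_forall hb)).trans (le_of_eq ?_)
      rw [integral_mul_const]
      ring
    refine ⟨ε / 3 / (K + 1), by positivity, fun x hx y hy hxy => ?_⟩
    have h1 := (step1 v x hx l hl).trans_lt hlε
    have h2 := (step1 v y hy l hl).trans_lt hlε
    have h3 : |A v l x - A v l y| < ε / 3 := by
      refine (hAl x hx.1 y hy.1).trans_lt ?_
      rw [lt_div_iff₀ (by positivity)] at hxy
      nlinarith [dist_nonneg (x := x) (y := y)]
    rw [Real.dist_eq]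
    rw [abs_lt] at *
    constructor <;> linarith [h1.1, h1.2, h2.1, h2.2, h3.1, h3.2]

/-! ### Charts of a Lipschitz domain -/

lemma convex_lowerCube (a : ℝ) : Convex ℝ (lowerCube a) := by
  intro x hx y hy s t hs ht hst
  refine ⟨fun i => ?_, ?_⟩
  · rw [abs_lt]
    exact convex_Ioo (-(a / 2)) (a / 2) (abs_lt.1 (hx.1 i)) (abs_lt.1 (hy.1 i)) hs ht hst
  · exact convex_Iio (0 : ℝ) hx.2 hy.2 hs ht hst

lemma convex_lowerCube_union_plate (a : ℝ) : Convex ℝ (lowerCube a ∪ plate a) := by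
  have e : lowerCube a ∪ plate a = {y | y ∈ cube a ∧ y 2 ≤ 0} := by
    ext y
    simp only [lowerCube, plate, mem_union, mem_ofPred_eq, ← and_or_left, le_iff_lt_or_eq]
  rw [e]
  intro x hx y hy s t hs ht hst
  refine ⟨fun i => ?_, ?_⟩
  · rw [abs_lt]
    exact convex_Ioo (-(a / 2)) (a / 2) (abs_lt.1 (hx.1 i)) (abs_lt.1 (hy.1 i)) hs ht hst
  · exact convex_Iic (0 : ℝ) hx.2 hy.2 hs ht hst

lemma convex_lowerCube_union_halfPlate (a : ℝ) : Convex ℝ (lowerCube a ∪ halfPlate a) := by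
  have e : lowerCube a ∪ halfPlate a
      = {y | y ∈ cube a ∧ (y 2 < 0 ∨ y 2 = 0 ∧ y 1 ≤ 0)} := by
    ext y
    simp only [lowerCube, halfPlate, mem_union, mem_ofPred_eq, ← and_or_left]
  rw [e]
  intro x hx y hy s t hs ht hst
  refine ⟨fun i => ?_, ?_⟩
  · rw [abs_lt]
    exact convex_Ioo (-(a / 2)) (a / 2) (abs_lt.1 (hx.1 i)) (abs_lt.1 (hy.1 i)) hs ht hst
  · simp only [PiLp.add_apply, PiLp.smul_apply, smul_eq_mul]
    -- With both weights positive, a combination lies strictly below the plate unless both points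
    -- are on it; on the plate the condition on the coordinate 1 is convex.
    rcases hs.eq_or_lt with rfl | hs'
    · have : t = 1 := by linarith
      subst this
      simpa using hy.2
    rcases ht.eq_or_lt with rfl | ht'
    · have : s = 1 := by linarith
      subst this
      simpa using hx.2
    rcases hx.2 with hx2 | ⟨hx2, hx1⟩ <;> rcases hy.2 with hy2 | ⟨hy2, hy1⟩
    · left; nlinarith
    · left; rw [hy2]; nlinarith
    · left; rw [hx2]; nlinarith
    · right; rw [hx2, hy2]; constructor
      · ring
      · nlinarith

/-- The center of the lower half cube. -/
noncomputable def lowerCenter (a : ℝ) : E3 := EuclideanSpace.single 2 (-(a / 4))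

lemma ball_lowerCenter_subset {a : ℝ} (ha : 0 < a) :
    Metric.ball (lowerCenter a) (a / 4) ⊆ lowerCube a := by
  intro y hy
  rw [Metric.mem_ball, dist_eq_norm] at hy
  have h : ∀ i, |y i - lowerCenter a i| < a / 4 := fun i => by
    have := (PiLp.norm_apply_le (y - lowerCenter a) i).trans_lt hy
    rwa [Real.norm_eq_abs, PiLp.sub_apply] at this
  have h0 := h 0
  have h1 := h 1
  have h2 := h 2
  simp only [lowerCenter, PiLp.single_apply, Fin.reduceEq, if_false, if_true, sub_zero] at h0 h1 h2
  rw [abs_lt] at h0 h1 h2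
  refine ⟨fun i => ?_, by linarith [h2.2]⟩
  rw [abs_lt]
  fin_cases i
  · exact ⟨by dsimp; linarith [h0.1], by dsimp; linarith [h0.2]⟩
  · exact ⟨by dsimp; linarith [h1.1], by dsimp; linarith [h1.2]⟩
  · exact ⟨by dsimp; linarith [h2.1], by dsimp; linarith [h2.2]⟩

lemma exists_chart {Ω : Set E3} (h : IsLipschitzDomain Ω) {x : E3} (hx : x ∈ closure Ω) :
    ∃ (U : Set E3) (φ : E3 → E3) (L : ℝ≥0) (c : E3) (r R : ℝ), IsOpen U ∧ x ∈ U ∧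
      IsConvexChart (U ∩ Ω) φ L c r R := by
  by_cases hxΩ : x ∈ Ω
  · obtain ⟨ε, hε, hb⟩ := Metric.isOpen_iff.1 h.isOpen x hxΩ
    refine ⟨Metric.ball x ε, id, 1, x, ε, ε, Metric.isOpen_ball, Metric.mem_ball_self hε, ?_⟩
    rw [inter_eq_left.2 hb]
    exact {
      isOpen := Metric.isOpen_ball
      one_le := le_rfl
      lip := LipschitzWith.id.lipschitzOnWith
      antilip := fun y _ z _ => by simp
      convex := by rw [image_id]; exact convex_ball x ε
      r_pos := hε
      ball_subset := by rw [image_id]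
      bound := fun y hy => (Metric.mem_ball.1 hy).le }
  · have hxf : x ∈ frontier Ω := ⟨hx, by rwa [h.isOpen.interior_eq]⟩
    obtain ⟨U, a, φ, L₁, L₂, hU, hxU, ha, h1, h2, h3, h4, h5⟩ := h.lipschitz x hxf
    -- None of the three alternatives has to be excluded: all three model sets are convex and
    -- contain the lower half cube.
    rw [union_empty, inter_comm Ω U] at h5
    have hlip : LipschitzOnWith (max 1 (max L₁ L₂)) φ (U ∩ Ω) :=
      LipschitzOnWith.of_dist_le_mul fun y hy z hz => (h1 y hy.1 z hz.1).trans
        (mul_le_mul_of_nonneg_right (NNReal.coe_le_coe.2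
          ((le_max_left L₁ L₂).trans (le_max_right 1 (max L₁ L₂)))) dist_nonneg)
    have hbdd : Bornology.IsBounded (φ '' (U ∩ Ω)) := by
      obtain ⟨D, hD⟩ := Metric.isBounded_iff.1 h.isBounded
      refine Metric.isBounded_iff.2 ⟨(max 1 (max L₁ L₂) : ℝ≥0) * D, ?_⟩
      rintro _ ⟨y, hy, rfl⟩ _ ⟨z, hz, rfl⟩
      exact (hlip.dist_le_mul y hy z hz).trans
        (mul_le_mul_of_nonneg_left (hD hy.2 hz.2) (NNReal.coe_nonneg _))
    obtain ⟨R, hR⟩ := hbdd.subset_closedBall (lowerCenter a)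
    refine ⟨U, φ, max 1 (max L₁ L₂), lowerCenter a, a / 4, R, hU, hxU, ?_⟩
    exact {
      isOpen := hU.inter h.isOpen
      one_le := le_max_left _ _
      lip := hlip
      antilip := fun y hy z hz => (h2 y hy.1 z hz.1).trans
        (mul_le_mul_of_nonneg_right (NNReal.coe_le_coe.2
          ((le_max_right L₁ L₂).trans (le_max_right 1 (max L₁ L₂)))) dist_nonneg)
      convex := by
        rcases h5 with h5 | h5 | h5 <;> rw [h5]
        · exact convex_lowerCube a
        · exact convex_lowerCube_union_plate a
        · exact convex_lowerCube_union_halfPlate a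
      r_pos := by positivity
      ball_subset := by
        refine (ball_lowerCenter_subset ha).trans ?_
        -- In the first alternative the rewriting already closes the goal by reflexivity, so two
        -- cases remain.
        rcases h5 with h5 | h5 | h5 <;> rw [h5]
        · exact subset_union_left
        · exact subset_union_left
      bound := fun y hy => hR (mem_image_of_mem φ hy) }

lemma volume_ne_top {Ω : Set E3} (h : IsLipschitzDomain Ω) : volume Ω ≠ ⊤ :=
  h.isBounded.measure_lt_top.ne

lemma isCompact_closure {Ω : Set E3} (h : IsLipschitzDomain Ω) : IsCompact (closure Ω) :=
  h.isBounded.isCompact_closure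

/-- A property that holds almost everywhere in an open set holds on a dense subset. -/
lemma closure_subset_of_ae {Ω G : Set E3} (hΩ : IsOpen Ω)
    (hG : ∀ᵐ x ∂volume.restrict Ω, x ∈ G) : closure Ω ⊆ closure (Ω ∩ G) := by
  refine closure_minimal (fun x hx => ?_) isClosed_closure
  rw [mem_closure_iff]
  intro o ho hxo
  by_contra hne
  have h1 : (volume.restrict Ω) (o ∩ Ω) = 0 := by
    have hsub : o ∩ Ω ⊆ {y | y ∉ G} := fun y hy hyG => hne ⟨y, hy.1, hy.2, hyG⟩
    exact measure_mono_null hsub (ae_iff.1 hG)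
  rw [Measure.restrict_apply (ho.inter hΩ).measurableSet, inter_assoc, inter_self] at h1
  exact ((ho.inter hΩ).measure_pos volume ⟨x, hxo, hx⟩).ne' h1

/-- For `q > 3`, functions in `W^{1,q}` of a Lipschitz domain are continuous up to the boundary,
and their maximum is controlled through the norms of `W^{1,q}` and `W^{-1,q}`. -/
theorem exists_continuous_rep {Ω : Set E3} (h : IsLipschitzDomain Ω) {q q' : ℝ≥0∞}
    [hq1 : Fact (1 ≤ q)] [Fact (1 ≤ q')] [ENNReal.HolderConjugate q q'] (hq : 3 < q)
    (hqt : q ≠ ⊤) :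
    ∃ C : ℝ, 0 ≤ C ∧ ∀ v : W1 Ω q, ∃ g : E3 → ℝ, ContinuousOn g (closure Ω) ∧
      fn v =ᵐ[volume.restrict Ω] g ∧ ∀ x ∈ closure Ω, ∀ l ∈ Ioc (0 : ℝ) 1, |g x| ≤
        C * (l ^ (1 - 3 / q.toReal) * ‖v‖ + l ^ (-1 - 3 / q.toReal) * ‖embed Ω q q' v‖) := by
  have hv := volume_ne_top h
  obtain ⟨C, hC0, hC⟩ : ∃ C : ℝ, 0 ≤ C ∧ ∀ v : W1 Ω q, ∀ x ∈ closure Ω ∩ goodSet v,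
      ∀ l ∈ Ioc (0 : ℝ) 1, |fn v x| ≤
        C * (l ^ (1 - 3 / q.toReal) * ‖v‖ + l ^ (-1 - 3 / q.toReal) * ‖embed Ω q q' v‖) := by
    -- Compactness reduces the estimate to finitely many charts, with the maximum of their
    -- constants.
    refine (isCompact_closure h).induction_on (p := fun s => ∃ C : ℝ, 0 ≤ C ∧ ∀ v : W1 Ω q,
      ∀ x ∈ s ∩ goodSet v, ∀ l ∈ Ioc (0 : ℝ) 1, |fn v x| ≤
        C * (l ^ (1 - 3 / q.toReal) * ‖v‖ + l ^ (-1 - 3 / q.toReal) * ‖embed Ω q q' v‖))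
      ?_ ?_ ?_ ?_
    · exact ⟨0, le_rfl, fun v x hx => hx.1.elim⟩
    · rintro s t hst ⟨C, hC0, hC⟩
      exact ⟨C, hC0, fun v x hx => hC v x ⟨hst hx.1, hx.2⟩⟩
    · rintro s t ⟨C, hC0, hC⟩ ⟨C', hC0', hC'⟩
      refine ⟨max C C', le_max_of_le_left hC0, fun v x hx l hl => ?_⟩
      have hl0 := hl.1
      rcases hx.1 with hx1 | hx1
      · exact (hC v x ⟨hx1, hx.2⟩ l hl).trans
          (mul_le_mul_of_nonneg_right (le_max_left _ _) (by positivity))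
      · exact (hC' v x ⟨hx1, hx.2⟩ l hl).trans
          (mul_le_mul_of_nonneg_right (le_max_right _ _) (by positivity))
    · intro x hx
      obtain ⟨U, φ, L, c, r, R, hU, hxU, hch⟩ := exists_chart h hx
      obtain ⟨C, hC0, hC⟩ := hch.estimate h.isOpen hv inter_subset_right hq hqt (q' := q')
      exact ⟨U, mem_nhdsWithin_of_mem_nhds (hU.mem_nhds hxU), C, hC0, fun v y hy =>
        (hC v).1 y ⟨⟨hy.1, hy.2.1⟩, hy.2⟩⟩
  refine ⟨C, hC0, fun v => ?_⟩
  have hgood := ae_mem_goodSet h.isOpen hv v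
  have hdense : closure Ω ⊆ closure (goodSet v) :=
    (closure_subset_of_ae h.isOpen hgood).trans (closure_mono inter_subset_right)
  -- Near `x` the good points lie in one chart, where the function is uniformly continuous; Cauchy
  -- filters map to Cauchy filters, which gives the limit defining the extension.
  have hlim : ∀ x ∈ closure Ω, ∃ y, Tendsto (fn v) (𝓝[goodSet v] x) (𝓝 y) := by
    intro x hx
    obtain ⟨U, φ, L, c, r, R, hU, hxU, hch⟩ := exists_chart h hx
    obtain ⟨_, _, hC⟩ := hch.estimate h.isOpen hv inter_subset_right hq hqt (q' := q')
    have huc := (hC v).2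
    have hne : (𝓝[goodSet v] x).NeBot := mem_closure_iff_nhdsWithin_neBot.1 (hdense hx)
    have hc : Cauchy (𝓝[goodSet v] x) := cauchy_nhds.mono nhdsWithin_le_nhds
    have hle : 𝓝[goodSet v] x ≤ 𝓟 (U ∩ Ω ∩ goodSet v) := by
      rw [le_principal_iff]
      filter_upwards [mem_nhdsWithin_of_mem_nhds (hU.mem_nhds hxU), self_mem_nhdsWithin]
        with y hy1 hy2 using ⟨⟨hy1, hy2.1⟩, hy2⟩
    exact CompleteSpace.complete (hc.map_of_le huc hle)
  have hcont := continuousOn_extendFrom hdense hlim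
  have hself : ∀ x ∈ goodSet v, extendFrom (goodSet v) (fn v) x = fn v x := by
    intro x hx
    obtain ⟨y, hy⟩ := hlim x (subset_closure hx.1)
    have h1 : y = fn v x := by
      have h2 : Tendsto (fn v) (pure x) (𝓝 y) :=
        hy.mono_left (by
          refine le_inf (pure_le_nhds x) ?_
          simpa using hx)
      exact (tendsto_nhds_unique (tendsto_pure_nhds (fn v) x) h2).symm
    rw [extendFrom_eq (subset_closure hx) hy, h1]
  refine ⟨extendFrom (goodSet v) (fn v), hcont, ?_, fun x hx l hl => ?_⟩
  · filter_upwards [hgood] with x hx using (hself x hx).symm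
  · have hne : (𝓝[goodSet v] x).NeBot := mem_closure_iff_nhdsWithin_neBot.1 (hdense hx)
    have ht : Tendsto (extendFrom (goodSet v) (fn v)) (𝓝[goodSet v] x)
        (𝓝 (extendFrom (goodSet v) (fn v) x)) :=
      (hcont x hx).mono_left (nhdsWithin_mono x fun y hy => subset_closure hy.1)
    refine le_of_tendsto ht.abs ?_
    filter_upwards [self_mem_nhdsWithin] with y hy
    rw [hself y hy]
    exact hC v y ⟨subset_closure hy.1, hy⟩ l hl

/-! ### Traces and the boundary measure -/

/-- The trace of a function that is continuous up to the boundary is its boundary value. -/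
lemma trace_eq {Ω : Set E3} (hΩ : IsOpen Ω) {f g : E3 → ℝ} (hg : ContinuousOn g (closure Ω))
    (hfg : f =ᵐ[volume.restrict Ω] g) {x : E3} (hx : x ∈ closure Ω) : trace Ω f x = g x := by
  refine Tendsto.limUnder_eq ?_
  rw [Metric.tendsto_nhds]
  intro ε hε
  obtain ⟨δ, hδ, hb⟩ := Metric.continuousOn_iff.1 hg x hx (ε / 2) (by positivity)
  filter_upwards [Ioo_mem_nhdsGT hδ] with ρ hρ
  set S := Ω ∩ Metric.ball x ρ with hS
  have hSm : MeasurableSet S := (hΩ.inter Metric.isOpen_ball).measurableSet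
  have hSt : volume S ≠ ⊤ :=
    ((measure_mono inter_subset_right).trans_lt measure_ball_lt_top).ne
  have hSp : volume S ≠ 0 := by
    obtain ⟨y, hy1, hy2⟩ := mem_closure_iff.1 hx _ Metric.isOpen_ball (Metric.mem_ball_self hρ.1)
    exact ((hΩ.inter Metric.isOpen_ball).measure_pos volume ⟨y, hy2, hy1⟩).ne'
  have hcl : ∀ y ∈ S, dist (g y) (g x) < ε / 2 := fun y hy =>
    hb y (subset_closure hy.1) ((Metric.mem_ball.1 hy.2).trans hρ.2)
  have hfg' : f =ᵐ[volume.restrict S] g := ae_restrict_of_ae_restrict_of_subset inter_subset_left hfg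
  have hbd : ∀ᵐ y ∂volume.restrict S, ‖f y - g x‖ ≤ ε / 2 := by
    filter_upwards [hfg', ae_restrict_mem hSm] with y hy hyS
    rw [hy, ← dist_eq_norm]
    exact (hcl y hyS).le
  have hgi : IntegrableOn f S := by
    have hm : AEStronglyMeasurable f (volume.restrict S) :=
      ((hg.mono (inter_subset_left.trans subset_closure)).aestronglyMeasurable hSm).congr hfg'.symm
    have : IsFiniteMeasure (volume.restrict S) := ⟨by
      rw [Measure.restrict_apply_univ]; exact hSt.lt_top⟩
    refine Integrable.of_bound hm (‖g x‖ + ε / 2) ?_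
    filter_upwards [hbd] with y hy
    have := norm_add_le (f y - g x) (g x)
    rw [sub_add_cancel] at this
    linarith
  have hmem := (convex_closedBall (g x) (ε / 2)).set_average_mem Metric.isClosed_closedBall hSp hSt
    (f := f) (by
      filter_upwards [hbd] with y hy
      rwa [Metric.mem_closedBall, dist_eq_norm]) hgi
  exact (Metric.mem_closedBall.1 hmem).trans_lt (half_lt_self hε)

/-- The plate lies in the Lipschitz image of a bounded subset of the plane, where `μH[2]` is a Haar
measure. -/
lemma hausdorffMeasure_plate_lt_top {a : ℝ} (ha : 0 < a) : (μH[2] : Measure E3) (plate a) < ⊤ := by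
  let J : (Fin 2 → ℝ) →L[ℝ] E3 :=
    (ContinuousLinearMap.proj 0).smulRight (EuclideanSpace.single 0 1) +
      (ContinuousLinearMap.proj 1).smulRight (EuclideanSpace.single 1 1)
  have hsub : plate a ⊆ J '' Metric.ball 0 a := by
    rintro y ⟨hy, hy2⟩
    refine ⟨![y 0, y 1], ?_, ?_⟩
    · rw [mem_ball_zero_iff, pi_norm_lt_iff ha]
      intro i
      fin_cases i
      · exact (hy 0).trans (half_lt_self ha)
      · exact (hy 1).trans (half_lt_self ha)
    · ext i
      fin_cases i <;> simp [J, hy2]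
  have hH : (μH[2] : Measure (Fin 2 → ℝ)).IsAddHaarMeasure := by
    have := isAddHaarMeasure_hausdorffMeasure (E := Fin 2 → ℝ)
    simpa using this
  refine (measure_mono hsub).trans_lt ?_
  refine ((J.lipschitz.lipschitzOnWith (s := Metric.ball 0 a)).hausdorffMeasure_image_le
    (d := 2) (by norm_num)).trans_lt ?_
  exact ENNReal.mul_lt_top (ENNReal.rpow_lt_top_of_nonneg (by norm_num) ENNReal.coe_ne_top)
    measure_ball_lt_top

/-- By compactness a local bound suffices. A chart maps the boundary near `x` into the plate and its
inverse is Lipschitz. Finiteness makes the boundary integrals of bounded functions converge and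
allows slicing on the lateral surface. -/
lemma isFiniteMeasure_boundaryMeasure {Ω : Set E3} (h : IsLipschitzDomain Ω) :
    IsFiniteMeasure (boundaryMeasure Ω) := by
  have hc : IsCompact (frontier Ω) :=
    (isCompact_closure h).of_isClosed_subset isClosed_frontier frontier_subset_closure
  have hfin : (μH[2] : Measure E3) (frontier Ω) < ⊤ := by
    refine hc.measure_lt_top_of_nhdsWithin fun x hx => ?_
    obtain ⟨U, a, φ, L₁, L₂, hU, hxU, ha, h1, h2, h3, h4, h5⟩ := h.lipschitz x hx
    rw [union_empty, inter_comm Ω U] at h5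
    refine ⟨U ∩ frontier Ω, by
      rw [inter_comm]; exact inter_mem_nhdsWithin _ (hU.mem_nhds hxU), ?_⟩
    have hinj : InjOn φ U := fun y hy z hz e => by
      have := h2 y hy z hz
      rw [e, dist_self, mul_zero] at this
      exact dist_le_zero.1 this
    have hcont : ContinuousOn φ U :=
      (LipschitzOnWith.of_dist_le_mul (K := L₁) fun y hy z hz => h1 y hy z hz).continuousOn
    have hneg : ∀ y ∈ U ∩ Ω, φ y 2 ≤ 0 := by
      intro y hy
      have hy' := mem_image_of_mem φ hy
      rcases h5 with h5 | h5 | h5 <;> rw [h5] at hy'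
      · exact hy'.2.le
      · exact hy'.elim (fun h => h.2.le) fun h => h.2.le
      · exact hy'.elim (fun h => h.2.le) fun h => h.2.1.le
    have hmap : ∀ y ∈ U ∩ frontier Ω, φ y ∈ plate a := by
      rintro y ⟨hyU, hyf⟩
      have hcube : φ y ∈ cube a := h3 ▸ mem_image_of_mem φ hyU
      refine ⟨hcube, le_antisymm ?_ ?_⟩
      -- A boundary point is a limit of points of `U ∩ Ω`, whose images have nonpositive third
      -- coordinate.
      · have hne : (𝓝[U ∩ Ω] y).NeBot := by
          rw [← mem_closure_iff_nhdsWithin_neBot]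
          exact closure_mono subset_rfl (hU.inter_closure ⟨hyU, hyf.1⟩)
        have ht : Tendsto (fun z => φ z 2) (𝓝[U ∩ Ω] y) (𝓝 (φ y 2)) :=
          ((by fun_prop : Continuous fun p : E3 => p 2).tendsto (φ y)).comp
            ((hcont y hyU).mono_left (nhdsWithin_mono y inter_subset_left))
        exact le_of_tendsto ht (by filter_upwards [self_mem_nhdsWithin] with z hz using hneg z hz)
      -- The lower half cube is covered by the image of `U ∩ Ω`, so by injectivity a boundary point
      -- mapped below the plate would lie in the open set `Ω`.
      · by_contra hlt
        have hmem : φ y ∈ φ '' (U ∩ Ω) := by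
          have : φ y ∈ lowerCube a := ⟨hcube, not_le.1 hlt⟩
          rcases h5 with h5 | h5 | h5 <;> rw [h5]
          · exact this
          · exact Or.inl this
          · exact Or.inl this
        obtain ⟨z, hz, hzy⟩ := hmem
        have : z = y := hinj hz.1 hyU hzy
        rw [this] at hz
        exact hyf.2 (by rw [h.isOpen.interior_eq]; exact hz.2)
    have hlip : LipschitzOnWith L₂ (Function.invFunOn φ U) (φ '' (U ∩ frontier Ω)) := by
      refine LipschitzOnWith.of_dist_le_mul ?_
      rintro _ ⟨y, hy, rfl⟩ _ ⟨z, hz, rfl⟩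
      rw [hinj.leftInvOn_invFunOn hy.1, hinj.leftInvOn_invFunOn hz.1]
      exact h2 y hy.1 z hz.1
    have himg : Function.invFunOn φ U '' (φ '' (U ∩ frontier Ω)) = U ∩ frontier Ω := by
      rw [image_image]
      exact (image_congr fun y hy => hinj.leftInvOn_invFunOn hy.1).trans (image_id' _)
    rw [← himg]
    refine (hlip.hausdorffMeasure_image_le (d := 2) (by norm_num)).trans_lt ?_
    refine ENNReal.mul_lt_top (ENNReal.rpow_lt_top_of_nonneg (by norm_num) ENNReal.coe_ne_top) ?_
    exact (measure_mono (by rintro _ ⟨y, hy, rfl⟩; exact hmap y hy)).trans_lt (hausdorffMeasure_plate_lt_top ha)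
  refine ⟨?_⟩
  rw [boundaryMeasure, Measure.smul_apply, Measure.restrict_apply_univ, smul_eq_mul]
  exact ENNReal.mul_lt_top ENNReal.ofReal_lt_top hfin

/-! ### The embedding into the continuous functions -/

/-- Extension by zero of a continuous function on a set. -/
noncomputable def extendZero {K : Set E3} (f : C(K, ℝ)) (x : E3) : ℝ :=
  open Classical in if hx : x ∈ K then f ⟨x, hx⟩ else 0

lemma extendZero_apply {K : Set E3} (f : C(K, ℝ)) {x : E3} (hx : x ∈ K) :
    extendZero f x = f ⟨x, hx⟩ := dif_pos hx

lemma continuousOn_extendZero {K : Set E3} (f : C(K, ℝ)) : ContinuousOn (extendZero f) K := by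
  rw [continuousOn_iff_continuous_domRestrict]
  refine f.continuous.congr fun x => ?_
  rw [domRestrict_apply, extendZero_apply f x.2]

/-- Both functions agree on the closure with the limit of averages `trace Ω f`, which depends only
on the almost everywhere class. -/
lemma eqOn_closure_of_ae_eq {Ω : Set E3} (hΩ : IsOpen Ω) {f g : E3 → ℝ}
    (hf : ContinuousOn f (closure Ω)) (hg : ContinuousOn g (closure Ω))
    (hfg : f =ᵐ[volume.restrict Ω] g) : EqOn f g (closure Ω) := fun _ hx =>
  (trace_eq hΩ hf ae_eq_rfl hx).symm.trans (trace_eq hΩ hg hfg hx)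

/-- The embedding of `W^{1,q}(Ω)`, `q > 3`, into `C(closure Ω)`, with an interpolation
inequality. -/
theorem exists_embedding {Ω : Set E3} (h : IsLipschitzDomain Ω) [CompactSpace (closure Ω)]
    {q q' : ℝ≥0∞} [hq1 : Fact (1 ≤ q)] [Fact (1 ≤ q')] [ENNReal.HolderConjugate q q'] (hq : 3 < q)
    (hqt : q ≠ ⊤) :
    ∃ (T : W1 Ω q →L[ℝ] C(closure Ω, ℝ)) (C : ℝ), 0 ≤ C ∧
      (∀ v, fn v =ᵐ[volume.restrict Ω] extendZero (T v)) ∧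
      ∀ v, ∀ l ∈ Ioc (0 : ℝ) 1, ‖T v‖ ≤
        C * (l ^ (1 - 3 / q.toReal) * ‖v‖ + l ^ (-1 - 3 / q.toReal) * ‖embed Ω q q' v‖) := by
  obtain ⟨C, hC0, hC⟩ := exists_continuous_rep h (q' := q') hq hqt
  choose g hgc hgae hgb using hC
  -- The representatives were merely chosen; uniqueness of the continuous representative makes the
  -- choice linear.
  let T₀ : W1 Ω q →ₗ[ℝ] C(closure Ω, ℝ) :=
    { toFun := fun v => ⟨(closure Ω).domRestrict (g v),
        continuousOn_iff_continuous_domRestrict.1 (hgc v)⟩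
      map_add' := fun v w => by
        ext x
        refine eqOn_closure_of_ae_eq h.isOpen (hgc _) ((hgc v).add (hgc w)) ?_ x.2
        filter_upwards [hgae (v + w), hgae v, hgae w, fn_add v w] with y h1 h2 h3 h4
        rw [← h1, h4, Pi.add_apply, h2, h3, Pi.add_apply]
      map_smul' := fun c v => by
        ext x
        refine eqOn_closure_of_ae_eq h.isOpen (hgc _) ((hgc v).const_smul c) ?_ x.2
        filter_upwards [hgae (c • v), hgae v, fn_smul c v] with y h1 h2 h4
        rw [← h1, h4, Pi.smul_apply, h2, Pi.smul_apply] }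
  have hb : ∀ v, ∀ l ∈ Ioc (0 : ℝ) 1, ‖T₀ v‖ ≤
      C * (l ^ (1 - 3 / q.toReal) * ‖v‖ + l ^ (-1 - 3 / q.toReal) * ‖embed Ω q q' v‖) := by
    intro v l hl
    have hl0 := hl.1
    exact (ContinuousMap.norm_le _ (by positivity)).2 fun x => hgb v x x.2 l hl
  -- The interpolation inequality at `l = 1`, combined with the boundedness of `embed`, yields the
  -- operator bound.
  refine ⟨T₀.mkContinuous (C * (1 + ‖embed Ω q q'‖)) fun v => ?_, C, hC0, fun v => ?_, hb⟩
  · refine (hb v 1 (right_mem_Ioc.2 one_pos)).trans ?_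
    rw [Real.one_rpow, Real.one_rpow, one_mul, one_mul, mul_assoc, add_mul, one_mul]
    exact mul_le_mul_of_nonneg_left (add_le_add le_rfl ((embed Ω q q').le_opNorm v)) hC0
  · filter_upwards [hgae v, ae_restrict_mem h.isOpen.measurableSet] with x hx hxΩ
    rw [hx]
    exact (extendZero_apply (T₀ v) (subset_closure hxΩ)).symm

/-! ### The chain rule -/

/-- The chain rule for weak gradients of bounded functions. -/
theorem HasWeakGradient.comp_of_bounded {Ω : Set E3} (hΩ : IsOpen Ω) {f : E3 → ℝ} {g : E3 → E3}
    (hf : IntegrableOn f Ω) (hg : IntegrableOn g Ω) (h : HasWeakGradient Ω f g) {B : ℝ}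
    (hB0 : 0 ≤ B) (hB : ∀ᵐ x ∂volume.restrict Ω, |f x| ≤ B) {H H' : ℝ → ℝ}
    (hH : ∀ s, HasDerivAt H (H' s) s) (hH' : Continuous H') :
    HasWeakGradient Ω (fun x => H (f x)) (fun x => H' (f x) • g x) := by
  intro ψ hψ hc hs v
  have hHc : Continuous H := continuous_iff_continuousAt.2 fun s => (hH s).continuousAt
  have hH1 : ContDiff ℝ 1 H := by
    rw [contDiff_one_iff_deriv]
    refine ⟨fun s => (hH s).differentiableAt, ?_⟩
    rwa [funext fun s => (hH s).deriv]
  have hfI : Integrable (Ω.indicator f) volume := (integrable_indicator_iff hΩ.measurableSet).2 hf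
  have hgI : Integrable (Ω.indicator g) volume := (integrable_indicator_iff hΩ.measurableSet).2 hg
  set F : ℕ → E3 → ℝ := fun n => mollify n (Ω.indicator f) with hF
  set G : ℕ → E3 → E3 := fun n => mollify n (Ω.indicator g) with hG
  have hFs : ∀ n, ContDiff ℝ ∞ (F n) := fun n => contDiff_mollify n hfI.locallyIntegrable
  have hGs : ∀ n, ContDiff ℝ ∞ (G n) := fun n => contDiff_mollify n hgI.locallyIntegrable
  have hFB : ∀ n x, F n x ∈ Icc (-B) B := by
    intro n x
    rw [mem_Icc, ← abs_le, ← Real.norm_eq_abs]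
    refine norm_mollify_le ?_ n x
    have := (ae_restrict_iff' hΩ.measurableSet).1 hB
    filter_upwards [this] with y hy
    by_cases hyΩ : y ∈ Ω
    · rw [indicator_of_mem hyΩ]; exact hy hyΩ
    · simpa [hyΩ] using hB0
  obtain ⟨M₀, hM₀⟩ := isCompact_Icc.exists_bound_of_continuousOn (s := Icc (-B) B)
    hHc.continuousOn
  obtain ⟨M₁, hM₁⟩ := isCompact_Icc.exists_bound_of_continuousOn (s := Icc (-B) B)
    hH'.continuousOn
  have hM₁0 : 0 ≤ M₁ := (norm_nonneg _).trans (hM₁ 0 ⟨by linarith, hB0⟩)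
  obtain ⟨Mψ, hMψ⟩ := hc.exists_bound_of_continuous hψ.continuous
  have hMψ0 : 0 ≤ Mψ := (norm_nonneg _).trans (hMψ 0)
  have hFt : ∀ᵐ x ∂volume.restrict Ω, Tendsto (fun n => F n x) atTop (𝓝 (f x)) := by
    filter_upwards [ae_restrict_of_ae (ae_tendsto_mollify hfI.locallyIntegrable),
      ae_restrict_mem hΩ.measurableSet] with x hx hxΩ
    rwa [indicator_of_mem hxΩ] at hx
  have cdψ : Continuous fun x => fderiv ℝ ψ x v :=
    (hψ.continuous_fderiv (by simp)).clm_apply continuous_const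
  obtain ⟨d, hd, hdΩ⟩ := hc.isCompact.exists_cthickening_subset_open hΩ hs
  -- Integration by parts and the classical chain rule for mollifications, valid once the kernel
  -- fits into `Ω` around the support of `ψ`. The mollified gradient is split as `g` plus an error:
  -- the error tends to zero in L¹ against bounded factors, while the `g` part is handled by
  -- dominated convergence in `H' (F n)`.
  have heq : ∀ᶠ n in atTop, ∫ x in Ω, fderiv ℝ ψ x v * H (F n x)
      = - ((∫ x in Ω, ψ x * (H' (F n x) * inner ℝ (G n x - g x) v)) +
        ∫ x in Ω, ψ x * (H' (F n x) * inner ℝ (g x) v)) := by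
    filter_upwards [tendsto_mollifier_rOut.eventually (ge_mem_nhds hd)] with n hn
    have h1 := setIntegral_fderiv_mul hψ hc hs (hH1.comp ((hFs n).of_le (by simp))) v
    have cψH : Continuous fun x => ψ x * H' (F n x) :=
      hψ.continuous.mul (hH'.comp (hFs n).continuous)
    have i2 : Integrable (fun x => ψ x * (H' (F n x) * inner ℝ (g x) v)) (volume.restrict Ω) := by
      have : Integrable (fun x => ψ x * H' (F n x) * inner ℝ (g x) v) (volume.restrict Ω) := by
        refine Integrable.bdd_mul (c := Mψ * M₁) (hg.inner_const v) cψH.aestronglyMeasurable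
          (Eventually.of_forall fun x => ?_)
        rw [norm_mul]
        exact mul_le_mul (hMψ x) (hM₁ _ (hFB n x)) (norm_nonneg _) hMψ0
      simpa only [mul_assoc] using this
    have i3 : Integrable (fun x => ψ x * (H' (F n x) * inner ℝ (G n x) v))
        (volume.restrict Ω) := by
      have : Continuous fun x => ψ x * (H' (F n x) * inner ℝ (G n x) v) :=
        hψ.continuous.mul ((hH'.comp (hFs n).continuous).mul
          ((hGs n).continuous.inner continuous_const))
      exact (this.integrable_of_hasCompactSupport hc.mul_right).integrableOn
    have i1 : Integrable (fun x => ψ x * (H' (F n x) * inner ℝ (G n x - g x) v))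
        (volume.restrict Ω) := by
      refine (i3.sub i2).congr (Eventually.of_forall fun x => ?_)
      simp only [Pi.sub_apply, inner_sub_left]
      ring
    rw [← integral_add i1 i2]
    refine h1.trans (congrArg Neg.neg (integral_congr_ae (Eventually.of_forall fun x => ?_)))
    simp only [inner_sub_left]
    by_cases hx : x ∈ tsupport ψ
    · have hsub : Metric.closedBall x (mollifier n).rOut ⊆ Ω :=
        (Metric.closedBall_subset_closedBall hn).trans
          ((Metric.closedBall_subset_cthickening hx d).trans hdΩ)
      have h2 : fderiv ℝ (H ∘ F n) x v = H' (F n x) * inner ℝ (G n x) v := by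
        rw [← fderiv_mollify hΩ.measurableSet hf hg h hsub]
        have h3 : HasFDerivAt (F n) (fderiv ℝ (F n) x) x :=
          ((hFs n).differentiable (by simp)).differentiableAt.hasFDerivAt
        rw [((hH (F n x)).comp_hasFDerivAt x h3).fderiv]
        simp [hF]
      rw [h2]
      ring
    · rw [image_eq_zero_of_notMem_tsupport hx]
      ring
  have hL : Tendsto (fun n => ∫ x in Ω, fderiv ℝ ψ x v * H (F n x)) atTop
      (𝓝 (∫ x in Ω, fderiv ℝ ψ x v * H (f x))) := by
    refine tendsto_integral_of_dominated_convergence (fun x => ‖fderiv ℝ ψ x v‖ * M₀)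
      (fun n => (cdψ.mul (hHc.comp (hFs n).continuous)).aestronglyMeasurable) ?_ (fun n => ?_) ?_
    · exact ((cdψ.integrable_of_hasCompactSupport (hc.fderiv_apply ℝ v)).norm.mul_const
        M₀).integrableOn
    · refine Eventually.of_forall fun x => ?_
      rw [norm_mul]
      exact mul_le_mul_of_nonneg_left (hM₀ _ (hFB n x)) (norm_nonneg _)
    · filter_upwards [hFt] with x hx
      exact ((hHc.tendsto _).comp hx).const_mul _
  have hR2 : Tendsto (fun n => ∫ x in Ω, ψ x * (H' (F n x) * inner ℝ (g x) v)) atTop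
      (𝓝 (∫ x in Ω, ψ x * (H' (f x) * inner ℝ (g x) v))) := by
    refine tendsto_integral_of_dominated_convergence (fun x => Mψ * (M₁ * ‖(inner ℝ (g x) v : ℝ)‖))
      (fun n => ?_) ?_ (fun n => ?_) ?_
    · exact hψ.continuous.aestronglyMeasurable.mul
        ((hH'.comp (hFs n).continuous).aestronglyMeasurable.mul (hg.inner_const v).1)
    · exact (((hg.inner_const v).norm).const_mul M₁).const_mul Mψ
    · refine Eventually.of_forall fun x => ?_
      rw [norm_mul, norm_mul]
      exact mul_le_mul (hMψ x) (mul_le_mul_of_nonneg_right (hM₁ _ (hFB n x)) (norm_nonneg _))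
        (by positivity) hMψ0
    · filter_upwards [hFt] with x hx
      exact (((hH'.tendsto _).comp hx).mul_const _).const_mul _
  have hR1 : Tendsto (fun n => ∫ x in Ω, ψ x * (H' (F n x) * inner ℝ (G n x - g x) v)) atTop
      (𝓝 0) := by
    have ht := tendsto_lintegral_mollify_sub hgI
    have ht2 : Tendsto (fun n => ENNReal.ofReal (Mψ * (M₁ * ‖v‖)) *
        ∫⁻ x, ‖G n x - Ω.indicator g x‖ₑ) atTop (𝓝 0) := by
      have := ENNReal.Tendsto.const_mul (a := ENNReal.ofReal (Mψ * (M₁ * ‖v‖))) ht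
        (Or.inr ENNReal.ofReal_ne_top)
      rwa [mul_zero] at this
    rw [tendsto_zero_iff_enorm_tendsto_zero]
    refine tendsto_of_tendsto_of_tendsto_of_le_of_le tendsto_const_nhds ht2 (fun _ => zero_le)
      fun n => ?_
    refine (enorm_integral_le_lintegral_enorm _).trans ?_
    rw [← lintegral_const_mul' _ _ ENNReal.ofReal_ne_top]
    refine le_trans ?_ (lintegral_mono' (Measure.restrict_le_self (s := Ω)) le_rfl)
    refine lintegral_mono_ae ?_
    filter_upwards [ae_restrict_mem hΩ.measurableSet] with x hx
    rw [indicator_of_mem hx, ← ofReal_norm, ← ofReal_norm, ← ENNReal.ofReal_mul (by positivity)]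
    refine ENNReal.ofReal_le_ofReal ?_
    rw [norm_mul, norm_mul]
    calc _ ≤ Mψ * (M₁ * (‖G n x - g x‖ * ‖v‖)) :=
          mul_le_mul (hMψ x) (mul_le_mul (hM₁ _ (hFB n x)) (norm_inner_le_norm _ _)
            (norm_nonneg _) hM₁0) (by positivity) hMψ0
      _ = _ := by ring
  have hlim := hL.congr' heq
  have hlim2 := (hR1.add hR2).neg
  rw [zero_add] at hlim2
  have := tendsto_nhds_unique hL (hlim2.congr' (heq.mono fun n hn => hn.symm))
  rw [this]
  simp_rw [real_inner_smul_left]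

/-! ### Functions with a weak time derivative -/

section Time

variable {X : Type*} [NormedAddCommGroup X] [NormedSpace ℝ X] [CompleteSpace X]

/-- Bump functions on the line with supports shrinking to the origin. -/
noncomputable def timeBump (n : ℕ) : ContDiffBump (0 : ℝ) where
  rIn := 1 / (2 * ((n : ℝ) + 1))
  rOut := 1 / ((n : ℝ) + 1)
  rIn_pos := by positivity
  rIn_lt_rOut := by
    apply one_div_lt_one_div_of_lt <;> nlinarith [Nat.cast_nonneg (α := ℝ) n]

lemma tendsto_timeBump_rOut : Tendsto (fun n => (timeBump n).rOut) atTop (𝓝 0) :=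
  tendsto_one_div_add_atTop_nhds_zero_nat

/-- A smooth approximation of the indicator function of `[s, t]`. -/
noncomputable def smoothStep (n : ℕ) (s t x : ℝ) : ℝ :=
  ∫ y in (x - t)..(x - s), (timeBump n).normed volume y

lemma hasDerivAt_smoothStep (n : ℕ) (s t x : ℝ) : HasDerivAt (smoothStep n s t)
    ((timeBump n).normed volume (x - s) - (timeBump n).normed volume (x - t)) x := by
  have hc : Continuous ((timeBump n).normed (volume : Measure ℝ)) := (timeBump n).continuous_normed
  have hP : ∀ z, HasDerivAt (fun u => ∫ y in (0 : ℝ)..u, (timeBump n).normed volume y)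
      ((timeBump n).normed volume z) z := fun z =>
    intervalIntegral.integral_hasDerivAt_right (hc.intervalIntegrable _ _)
      (hc.stronglyMeasurableAtFilter _ _) hc.continuousAt
  have h1 := (hP (x - s)).comp_sub_const x s
  have h2 := (hP (x - t)).comp_sub_const x t
  refine (h1.sub h2).congr_of_eventuallyEq (Eventually.of_forall fun z => ?_)
  simp only [smoothStep, Pi.sub_apply]
  rw [intervalIntegral.integral_interval_sub_left (hc.intervalIntegrable _ _)
    (hc.intervalIntegrable _ _)]

lemma smoothStep_eq_zero {n : ℕ} {s t x : ℝ} (hst : s ≤ t)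
    (hx : x ∉ Ioo (s - (timeBump n).rOut) (t + (timeBump n).rOut)) : smoothStep n s t x = 0 := by
  refine intervalIntegral.integral_zero_ae (Eventually.of_forall fun y hy => ?_)
  rw [uIoc_of_le (by linarith)] at hy
  rw [← Function.notMem_support, (timeBump n).support_normed_eq, Metric.mem_ball, dist_zero_right,
    Real.norm_eq_abs, abs_lt]
  rintro ⟨h1, h2⟩
  exact hx ⟨by linarith [hy.2], by linarith [hy.1]⟩

lemma smoothStep_eq_one {n : ℕ} {s t x : ℝ} (h1 : s + (timeBump n).rOut ≤ x)
    (h2 : x + (timeBump n).rOut ≤ t) : smoothStep n s t x = 1 := by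
  have hr := (timeBump n).rOut_pos
  rw [smoothStep, intervalIntegral.integral_of_le (by linarith),
    setIntegral_eq_integral_of_forall_compl_eq_zero, (timeBump n).integral_normed]
  intro y hy
  rw [← Function.notMem_support, (timeBump n).support_normed_eq, Metric.mem_ball, dist_zero_right,
    Real.norm_eq_abs, abs_lt]
  rintro ⟨h3, h4⟩
  exact hy ⟨by linarith, by linarith⟩

lemma abs_smoothStep_le (n : ℕ) {s t : ℝ} (hst : s ≤ t) (x : ℝ) : |smoothStep n s t x| ≤ 1 := by
  have hi : Integrable ((timeBump n).normed (volume : Measure ℝ)) := (timeBump n).integrable_normed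
  have h0 : 0 ≤ᵐ[volume] (timeBump n).normed (volume : Measure ℝ) :=
    Eventually.of_forall fun y => (timeBump n).nonneg_normed y
  rw [smoothStep, intervalIntegral.integral_of_le (by linarith),
    abs_of_nonneg (setIntegral_nonneg_of_ae h0)]
  exact (setIntegral_le_integral hi h0).trans_eq (timeBump n).integral_normed

lemma contDiff_smoothStep (n : ℕ) (s t : ℝ) : ContDiff ℝ ∞ (smoothStep n s t) := by
  rw [contDiff_infty_iff_deriv]
  refine ⟨fun x => (hasDerivAt_smoothStep n s t x).differentiableAt, ?_⟩
  rw [funext fun x => (hasDerivAt_smoothStep n s t x).deriv]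
  have hs : ContDiff ℝ ∞ ((timeBump n).normed (volume : Measure ℝ)) := (timeBump n).contDiff_normed
  exact (hs.comp (contDiff_id.sub contDiff_const)).sub (hs.comp (contDiff_id.sub contDiff_const))

/-- The fundamental theorem of calculus for weak time derivatives. -/
theorem HasWeakTimeDeriv.sub_eq_integral {a b : ℝ} {u w w' : ℝ → X}
    (h : HasWeakTimeDeriv a b u w') (hw : ContinuousOn w (Icc a b))
    (hu : ∀ᵐ t ∂volume.restrict (Ioo a b), w t = u t) (hw' : IntegrableOn w' (Ioo a b))
    {s t : ℝ} (has : a ≤ s) (hst : s ≤ t) (htb : t ≤ b) : w t - w s = ∫ x in s..t, w' x := by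
  rcases hst.eq_or_lt with rfl | hst'
  · simp
  have key : ∀ s t, a < s → s < t → t < b → w t - w s = ∫ x in s..t, w' x := by
    intro s t has hst htb
    set W : ℝ → X := (Icc a b).indicator w with hW
    have hWm : AEStronglyMeasurable W volume :=
      (aestronglyMeasurable_indicator_iff measurableSet_Icc).2
        (hw.aestronglyMeasurable measurableSet_Icc)
    have hWi : Integrable W volume :=
      (integrable_indicator_iff measurableSet_Icc).2 (hw.integrableOn_compact isCompact_Icc)
    have hWt : ∀ z ∈ Ioo a b, Tendsto W (𝓝 z) (𝓝 (w z)) := by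
      intro z hz
      have h1 : ContinuousAt w z := hw.continuousAt (Icc_mem_nhds hz.1 hz.2)
      refine h1.tendsto.congr' ?_
      filter_upwards [Icc_mem_nhds hz.1 hz.2] with y hy
      rw [hW, indicator_of_mem hy]
    have hconv : ∀ z ∈ Ioo a b, Tendsto (fun n => ∫ x, (timeBump n).normed volume (x - z) • W x)
        atTop (𝓝 (w z)) := by
      intro z hz
      have h1 := ContDiffBump.convolution_tendsto_right (μ := volume) (g := fun _ : ℕ => W)
        (k := fun _ => z) (x₀ := z) (z₀ := w z) tendsto_timeBump_rOut
        (Eventually.of_forall fun _ => hWm) ((hWt z hz).comp tendsto_snd) tendsto_const_nhds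
      refine h1.congr fun n => ?_
      rw [convolution_eq_swap]
      refine integral_congr_ae (Eventually.of_forall fun x => ?_)
      simp only [ContinuousLinearMap.lsmul_apply]
      rw [← (timeBump n).normed_neg, neg_sub]
    have hdist : 0 < min (s - a) (b - t) := lt_min (by linarith) (by linarith)
    -- The derivative of the smooth step is the bump at `s` minus the bump at `t`, so testing the
    -- weak derivative with it compares mollified values of `w` at the two times.
    have heq : ∀ᶠ n in atTop, (∫ x, (timeBump n).normed volume (x - s) • W x)
        - ∫ x, (timeBump n).normed volume (x - t) • W x
        = - ∫ x in Ioo a b, smoothStep n s t x • w' x := by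
      filter_upwards [tendsto_timeBump_rOut.eventually (gt_mem_nhds hdist)] with n hn
      have hn1 := hn.trans_le (min_le_left _ _)
      have hn2 := hn.trans_le (min_le_right _ _)
      have hsupp : tsupport (smoothStep n s t) ⊆
          Icc (s - (timeBump n).rOut) (t + (timeBump n).rOut) := by
        refine closure_minimal (fun x hx => ?_) isClosed_Icc
        by_contra hx'
        exact hx (smoothStep_eq_zero hst.le fun h => hx' (Ioo_subset_Icc_self h))
      have hsub : Icc (s - (timeBump n).rOut) (t + (timeBump n).rOut) ⊆ Ioo a b := fun x hx =>
        ⟨by linarith [hx.1], by linarith [hx.2]⟩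
      have h1 := h _ (contDiff_smoothStep n s t)
        (isCompact_Icc.of_isClosed_subset (isClosed_tsupport _) hsupp) (hsupp.trans hsub)
      rw [← h1]
      have hint : ∀ z, Integrable (fun x => (timeBump n).normed volume (x - z) • W x) := by
        intro z
        obtain ⟨M, hM⟩ := (timeBump n).hasCompactSupport_normed (μ := volume)
          |>.exists_bound_of_continuous (timeBump n).continuous_normed
        exact hWi.bdd_smul M ((timeBump n).continuous_normed.comp
          (continuous_id.sub continuous_const)).aestronglyMeasurable
          (Eventually.of_forall fun x => hM _)
      have e1 : ∫ x in Ioo a b, deriv (smoothStep n s t) x • u x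
          = ∫ x in Ioo a b, deriv (smoothStep n s t) x • W x := by
        refine integral_congr_ae ?_
        filter_upwards [hu, ae_restrict_mem measurableSet_Ioo] with x hx hxI
        rw [← hx, hW, indicator_of_mem (Ioo_subset_Icc_self hxI)]
      rw [e1, setIntegral_eq_integral_of_forall_compl_eq_zero, ← integral_sub (hint s) (hint t)]
      · refine integral_congr_ae (Eventually.of_forall fun x => ?_)
        simp only
        rw [(hasDerivAt_smoothStep n s t x).deriv, sub_smul]
      · intro x hx
        have : x ∉ tsupport (deriv (smoothStep n s t)) := fun hx' =>
          hx (hsub (hsupp ((tsupport_deriv_subset) hx')))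
        rw [image_eq_zero_of_notMem_tsupport this, zero_smul]
    have hL := (hconv s ⟨has, hst.trans htb⟩).sub (hconv t ⟨has.trans hst, htb⟩)
    have hR : Tendsto (fun n => ∫ x in Ioo a b, smoothStep n s t x • w' x) atTop
        (𝓝 (∫ x in Ioo a b, (Ioo s t).indicator w' x)) := by
      refine tendsto_integral_of_dominated_convergence (fun x => ‖w' x‖)
        (fun n => (contDiff_smoothStep n s t).continuous.aestronglyMeasurable.smul hw'.1) hw'.norm
        (fun n => Eventually.of_forall fun x => ?_) ?_
      · rw [norm_smul]
        exact mul_le_of_le_one_left (norm_nonneg _) (abs_smoothStep_le n hst.le x)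
      · have hne : ∀ z : ℝ, ∀ᵐ x ∂volume.restrict (Ioo a b), x ≠ z := fun z =>
          ae_restrict_of_ae (by simp [ae_iff])
        filter_upwards [hne s, hne t] with x hxs hxt
        refine tendsto_const_nhds.congr' ?_
        by_cases hx : x ∈ Ioo s t
        · have hpos : 0 < min (x - s) (t - x) := lt_min (by linarith [hx.1]) (by linarith [hx.2])
          filter_upwards [tendsto_timeBump_rOut.eventually (gt_mem_nhds hpos)] with n hn
          have hn1 := hn.trans_le (min_le_left _ _)
          have hn2 := hn.trans_le (min_le_right _ _)
          rw [indicator_of_mem hx, smoothStep_eq_one (by linarith) (by linarith), one_smul]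
        · have hpos : 0 < max (s - x) (x - t) := by
            rcases lt_or_gt_of_ne hxs with h1 | h1
            · exact lt_max_of_lt_left (by linarith)
            · rcases lt_or_gt_of_ne hxt with h2 | h2
              · exact (hx ⟨h1, h2⟩).elim
              · exact lt_max_of_lt_right (by linarith)
          filter_upwards [tendsto_timeBump_rOut.eventually (gt_mem_nhds hpos)] with n hn
          rw [indicator_of_notMem hx, smoothStep_eq_zero hst.le, zero_smul]
          rintro ⟨h1, h2⟩
          rcases lt_max_iff.1 hn with h3 | h3 <;> linarith
    have hfin := tendsto_nhds_unique hL (hR.neg.congr' (heq.mono fun n hn => hn.symm))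
    rw [setIntegral_indicator measurableSet_Ioo,
      inter_eq_right.2 (Ioo_subset_Ioo has.le htb.le)] at hfin
    rw [intervalIntegral.integral_of_le hst.le, integral_Ioc_eq_integral_Ioo, ← neg_sub, hfin,
      neg_neg]
  have hab : a < b := has.trans_lt (hst'.trans_le htb)
  have hw'i : IntegrableOn w' (Icc a b) := (integrableOn_Icc_iff_integrableOn_Ioo).2 hw'
  have hint : ∀ s ∈ Icc a b, ∀ t ∈ Icc a b, IntervalIntegrable w' volume s t := by
    intro s hs t ht
    refine (hw'i.mono_set ?_).intervalIntegrable
    exact uIcc_subset_Icc hs ht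
  set P : ℝ → X := fun t => ∫ x in a..t, w' x with hP
  have hPc : ContinuousOn P (Icc a b) := by
    have := intervalIntegral.continuousOn_primitive_interval (μ := volume) (f := w') (a := a)
      (b := b) (by rwa [uIcc_of_le hab.le])
    rwa [uIcc_of_le hab.le] at this
  have ha := left_mem_Icc.2 hab.le
  have hs : s ∈ Icc a b := ⟨has, hst.trans htb⟩
  have ht : t ∈ Icc a b := ⟨has.trans hst, htb⟩
  have hconst : ∀ x ∈ Ioo a b, ∀ y ∈ Ioo a b, x < y → w y - P y = w x - P x := by
    intro x hx y hy hxy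
    have h1 := key x y hx.1 hxy hy.2
    have h2 : P y - P x = ∫ z in x..y, w' z :=
      intervalIntegral.integral_interval_sub_left (hint a ha y (Ioo_subset_Icc_self hy))
        (hint a ha x (Ioo_subset_Icc_self hx))
    rw [sub_eq_sub_iff_sub_eq_sub, h1, h2]
  have hmid : (a + b) / 2 ∈ Ioo a b := ⟨by linarith, by linarith⟩
  -- The test function needs room on both sides, so the formula was shown for interior times only.
  -- Continuity extends the constancy of `w - P` to the end points.
  have hEq : EqOn (fun x => w x - P x) (fun _ => w ((a + b) / 2) - P ((a + b) / 2))
      (Icc a b) := by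
    rw [← closure_Ioo hab.ne]
    have hcl : ContinuousOn (fun x => w x - P x) (closure (Ioo a b)) := by
      rw [closure_Ioo hab.ne]; exact hw.sub hPc
    refine EqOn.of_subset_closure (s := Ioo a b) ?_ hcl continuousOn_const subset_closure
      subset_rfl
    intro x hx
    rcases lt_trichotomy x ((a + b) / 2) with h1 | h1 | h1
    · exact (hconst x hx _ hmid h1).symm
    · simp only [h1]
    · exact hconst _ hmid x hx h1
  have h1 : w t - P t = w s - P s := (hEq ht).trans (hEq hs).symm
  have h2 : P t - P s = ∫ z in s..t, w' z :=
    intervalIntegral.integral_interval_sub_left (hint a ha t ht) (hint a ha s hs)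
  rw [← h2]
  exact sub_eq_sub_iff_sub_eq_sub.1 h1

lemma norm_intervalIntegral_le_rpow {E : Type*} [NormedAddCommGroup E] [NormedSpace ℝ E]
    {f : ℝ → E} {r : ℝ≥0∞} (hr : 1 ≤ r) (hrt : r ≠ ⊤)
    (hf : MemLp f r volume) {c d : ℝ} (hcd : c ≤ d) :
    ‖∫ x in c..d, f x‖ ≤ (d - c) ^ (1 - 1 / r.toReal) * (eLpNorm f r volume).toReal := by
  have hr1 : 1 ≤ r.toReal := by
    simpa using ENNReal.toReal_mono hrt hr
  have hexp : 0 ≤ 1 - 1 / r.toReal := by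
    rw [sub_nonneg, div_le_one (by linarith)]; exact hr1
  rw [intervalIntegral.integral_of_le hcd]
  have h1 : ‖∫ x in Ioc c d, f x‖ₑ ≤
      eLpNorm f r volume * ENNReal.ofReal (d - c) ^ (1 - 1 / r.toReal) := by
    refine (enorm_integral_le_lintegral_enorm _).trans ?_
    refine (lintegral_le_rpow_mul_measure hf.1.enorm.restrict hr1).trans ?_
    rw [Measure.restrict_apply_univ, Real.volume_Ioc]
    refine mul_le_mul_left ?_ _
    rw [eLpNorm_eq_lintegral_rpow_enorm_toReal (by positivity) hrt]
    exact ENNReal.rpow_le_rpow (lintegral_mono' Measure.restrict_le_self le_rfl) (by positivity)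
  rw [ENNReal.ofReal_rpow_of_nonneg (by linarith) hexp] at h1
  have h2 := ENNReal.toReal_mono (ENNReal.mul_ne_top hf.2.ne ENNReal.ofReal_ne_top) h1
  rw [ENNReal.toReal_mul, ENNReal.toReal_ofReal (Real.rpow_nonneg (by linarith) _),
    toReal_enorm] at h2
  rwa [mul_comm]

end Time

/-! ### Time regularity by interpolation -/

/-- If `T : Y → Z` obeys an interpolation inequality between `Y` and `X`, then a curve in
`W^{1,r}(a, b; X) ∩ L^r(a, b; Y)` is mapped to a continuous curve in `Z`. -/
theorem exists_continuous_curve {X Y Z : Type*} [NormedAddCommGroup X] [NormedSpace ℝ X]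
    [CompleteSpace X] [NormedAddCommGroup Y] [NormedSpace ℝ Y] [CompleteSpace Y]
    [NormedAddCommGroup Z] [NormedSpace ℝ Z] [CompleteSpace Z] (ι : Y →L[ℝ] X) (T : Y →L[ℝ] Z)
    {C β : ℝ} (hC : 0 ≤ C)
    (hT : ∀ v, ∀ l ∈ Ioc (0 : ℝ) 1, ‖T v‖ ≤ C * (l ^ β * ‖v‖ + l ^ (β - 2) * ‖ι v‖))
    {r : ℝ≥0∞} (hr : 1 < r) (hrt : r ≠ ⊤) (hβ : 2 / r.toReal < β) {a b : ℝ} (hab : a < b)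
    {θ : ℝ → Y} {w w' : ℝ → X} (hθ : MemLp θ r volume) (hw' : MemLp w' r volume)
    (hwθ : ∀ᵐ t ∂volume.restrict (Ioo a b), w t = ι (θ t))
    (hw : ∀ s t, a ≤ s → s ≤ t → t ≤ b → w t - w s = ∫ x in s..t, w' x) :
    ∃ Θ : ℝ → Z, ContinuousOn Θ (Icc a b) ∧ ∀ t ∈ Icc a b, ∃ v : ℕ → Y,
      Tendsto (fun n => ι (v n)) atTop (𝓝 (w t)) ∧ Tendsto (fun n => T (v n)) atTop (𝓝 (Θ t)) := by
  have hr1' : 1 < r.toReal := by simpa using (ENNReal.toReal_lt_toReal ENNReal.one_ne_top hrt).2 hr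
  replace hr := hr.le
  have hr1 := hr1'.le
  have hr0 : 0 < r.toReal := by linarith
  have hpos : 0 < 1 - 1 / r.toReal := by
    rw [sub_pos, div_lt_one (by linarith)]; exact hr1'
  have hexp := hpos.le
  set L := b - a with hL
  have hL0 : 0 < L := sub_pos.2 hab
  set N := (eLpNorm θ r volume).toReal with hN
  set N' := (eLpNorm w' r volume).toReal with hN'
  have hN0 : 0 ≤ N := ENNReal.toReal_nonneg
  have hN0' : 0 ≤ N' := ENNReal.toReal_nonneg
  -- Window lengths proportional to `l ^ 2` with `l = (1/2) ^ n`: this matches the gap 2 between the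
  -- exponents `β` and `β - 2`.
  set k : ℕ → ℝ := fun n => (1 / 4) ^ n with hk
  have hk0 : ∀ n, 0 < k n := fun n => by positivity
  have hk1 : ∀ n, k n ≤ 1 := fun n => pow_le_one₀ (by norm_num) (by norm_num)
  -- The window divides at `t` in the same proportion as `[a, b]`, so it contains `t`, never leaves
  -- `[a, b]` and depends continuously on `t` up to the end points.
  set S : ℕ → ℝ → ℝ := fun n t => t - k n * (t - a) with hS
  set avg : ℕ → ℝ → Y := fun n t => (L * k n)⁻¹ • ∫ x in (S n t)..(S n t + L * k n), θ x with havg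
  have hLk : ∀ n, 0 < L * k n := fun n => mul_pos hL0 (hk0 n)
  have hSa : ∀ n, ∀ t ∈ Icc a b, a ≤ S n t := by
    intro n t ht
    have := mul_le_mul_of_nonneg_right (hk1 n) (sub_nonneg.2 ht.1)
    simp only [hS]; linarith
  have hSb : ∀ n, ∀ t ∈ Icc a b, S n t + L * k n ≤ b := by
    intro n t ht
    have := mul_le_mul_of_nonneg_right (hk1 n) (sub_nonneg.2 ht.2)
    simp only [hS, hL]; linarith
  have hSt : ∀ n, ∀ t ∈ Icc a b, t ∈ Icc (S n t) (S n t + L * k n) := by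
    intro n t ht
    have h1 := mul_nonneg (hk0 n).le (sub_nonneg.2 ht.1)
    have h2 := mul_nonneg (hk0 n).le (sub_nonneg.2 ht.2)
    simp only [hS, hL]
    constructor <;> linarith
  have hθloc : ∀ c d, IntervalIntegrable θ volume c d := fun c d =>
    ((hθ.locallyIntegrable hr).integrableOn_isCompact isCompact_uIcc).intervalIntegrable
  have hY : ∀ n t, ‖avg n t‖ ≤ (L * k n) ^ (-(1 / r.toReal)) * N := by
    intro n t
    have h1 := norm_intervalIntegral_le_rpow hr hrt hθ
      (le_add_of_nonneg_right (hLk n).le : S n t ≤ S n t + L * k n)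
    rw [add_sub_cancel_left] at h1
    rw [havg, norm_smul, norm_inv, Real.norm_of_nonneg (hLk n).le]
    refine (mul_le_mul_of_nonneg_left h1 (inv_nonneg.2 (hLk n).le)).trans (le_of_eq ?_)
    rw [← mul_assoc, ← Real.rpow_neg_one, ← Real.rpow_add (hLk n)]
    congr 2
    ring
  have hX : ∀ n, ∀ t ∈ Icc a b, ‖ι (avg n t) - w t‖ ≤ (L * k n) ^ (1 - 1 / r.toReal) * N' := by
    intro n t ht
    have hle : S n t ≤ S n t + L * k n := le_add_of_nonneg_right (hLk n).le
    have hιθ : IntervalIntegrable (fun x => ι (θ x)) volume (S n t) (S n t + L * k n) :=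
      ⟨ι.integrable_comp (hθloc _ _).1, ι.integrable_comp (hθloc _ _).2⟩
    have e : ι (avg n t) - w t
        = (L * k n)⁻¹ • ∫ x in (S n t)..(S n t + L * k n), (ι (θ x) - w t) := by
      rw [intervalIntegral.integral_sub hιθ (by simp), intervalIntegral.integral_const,
        ι.intervalIntegral_comp_comm (hθloc _ _), add_sub_cancel_left, smul_sub, smul_smul,
        inv_mul_cancel₀ (hLk n).ne', one_smul, havg, map_smul]
    have hwd : ∀ x ∈ Icc (S n t) (S n t + L * k n), ‖w x - w t‖
        ≤ (L * k n) ^ (1 - 1 / r.toReal) * N' := by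
      have haux : ∀ c d, a ≤ c → c ≤ d → d ≤ b → d - c ≤ L * k n →
          ‖w d - w c‖ ≤ (L * k n) ^ (1 - 1 / r.toReal) * N' := by
        intro c d h1 h2 h3 h4
        rw [hw c d h1 h2 h3]
        refine (norm_intervalIntegral_le_rpow hr hrt hw' h2).trans ?_
        exact mul_le_mul_of_nonneg_right (Real.rpow_le_rpow (by linarith) h4 hexp) hN0'
      intro x hx
      have ht' := hSt n t ht
      rcases le_total x t with hxt | hxt
      · rw [norm_sub_rev]
        exact haux x t ((hSa n t ht).trans hx.1) hxt ht.2 (by linarith [hx.1, ht'.2])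
      · exact haux t x ht.1 hxt (hx.2.trans (hSb n t ht)) (by linarith [hx.2, ht'.1])
    have hae : ∀ᵐ x, x ∈ Set.uIoc (S n t) (S n t + L * k n) → ‖ι (θ x) - w t‖
        ≤ (L * k n) ^ (1 - 1 / r.toReal) * N' := by
      have h1 := (ae_restrict_iff' measurableSet_Ioo).1 hwθ
      have h2 : ∀ᵐ x : ℝ, x ≠ b := by simp [ae_iff]
      filter_upwards [h1, h2] with x hx hxb hxI
      rw [uIoc_of_le hle] at hxI
      rw [← hx ⟨(hSa n t ht).trans_lt hxI.1, lt_of_le_of_ne (hxI.2.trans (hSb n t ht)) hxb⟩]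
      exact hwd x (Ioc_subset_Icc_self hxI)
    have h3 := intervalIntegral.norm_integral_le_of_norm_le_const_ae hae
    rw [add_sub_cancel_left, abs_of_pos (hLk n)] at h3
    rw [e, norm_smul, norm_inv, Real.norm_of_nonneg (hLk n).le, inv_mul_le_iff₀ (hLk n)]
    exact h3.trans_eq (mul_comm _ _)
  set ρ : ℝ := (1 / 2) ^ (β - 2 / r.toReal) with hρ
  have hρ0 : 0 ≤ ρ := by positivity
  have hρ1 : ρ < 1 := Real.rpow_lt_one (by norm_num) (by norm_num) (by linarith)
  set K : ℝ := C * (L ^ (-(1 / r.toReal)) * (5 * N) + L ^ (1 - 1 / r.toReal) * (2 * N')) with hK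
  -- Both terms of the interpolation inequality scale alike: `l ^ β * l ^ (-2/r)` and `l ^ (β - 2) *
  -- l ^ (2 - 2/r)` equal `l ^ (β - 2/r) = ρ ^ n`.
  have hstep : ∀ n, ∀ t ∈ Icc a b, ‖T (avg n t) - T (avg (n + 1) t)‖ ≤ K * ρ ^ n := by
    intro n t ht
    set l : ℝ := (1 / 2) ^ n with hl
    have hl0 : 0 < l := by positivity
    have hl1 : l ≤ 1 := pow_le_one₀ (by norm_num) (by norm_num)
    have hkl : k n = l ^ 2 := by
      simp only [hk, hl]; rw [← pow_mul, mul_comm, pow_mul]; norm_num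
    have hLkn : (L * k n) ^ (-(1 / r.toReal)) = L ^ (-(1 / r.toReal)) * l ^ (-(2 / r.toReal)) := by
      rw [Real.mul_rpow hL0.le (hk0 n).le, hkl, ← Real.rpow_natCast, ← Real.rpow_mul hl0.le]
      congr 2
      push_cast
      ring
    have hLkn' : (L * k n) ^ (1 - 1 / r.toReal)
        = L ^ (1 - 1 / r.toReal) * l ^ (2 - 2 / r.toReal) := by
      rw [Real.mul_rpow hL0.le (hk0 n).le, hkl, ← Real.rpow_natCast, ← Real.rpow_mul hl0.le]
      congr 2
      push_cast
      ring
    have hks : k (n + 1) = k n / 4 := by simp only [hk, pow_succ]; ring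
    -- The 5 is `1 + 4`: quartering the window enlarges the second bound by `4 ^ (1/r) ≤ 4`.
    have h1 : ‖avg n t - avg (n + 1) t‖ ≤
        L ^ (-(1 / r.toReal)) * l ^ (-(2 / r.toReal)) * (5 * N) := by
      have h4 : (L * k (n + 1)) ^ (-(1 / r.toReal)) ≤ 4 * (L * k n) ^ (-(1 / r.toReal)) := by
        rw [hks, mul_div_assoc', Real.div_rpow (hLk n).le (by norm_num), div_eq_mul_inv, mul_comm,
          ← Real.rpow_neg (by norm_num), neg_neg]
        refine mul_le_mul_of_nonneg_right ?_ (Real.rpow_nonneg (hLk n).le _)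
        calc (4 : ℝ) ^ (1 / r.toReal) ≤ 4 ^ (1 : ℝ) :=
              Real.rpow_le_rpow_of_exponent_le (by norm_num) ((div_le_one hr0).2 hr1)
          _ = 4 := Real.rpow_one 4
      have h5 := hY n t
      have h6 := (hY (n + 1) t).trans (mul_le_mul_of_nonneg_right h4 hN0)
      rw [hLkn] at h5 h6
      refine (norm_sub_le _ _).trans ?_
      linarith
    have h2 : ‖ι (avg n t - avg (n + 1) t)‖ ≤
        L ^ (1 - 1 / r.toReal) * l ^ (2 - 2 / r.toReal) * (2 * N') := by
      have h5 := hX n t ht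
      have h6 := hX (n + 1) t ht
      have h7 : (L * k (n + 1)) ^ (1 - 1 / r.toReal) ≤ (L * k n) ^ (1 - 1 / r.toReal) := by
        refine Real.rpow_le_rpow (hLk _).le (mul_le_mul_of_nonneg_left ?_ hL0.le) hexp
        rw [hks]
        linarith [hk0 n]
      have h8 := h6.trans (mul_le_mul_of_nonneg_right h7 hN0')
      rw [hLkn'] at h5 h8
      have e : ι (avg n t - avg (n + 1) t)
          = (ι (avg n t) - w t) - (ι (avg (n + 1) t) - w t) := by rw [map_sub]; abel
      rw [e]
      refine (norm_sub_le _ _).trans ?_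
      linarith
    have hρn : ρ ^ n = l ^ (β - 2 / r.toReal) := by
      rw [hρ, hl, ← Real.rpow_natCast, ← Real.rpow_natCast, ← Real.rpow_mul (by norm_num),
        ← Real.rpow_mul (by norm_num), mul_comm]
    rw [← map_sub]
    refine (hT _ l ⟨hl0, hl1⟩).trans ?_
    rw [hK, mul_assoc C]
    refine mul_le_mul_of_nonneg_left ?_ hC
    rw [add_mul]
    refine add_le_add ?_ ?_
    · refine (mul_le_mul_of_nonneg_left h1 (by positivity)).trans (le_of_eq ?_)
      have : ρ ^ n = l ^ β * l ^ (-(2 / r.toReal)) := by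
        rw [hρn, ← Real.rpow_add hl0]; rfl
      rw [this]
      ring
    · refine (mul_le_mul_of_nonneg_left h2 (by positivity)).trans (le_of_eq ?_)
      have : ρ ^ n = l ^ (β - 2) * l ^ (2 - 2 / r.toReal) := by
        rw [hρn, ← Real.rpow_add hl0]; congr 1; ring
      rw [this]
      ring
  have hlim : ∀ t, t ∈ Icc a b → ∃ z, Tendsto (fun n => T (avg n t)) atTop (𝓝 z) := by
    intro t ht
    exact cauchySeq_tendsto_of_complete (cauchySeq_of_le_geometric ρ K hρ1 fun n => by
      rw [dist_eq_norm]; exact hstep n t ht)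
  choose! Θ hΘ using hlim
  refine ⟨Θ, ?_, fun t ht => ⟨fun n => avg n t, ?_, hΘ t ht⟩⟩
  · have hunif : TendstoUniformlyOn (fun n t => T (avg n t)) Θ atTop (Icc a b) := by
      rw [Metric.tendstoUniformlyOn_iff]
      intro ε hε
      have h1 : Tendsto (fun n => K * ρ ^ n / (1 - ρ)) atTop (𝓝 (K * 0 / (1 - ρ))) :=
        ((tendsto_pow_atTop_nhds_zero_of_lt_one hρ0 hρ1).const_mul K).div_const _
      rw [mul_zero, zero_div] at h1
      filter_upwards [h1.eventually (gt_mem_nhds hε)] with n hn t ht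
      rw [dist_comm]
      refine lt_of_le_of_lt ?_ hn
      exact dist_le_of_le_geometric_of_tendsto ρ K hρ1
        (fun n => by rw [dist_eq_norm]; exact hstep n t ht) (hΘ t ht) n
    refine hunif.continuousOn (Eventually.frequently (Eventually.of_forall fun n => ?_))
    have hP : Continuous fun t => ∫ x in (0 : ℝ)..t, θ x :=
      intervalIntegral.continuous_primitive hθloc 0
    have hSc : Continuous (S n) := by simp only [hS]; fun_prop
    have : Continuous (avg n) := by
      have e : avg n = fun t => (L * k n)⁻¹ • ((∫ x in (0 : ℝ)..(S n t + L * k n), θ x) -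
          ∫ x in (0 : ℝ)..(S n t), θ x) := by
        ext t
        rw [havg, intervalIntegral.integral_interval_sub_left (hθloc _ _) (hθloc _ _)]
      rw [e]
      exact ((hP.comp (hSc.add continuous_const)).sub (hP.comp hSc)).const_smul _
    exact (T.continuous.comp this).continuousOn
  · rw [tendsto_iff_norm_sub_tendsto_zero]
    have h1 : Tendsto (fun n => (L * k n) ^ (1 - 1 / r.toReal) * N') atTop
        (𝓝 ((L * 0) ^ (1 - 1 / r.toReal) * N')) := by
      refine Tendsto.mul_const _ ?_
      refine Tendsto.rpow_const ?_ (Or.inr hexp)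
      exact (tendsto_pow_atTop_nhds_zero_of_lt_one (by norm_num) (by norm_num)).const_mul L
    rw [mul_zero, Real.zero_rpow hpos.ne', zero_mul] at h1
    exact squeeze_zero (fun _ => norm_nonneg _) (fun n => hX n t ht) h1

/-! ### The continuous representative of a solution -/

lemma abs_extendZero_le {K : Set E3} [CompactSpace K] (f : C(K, ℝ)) (x : E3) :
    |extendZero f x| ≤ ‖f‖ := by
  by_cases hx : x ∈ K
  · rw [extendZero_apply f hx]
    exact f.norm_coe_le_norm _
  · simp [extendZero, hx]

lemma abs_extendZero_sub_le {K : Set E3} [CompactSpace K] (f g : C(K, ℝ)) (x : E3) :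
    |extendZero f x - extendZero g x| ≤ ‖f - g‖ := by
  by_cases hx : x ∈ K
  · rw [extendZero_apply f hx, extendZero_apply g hx]
    exact (f - g).norm_coe_le_norm ⟨x, hx⟩
  · simp [extendZero, hx]

lemma aestronglyMeasurable_extendZero {Ω : Set E3} (hΩ : IsOpen Ω) (f : C(closure Ω, ℝ)) :
    AEStronglyMeasurable (extendZero f) (volume.restrict Ω) :=
  ((continuousOn_extendZero f).mono subset_closure).aestronglyMeasurable hΩ.measurableSet

section

variable {Ω : Set E3} {p : ℝ≥0∞} [hp : Fact (1 ≤ p)]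

lemma integrable_fn (hv : volume Ω ≠ ⊤) (ξ : W1 Ω p) : Integrable (fn ξ) (volume.restrict Ω) := by
  have : IsFiniteMeasure (volume.restrict Ω) := ⟨by simpa using hv.lt_top⟩
  exact (memLp_fn ξ).integrable hp.out

lemma integrable_extendZero_mul (hΩ : IsOpen Ω) [CompactSpace (closure Ω)] (f : C(closure Ω, ℝ))
    {g : E3 → ℝ} (hg : Integrable g (volume.restrict Ω)) :
    Integrable (fun x => extendZero f x * g x) (volume.restrict Ω) :=
  hg.bdd_mul (c := ‖f‖) (aestronglyMeasurable_extendZero hΩ f)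
    (Eventually.of_forall fun x => abs_extendZero_le f x)

lemma ae_eq_of_forall_integral_fn_eq {f g : E3 → ℝ}
    (hf : IntegrableOn f Ω) (hg : IntegrableOn g Ω)
    (h : ∀ ξ : W1 Ω p, ∫ x in Ω, f x * fn ξ x = ∫ x in Ω, g x * fn ξ x) :
    f =ᵐ[volume.restrict Ω] g := by
  refine ae_eq_of_integral_contDiff_smul_eq hf.locallyIntegrable hg.locallyIntegrable ?_
  intro ψ hψ hc
  have hψ1 : ContDiff ℝ 1 ψ := hψ.of_le (by simp)
  have h1 : MemLp ψ p (volume.restrict Ω) := hψ.continuous.memLp_of_hasCompactSupport hc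
  have h2 : MemLp (gradient' ψ) p (volume.restrict Ω) := by
    refine (continuous_gradient' hψ1).memLp_of_hasCompactSupport ?_
    refine (hc.fderiv ℝ).mono fun x hx hx' => hx ?_
    rw [← norm_eq_zero, norm_gradient', hx', norm_zero]
  have h3 := h (W1.mk h1 h2 (hasWeakGradient_of_contDiff hψ1))
  have h4 : ∀ u : E3 → ℝ, ∫ x in Ω, ψ x • u x
      = ∫ x in Ω, u x * fn (W1.mk h1 h2 (hasWeakGradient_of_contDiff hψ1)) x := fun u => by
    refine integral_congr_ae ?_
    filter_upwards [fn_mk h1 h2 (hasWeakGradient_of_contDiff hψ1)] with x hx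
    rw [hx, smul_eq_mul, mul_comm]
  rw [h4, h4, h3]

/-- Reconciles the two limits of the time averages: uniform convergence of the representatives
passes to the limit in the integrals against `fn ξ`, which are also the values of the converging
functionals. -/
lemma apply_eq_integral_of_tendsto (hΩ : IsOpen Ω) (hv : volume Ω ≠ ⊤) [CompactSpace (closure Ω)]
    {q : ℝ≥0∞} [Fact (1 ≤ q)] [ENNReal.HolderConjugate q p] {T : W1 Ω q → C(closure Ω, ℝ)}
    (hT : ∀ v, fn v =ᵐ[volume.restrict Ω] extendZero (T v)) {v : ℕ → W1 Ω q} {w : W1Dual Ω p}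
    {g : C(closure Ω, ℝ)} (hw : Tendsto (fun n => embed Ω q p (v n)) atTop (𝓝 w))
    (hg : Tendsto (fun n => T (v n)) atTop (𝓝 g)) (ξ : W1 Ω p) :
    w ξ = ∫ x in Ω, extendZero g x * fn ξ x := by
  have h1 : Tendsto (fun n => embed Ω q p (v n) ξ) atTop (𝓝 (w ξ)) :=
    ((ContinuousLinearMap.apply ℝ ℝ ξ).continuous.tendsto w).comp hw
  refine tendsto_nhds_unique h1 ?_
  have hξ := integrable_fn hv ξ
  have h2 : ∀ n, embed Ω q p (v n) ξ = ∫ x in Ω, extendZero (T (v n)) x * fn ξ x := by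
    intro n
    rw [embed_apply]
    refine integral_congr_ae ?_
    filter_upwards [hT (v n)] with x hx
    rw [hx]
  rw [tendsto_iff_norm_sub_tendsto_zero]
  have h3 : Tendsto (fun n => ‖T (v n) - g‖ * ∫ x in Ω, ‖fn ξ x‖) atTop (𝓝 (0 * ∫ x in Ω, ‖fn ξ x‖)) :=
    (tendsto_iff_norm_sub_tendsto_zero.1 hg).mul_const _
  rw [zero_mul] at h3
  refine squeeze_zero (fun _ => norm_nonneg _) (fun n => ?_) h3
  rw [h2, ← integral_sub (integrable_extendZero_mul hΩ _ hξ) (integrable_extendZero_mul hΩ _ hξ),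
    ← integral_const_mul]
  refine norm_integral_le_of_norm_le (hξ.norm.const_mul _) (Eventually.of_forall fun x => ?_)
  rw [← sub_mul, norm_mul]
  exact mul_le_mul_of_nonneg_right (abs_extendZero_sub_le _ _ _) (norm_nonneg _)

/-- The second inequality is the condition on `r` rewritten as positivity of the exponent `1 - 3/q -
2/r` of the geometric series. The first puts the time derivative into L². -/
lemma two_lt_toReal_and_lt {q r : ℝ≥0∞} (hq : 3 < q) (hqt : q ≠ ⊤) (hr : 2 * q / (q - 3) < r)
    (hrt : r ≠ ⊤) : 2 < r.toReal ∧ 2 / r.toReal < 1 - 3 / q.toReal := by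
  have hq3 : 3 < q.toReal := by
    simpa using (ENNReal.toReal_lt_toReal (by simp) hqt).2 hq
  have hrr : 2 * q.toReal / (q.toReal - 3) < r.toReal := by
    have h1 := (ENNReal.toReal_lt_toReal hr.ne_top hrt).2 hr
    rwa [ENNReal.toReal_div, ENNReal.toReal_mul, ENNReal.toReal_sub_of_le hq.le hqt,
      ENNReal.toReal_ofNat, ENNReal.toReal_ofNat] at h1
  have hq0 : 0 < q.toReal - 3 := by linarith
  have hr2 : 2 < r.toReal := by
    refine lt_of_le_of_lt ?_ hrr
    rw [le_div_iff₀ hq0]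
    linarith
  refine ⟨hr2, ?_⟩
  rw [div_lt_iff₀ hq0] at hrr
  have h0 : 0 < q.toReal := by linarith
  rw [div_lt_iff₀ (by linarith), one_sub_div h0.ne', div_mul_eq_mul_div, lt_div_iff₀ h0]
  linarith

lemma memLp_indicator_Ioo {X : Type*} [NormedAddCommGroup X] {r : ℝ≥0∞} {a b : ℝ} {f : ℝ → X}
    (hf : MemLp f r (volume.restrict (Ioo a b))) : MemLp ((Ioo a b).indicator f) r volume :=
  (memLp_indicator_iff_restrict measurableSet_Ioo).2 hf

/-- The continuous representative of a solution. -/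
theorem exists_continuous_representative {q q' r : ℝ≥0∞} [Fact (1 ≤ q)] [Fact (1 ≤ q')]
    [ENNReal.HolderConjugate q q'] {Ω : Set E3} (hΩ : IsLipschitzDomain Ω)
    [CompactSpace (closure Ω)] (hq : 3 < q) (hqt : q ≠ ⊤) (hr : 2 * q / (q - 3) < r) (hrt : r ≠ ⊤)
    {a b : ℝ} (hab : a < b) {θ : ℝ → W1 Ω q} {w' : ℝ → W1Dual Ω q'}
    (hθ : MemLp θ r (volume.restrict (Ioo a b))) (hw' : MemLp w' r (volume.restrict (Ioo a b)))
    (h : HasWeakTimeDeriv a b (fun t => embed Ω q q' (θ t)) w') {w : ℝ → W1Dual Ω q'}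
    (hw : ContinuousOn w (Icc a b))
    (hwθ : ∀ᵐ t ∂volume.restrict (Ioo a b), w t = embed Ω q q' (θ t)) :
    ∃ Θ : ℝ → C(closure Ω, ℝ), ContinuousOn Θ (Icc a b) ∧
      (∀ t ∈ Icc a b, ∀ ξ : W1 Ω q', w t ξ = ∫ x in Ω, extendZero (Θ t) x * fn ξ x) ∧
      ∀ᵐ t ∂volume.restrict (Ioo a b), fn (θ t) =ᵐ[volume.restrict Ω] extendZero (Θ t) := by
  have hv := volume_ne_top hΩ
  obtain ⟨hr2, hβ⟩ := two_lt_toReal_and_lt hq hqt hr hrt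
  have hr1 : 1 < r := by
    rw [← ENNReal.toReal_lt_toReal ENNReal.one_ne_top hrt, ENNReal.toReal_one]
    linarith
  obtain ⟨T, C, hC, hT, hTb⟩ := exists_embedding hΩ (q' := q') hq hqt
  have hw'i : IntegrableOn w' (Ioo a b) := hw'.integrable hr1.le
  -- Extension by zero to the whole line, the form in which the theorem on curves takes its data.
  have hθ' := memLp_indicator_Ioo hθ
  have hw'' := memLp_indicator_Ioo hw'
  have hTb' : ∀ v, ∀ l ∈ Ioc (0 : ℝ) 1, ‖T v‖ ≤ C * (l ^ (1 - 3 / q.toReal) * ‖v‖ +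
      l ^ (1 - 3 / q.toReal - 2) * ‖embed Ω q q' v‖) := fun v l hl => by
    have e : 1 - 3 / q.toReal - 2 = -1 - 3 / q.toReal := by ring
    rw [e]
    exact hTb v l hl
  have hwθ' : ∀ᵐ t ∂volume.restrict (Ioo a b), w t = embed Ω q q' ((Ioo a b).indicator θ t) := by
    filter_upwards [hwθ, ae_restrict_mem measurableSet_Ioo] with t ht ht'
    rw [ht, indicator_of_mem ht']
  have hww : ∀ s t, a ≤ s → s ≤ t → t ≤ b → w t - w s = ∫ x in s..t, (Ioo a b).indicator w' x := by
    intro s t has hst htb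
    rw [h.sub_eq_integral hw hwθ hw'i has hst htb, intervalIntegral.integral_of_le hst,
      intervalIntegral.integral_of_le hst, integral_Ioc_eq_integral_Ioo,
      integral_Ioc_eq_integral_Ioo]
    refine setIntegral_congr_fun measurableSet_Ioo fun x hx => ?_
    have hx' : x ∈ Ioo a b := ⟨has.trans_lt hx.1, hx.2.trans_le htb⟩
    exact (Set.indicator_of_mem (s := Ioo a b) hx' w').symm
  obtain ⟨Θ, hΘc, hΘ⟩ :=
    exists_continuous_curve (embed Ω q q') T hC hTb' hr1 hrt hβ hab hθ' hw'' hwθ' hww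
  have hrep : ∀ t ∈ Icc a b, ∀ ξ : W1 Ω q', w t ξ = ∫ x in Ω, extendZero (Θ t) x * fn ξ x := by
    intro t ht ξ
    obtain ⟨v, h1, h2⟩ := hΘ t ht
    exact apply_eq_integral_of_tendsto hΩ.isOpen hv hT h1 h2 ξ
  refine ⟨Θ, hΘc, hrep, ?_⟩
  filter_upwards [hwθ, ae_restrict_mem measurableSet_Ioo] with t ht ht'
  refine ae_eq_of_forall_integral_fn_eq (p := q') (integrable_fn hv _) ?_ fun ξ => ?_
  · have : IsFiniteMeasure (volume.restrict Ω) := ⟨by simpa using hv.lt_top⟩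
    exact Integrable.of_bound (aestronglyMeasurable_extendZero hΩ.isOpen _) ‖Θ t‖
      (Eventually.of_forall (abs_extendZero_le _))
  · rw [← embed_apply, ← ht, hrep t (Ioo_subset_Icc_self ht')]

end

/-! ### The truncated test function -/

/-- The function `s ↦ -(M - s)₊²`. -/
noncomputable def negSq (M s : ℝ) : ℝ := -max (M - s) 0 ^ 2

lemma continuous_negSq (M : ℝ) : Continuous (negSq M) := by unfold negSq; fun_prop

lemma negSq_nonpos (M s : ℝ) : negSq M s ≤ 0 := neg_nonpos.2 (sq_nonneg _)

lemma negSq_eq_zero {M s : ℝ} (h : M ≤ s) : negSq M s = 0 := by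
  simp [negSq, max_eq_right (sub_nonpos.2 h)]

lemma max_sub_zero_le (M s : ℝ) : max (M - s) 0 ≤ |M| + |s| :=
  max_le ((le_abs_self _).trans (abs_sub M s)) (by positivity)

lemma abs_negSq_le (M s : ℝ) : |negSq M s| ≤ (|M| + |s|) ^ 2 := by
  rw [negSq, abs_neg, abs_of_nonneg (sq_nonneg _)]
  exact pow_le_pow_left₀ (le_max_right _ _) (max_sub_zero_le M s) 2

/-- The remainder of the linear approximation is at most the square of the increment, also across
the kink of the positive part. Squaring makes the truncation C¹, so the chain rule for C¹ functions
suffices. -/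
lemma hasDerivAt_negSq (M s : ℝ) : HasDerivAt (negSq M) (2 * max (M - s) 0) s := by
  have h : ∀ t, |negSq M t - negSq M s - (t - s) * (2 * max (M - s) 0)| ≤ ‖t - s‖ ^ 2 := by
    intro t
    rw [Real.norm_eq_abs, sq_abs, negSq, negSq, abs_le]
    rcases le_total (M - t) 0 with h1 | h1 <;> rcases le_total (M - s) 0 with h2 | h2 <;>
      simp only [max_eq_left, max_eq_right, h1, h2] <;> constructor <;> nlinarith
  rw [hasDerivAt_iff_isLittleO]
  refine Asymptotics.IsBigO.trans_isLittleO (g := fun t => ‖t - s‖ ^ 2)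
    (Asymptotics.IsBigO.of_bound 1 (Eventually.of_forall fun t => ?_)) ?_
  · rw [one_mul, Real.norm_eq_abs, norm_pow, norm_norm, smul_eq_mul]
    exact h t
  · exact Asymptotics.isLittleO_pow_sub_sub s one_lt_two

/-- The tangent inequality for the convex function `s ↦ max (M - s) 0 ^ 3 / 3`, whose derivative is
`negSq M`. -/
lemma max_pow_three_sub_le (M s t : ℝ) :
    max (M - s) 0 ^ 3 / 3 - max (M - t) 0 ^ 3 / 3 ≤ negSq M s * (s - t) := by
  rw [negSq]
  have h1 : 0 ≤ max (M - t) 0 := le_max_right _ _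
  have h2 : M - t ≤ max (M - t) 0 := le_max_left _ _
  set y := max (M - t) 0
  rcases le_total (M - s) 0 with h | h
  · rw [max_eq_right h]
    have := pow_nonneg h1 3
    linarith
  · rw [max_eq_left h]
    -- With `z = M - s` this is `y ^ 3 - 3 * y * z ^ 2 + 2 * z ^ 3 ≥ 0`, the tangent inequality for
    -- the cube on the nonnegative half line.
    have h3 : 0 ≤ (y - (M - s)) ^ 2 * (y + 2 * (M - s)) := by positivity
    have h4 : 0 ≤ (M - s) ^ 2 * (y - (M - t)) := mul_nonneg (sq_nonneg _) (by linarith)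
    nlinarith

/-- In the definition of ellipticity the null set may depend on the vector. A countable dense set of
vectors and continuity of the quadratic form give one null set for all, as needed for gradients that
vary with `x`. -/
lemma IsEllipticCoefficient.form_nonneg {Ω : Set E3} {A : E3 → Matrix (Fin 3) (Fin 3) ℝ}
    (h : IsEllipticCoefficient Ω A) :
    ∀ᵐ x ∂volume.restrict Ω, ∀ v : E3, 0 ≤ form (A x) v v := by
  obtain ⟨c, hc, hA⟩ := h.elliptic
  have h1 : ∀ᵐ x ∂volume.restrict Ω, ∀ n,
      0 ≤ form (A x) (TopologicalSpace.denseSeq E3 n) (TopologicalSpace.denseSeq E3 n) :=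
    ae_all_iff.2 fun n => (hA _).mono fun x hx => le_trans (by positivity) hx
  filter_upwards [h1] with x hx v
  have hcont : Continuous fun v : E3 => form (A x) v v := by unfold form; fun_prop
  exact (isClosed_Ici.preimage hcont).closure_subset_iff.2 (by rintro _ ⟨n, rfl⟩; exact hx n)
    (TopologicalSpace.denseRange_denseSeq E3 v)

lemma form_smul_right (A : Matrix (Fin 3) (Fin 3) ℝ) (c : ℝ) (v w : E3) :
    form A v (c • w) = c * form A v w := by
  simp only [form, PiLp.smul_apply, smul_eq_mul, Finset.mul_sum]
  refine Finset.sum_congr rfl fun i _ => Finset.sum_congr rfl fun j _ => ?_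
  ring

section

variable {q q' : ℝ≥0∞} [hq1 : Fact (1 ≤ q)] [hq1' : Fact (1 ≤ q')] {Ω : Set E3}

/-- Boundedness of `g` makes the truncation and its derivative bounded, so the gradient is a bounded
multiple of `grad v`; on a bounded domain L^q embeds into L^{q'}. The constant depends on `g` only
through `B`, and growth is linear in `‖v‖`: along the solution the norms are thus square integrable
in time. -/
lemma exists_test_function (hΩ : IsLipschitzDomain Ω) [CompactSpace (closure Ω)] (hqq : q' ≤ q)
    (hqt : q ≠ ⊤) (M B : ℝ) : ∃ C : ℝ, 0 ≤ C ∧ ∀ (v : W1 Ω q) (g : C(closure Ω, ℝ)), ‖g‖ ≤ B →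
      fn v =ᵐ[volume.restrict Ω] extendZero g → ∃ ξ : W1 Ω q',
        (fn ξ =ᵐ[volume.restrict Ω] fun x => negSq M (extendZero g x)) ∧
        (grad ξ =ᵐ[volume.restrict Ω] fun x => (2 * max (M - extendZero g x) 0) • grad v x) ∧
        ‖ξ‖ ≤ C * (1 + ‖v‖) := by
  have hv := volume_ne_top hΩ
  have hfin : IsFiniteMeasure (volume.restrict Ω) := ⟨by simpa using hv.lt_top⟩
  set K : ℝ := |M| + |B| with hK
  set V₁ : ℝ := (volume Ω ^ (q'.toReal⁻¹)).toReal
  set V₂ : ℝ := (volume Ω ^ (1 / q'.toReal - 1 / q.toReal)).toReal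
  have hK0 : 0 ≤ K := by positivity
  have hexp : 0 ≤ 1 / q'.toReal - 1 / q.toReal := by
    have h1 : 1 ≤ q'.toReal := by
      simpa using ENNReal.toReal_mono (ne_top_of_le_ne_top hqt hqq) hq1'.out
    exact sub_nonneg.2 (one_div_le_one_div_of_le (by linarith) (ENNReal.toReal_mono hqt hqq))
  refine ⟨K ^ 2 * V₁ + 2 * K * V₂, by positivity, fun v g hg hvg => ?_⟩
  have hgK : ∀ x, |M| + |extendZero g x| ≤ K := fun x =>
    add_le_add_right ((abs_extendZero_le g x).trans (hg.trans (le_abs_self B))) _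
  have hgm := aestronglyMeasurable_extendZero hΩ.isOpen g
  have hw : HasWeakGradient Ω (fun x => negSq M (extendZero g x))
      (fun x => (2 * max (M - extendZero g x) 0) • grad v x) := by
    refine (HasWeakGradient.comp_of_bounded hΩ.isOpen ((memLp_fn v).integrable hq1.out)
      ((memLp_grad v).integrable hq1.out) (hasWeakGradient_fn v) (norm_nonneg g) ?_
      (hasDerivAt_negSq M) (by fun_prop)).congr ?_ ?_
    · filter_upwards [hvg] with x hx
      rw [hx]
      exact abs_extendZero_le g x
    · filter_upwards [hvg] with x hx
      rw [hx]
    · filter_upwards [hvg] with x hx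
      rw [hx]
  have hfm : AEStronglyMeasurable (fun x => negSq M (extendZero g x)) (volume.restrict Ω) :=
    (continuous_negSq M).comp_aestronglyMeasurable hgm
  have hpm : AEStronglyMeasurable (fun x => 2 * max (M - extendZero g x) 0) (volume.restrict Ω) :=
    (show Continuous fun s : ℝ => 2 * max (M - s) 0 by fun_prop).comp_aestronglyMeasurable hgm
  have hfb : eLpNorm (fun x => negSq M (extendZero g x)) q' (volume.restrict Ω)
      ≤ ENNReal.ofReal (K ^ 2 * V₁) := by
    refine (eLpNorm_le_of_ae_bound (C := K ^ 2) (Eventually.of_forall fun x => ?_)).trans_eq ?_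
    · exact (abs_negSq_le _ _).trans (pow_le_pow_left₀ (by positivity) (hgK x) 2)
    · rw [Measure.restrict_apply_univ, mul_comm, ENNReal.ofReal_mul (by positivity),
        ENNReal.ofReal_toReal (ENNReal.rpow_ne_top_of_nonneg (by positivity) hv)]
  have hgb : eLpNorm (fun x => (2 * max (M - extendZero g x) 0) • grad v x) q' (volume.restrict Ω)
      ≤ ENNReal.ofReal (2 * K * V₂ * ‖v‖) := by
    refine (eLpNorm_le_mul_eLpNorm_of_ae_le_mul (c := 2 * K) (g := grad v)
      (Eventually.of_forall fun x => ?_) q').trans ?_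
    · rw [norm_smul, Real.norm_of_nonneg (mul_nonneg zero_le_two (le_max_right _ _))]
      exact mul_le_mul_of_nonneg_right (mul_le_mul_of_nonneg_left
        ((max_sub_zero_le _ _).trans (hgK x)) zero_le_two) (norm_nonneg _)
    · rw [mul_assoc (2 * K), ENNReal.ofReal_mul (p := 2 * K) (by positivity),
        ENNReal.ofReal_mul ENNReal.toReal_nonneg,
        ENNReal.ofReal_toReal (ENNReal.rpow_ne_top_of_nonneg hexp hv),
        mul_comm (volume Ω ^ (1 / q'.toReal - 1 / q.toReal))]
      refine mul_le_mul_right ((eLpNorm_le_eLpNorm_mul_rpow_measure_univ hqq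
        (memLp_grad v).1).trans ?_) _
      rw [Measure.restrict_apply_univ]
      exact mul_le_mul_left (eLpNorm_grad_le v) _
  refine ⟨W1.mk ⟨hfm, hfb.trans_lt ENNReal.ofReal_lt_top⟩
    ⟨hpm.smul (memLp_grad v).1, hgb.trans_lt ENNReal.ofReal_lt_top⟩ hw, fn_mk _ _ _,
    grad_mk _ _ _, norm_mk_le _ _ _ (hfb.trans (ENNReal.ofReal_le_ofReal ?_))
      (hgb.trans (ENNReal.ofReal_le_ofReal ?_)) ?_⟩
  · have h1 : 0 ≤ K ^ 2 * V₁ * ‖v‖ := by positivity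
    have h2 : 0 ≤ 2 * K * V₂ * (1 + ‖v‖) := by positivity
    linarith
  · have h1 : 0 ≤ K ^ 2 * V₁ * (1 + ‖v‖) := by positivity
    have h2 : 0 ≤ 2 * K * V₂ := by positivity
    linarith
  · positivity

end

/-! ### The sign of the time derivative on the test function -/

section Sign

variable {q q' : ℝ≥0∞} [hq1 : Fact (1 ≤ q)] [hq1' : Fact (1 ≤ q')]

/-- Pointwise: where `M ≤ g` the factor `negSq` vanishes, and elsewhere `g ≤ M ≤ ℓ` is multiplied by
`α ≥ 0` and by a nonpositive factor, which reverses the order. In the application `f₁` and `f₂` are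
the traces of the temperature and of the test function. -/
lemma boundary_integral_le {Ω : Set E3} (hΩ : IsLipschitzDomain Ω) {g α ℓ : E3 → ℝ} {M : ℝ}
    (hg : ContinuousOn g (closure Ω)) (hα : MemLp α ⊤ (boundaryMeasure Ω))
    (hα0 : ∀ᵐ x ∂boundaryMeasure Ω, 0 ≤ α x) (hℓ : MemLp ℓ ⊤ (boundaryMeasure Ω))
    (hℓM : ∀ᵐ x ∂boundaryMeasure Ω, M ≤ ℓ x) {f₁ f₂ : E3 → ℝ} (hf₁ : EqOn f₁ g (closure Ω))
    (hf₂ : EqOn f₂ (fun x => negSq M (g x)) (closure Ω)) :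
    ∫ x, α x * ℓ x * f₂ x ∂boundaryMeasure Ω ≤ ∫ x, α x * f₁ x * f₂ x ∂boundaryMeasure Ω := by
  have hfin := isFiniteMeasure_boundaryMeasure hΩ
  have hmem : ∀ᵐ x ∂boundaryMeasure Ω, x ∈ frontier Ω := by
    unfold boundaryMeasure
    exact Measure.ae_smul_measure (ae_restrict_mem isClosed_frontier.measurableSet) _
  have hcl : frontier Ω ⊆ closure Ω := frontier_subset_closure
  have hbdd : ∀ f : E3 → ℝ, ContinuousOn f (closure Ω) → MemLp f ⊤ (boundaryMeasure Ω) := by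
    intro f hf
    obtain ⟨C, hC⟩ := (isCompact_closure hΩ).exists_bound_of_continuousOn hf
    refine memLp_top_of_bound ?_ C (hmem.mono fun x hx => hC x (hcl hx))
    unfold boundaryMeasure
    exact ((hf.mono hcl).aestronglyMeasurable isClosed_frontier.measurableSet).smul_measure _
  have h1 : MemLp f₁ ⊤ (boundaryMeasure Ω) := hbdd f₁ (hg.congr hf₁)
  have h2 : MemLp f₂ ⊤ (boundaryMeasure Ω) :=
    hbdd f₂ (((continuous_negSq M).comp_continuousOn hg).congr hf₂)
  have hint : ∀ u : E3 → ℝ, MemLp u ⊤ (boundaryMeasure Ω) →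
      Integrable (fun x => α x * u x * f₂ x) (boundaryMeasure Ω) := fun u hu =>
    ((hu.mul' hα (r := ⊤)).mul' h2 (r := ⊤) |>.integrable le_top).congr
      (Eventually.of_forall fun x => by simp; ring)
  refine integral_mono_ae (hint ℓ hℓ) (hint f₁ h1) ?_
  filter_upwards [hmem, hα0, hℓM] with x hx hx0 hxM
  rw [hf₁ (hcl hx), hf₂ (hcl hx)]
  rcases le_total M (g x) with h | h
  · simp [negSq_eq_zero h]
  · exact mul_le_mul_of_nonpos_right (mul_le_mul_of_nonneg_left (h.trans hxM) hx0)
      (negSq_nonpos _ _)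

/-- For an elliptic coefficient, a positive source and an outer temperature above `M`, the time
derivative is nonpositive on the test function `-(M - θ)₊²`. -/
lemma Data.ParabolicEq.apply_nonpos {D : Data q'} {t : ℝ} {ϑ χ : W1 D.Ω q}
    {dϑ : W1Dual D.Ω q'} (h : D.ParabolicEq t ϑ dϑ χ) (hΩ : IsLipschitzDomain D.Ω)
    (hη : IsConductivity D.η) (hσ : IsConductivity D.σ) (hκ : IsEllipticCoefficient D.Ω D.κ)
    (hε : IsEllipticCoefficient D.Ω D.ε) (hα : MemLp D.α ⊤ (boundaryMeasure D.Ω))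
    (hα0 : ∀ᵐ x ∂boundaryMeasure D.Ω, 0 ≤ D.α x)
    (hℓ : MemLp (fun x => D.θl (x, t)) ⊤ (boundaryMeasure D.Ω)) {M : ℝ}
    (hℓM : ∀ᵐ x ∂boundaryMeasure D.Ω, M ≤ D.θl (x, t)) {g : E3 → ℝ}
    (hg : ContinuousOn g (closure D.Ω)) (hϑ : fn ϑ =ᵐ[volume.restrict D.Ω] g) {ξ : W1 D.Ω q'}
    (hξ : fn ξ =ᵐ[volume.restrict D.Ω] fun x => negSq M (g x))
    (hξ' : grad ξ =ᵐ[volume.restrict D.Ω] fun x => (2 * max (M - g x) 0) • grad ϑ x) :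
    dϑ ξ ≤ 0 := by
  have h1 := h ξ
  have h2 := boundary_integral_le hΩ hg hα hα0 hℓ hℓM
    (fun x hx => trace_eq hΩ.isOpen hg hϑ hx)
    (fun x hx => trace_eq hΩ.isOpen ((continuous_negSq M).comp_continuousOn hg) hξ hx)
  -- The two interior terms enter only through the sign of their integrands, so no integrability has
  -- to be checked.
  have h3 : 0 ≤ ∫ x in D.Ω, D.η (fn ϑ x) * form (D.κ x) (grad ϑ x) (grad ξ x) := by
    refine integral_nonneg_of_ae ?_
    filter_upwards [hξ', hκ.form_nonneg] with x hx hx'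
    rw [hx, form_smul_right, Pi.zero_apply]
    exact mul_nonneg (hη.pos _).le (mul_nonneg (mul_nonneg zero_le_two (le_max_right _ _)) (hx' _))
  have h4 : ∫ x in D.Ω, D.σ (fn ϑ x) * form (D.ε x) (grad χ x) (grad χ x) * fn ξ x ≤ 0 := by
    refine integral_nonpos_of_ae ?_
    filter_upwards [hξ, hε.form_nonneg] with x hx hx'
    rw [hx, Pi.zero_apply]
    exact mul_nonpos_of_nonneg_of_nonpos (mul_nonneg (hσ.pos _).le (hx' _)) (negSq_nonpos _ _)
  linarith

end Sign

/-! ### A one-sided differential inequality -/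

section Decreasing

variable {X : Type*} [NormedAddCommGroup X]

/-- The substitution `s = t - u` turns the oscillation into translation differences; after
exchanging the integrals, the Cauchy–Schwarz inequality in `t` applies for each shift `u` in `(0,
h)`. -/
lemma lintegral_mul_lintegral_translate_le {z : ℝ → X} (hz : MemLp z 2 volume) {m : ℝ → ℝ≥0∞}
    {I : Set ℝ} (hm : AEMeasurable m (volume.restrict I)) {h : ℝ} {e : ℝ≥0∞}
    (he : ∀ u ∈ Ioo 0 h, eLpNorm (fun t => z (t - u) - z t) 2 volume ≤ e) :
    ∫⁻ t in I, m t * ∫⁻ s in Ioo (t - h) t, ‖z s - z t‖ₑ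
      ≤ ENNReal.ofReal h * ((∫⁻ t in I, m t ^ (2 : ℝ)) ^ (1 / 2 : ℝ) * e) := by
  have h1 : ∀ t, ∫⁻ s in Ioo (t - h) t, ‖z s - z t‖ₑ = ∫⁻ u in Ioo 0 h, ‖z (t - u) - z t‖ₑ := by
    intro t
    rw [← lintegral_indicator measurableSet_Ioo, ← lintegral_indicator measurableSet_Ioo,
      ← lintegral_sub_left_eq_self _ t]
    refine lintegral_congr fun u => ?_
    simp only [indicator, mem_Ioo]
    congr 1
    exact propext ⟨fun h => ⟨by linarith [h.2], by linarith [h.1]⟩,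
      fun h => ⟨by linarith [h.2], by linarith [h.1]⟩⟩
  have hzI : ∀ {J : Set ℝ}, AEStronglyMeasurable z (volume.restrict J) := fun {J} =>
    hz.1.mono_measure Measure.restrict_le_self
  have hmeas : AEMeasurable (Function.uncurry fun t u => m t * ‖z (t - u) - z t‖ₑ)
      ((volume.restrict I).prod (volume.restrict (Ioo 0 h))) := by
    have h2 : AEStronglyMeasurable (fun p : ℝ × ℝ => z (p.1 - p.2))
        ((volume.restrict I).prod (volume.restrict (Ioo 0 h))) := by
      have h3 : AEStronglyMeasurable (fun p : ℝ × ℝ => z (p.1 - p.2))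
          ((volume : Measure ℝ).prod volume) :=
        hz.1.comp_quasiMeasurePreserving (f := fun p : ℝ × ℝ => p.1 - p.2)
          (quasiMeasurePreserving_sub_of_right_invariant volume volume)
      rw [Measure.prod_restrict]
      exact h3.mono_measure Measure.restrict_le_self
    exact hm.comp_fst.mul (h2.sub hzI.comp_fst).enorm
  calc ∫⁻ t in I, m t * ∫⁻ s in Ioo (t - h) t, ‖z s - z t‖ₑ
      ≤ ∫⁻ t in I, ∫⁻ u in Ioo 0 h, m t * ‖z (t - u) - z t‖ₑ :=
        lintegral_mono fun t => by rw [h1]; exact lintegral_const_mul_le _ _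
    _ = ∫⁻ u in Ioo 0 h, ∫⁻ t in I, m t * ‖z (t - u) - z t‖ₑ := lintegral_lintegral_swap hmeas
    _ ≤ ∫⁻ _ in Ioo 0 h, (∫⁻ t in I, m t ^ (2 : ℝ)) ^ (1 / 2 : ℝ) * e := by
        refine setLIntegral_mono measurable_const fun u hu => ?_
        have hzu : AEStronglyMeasurable (fun t => z (t - u) - z t) volume :=
          (hz.1.comp_measurePreserving (measurePreserving_sub_right volume u)).sub hz.1
        have h2 := ENNReal.lintegral_mul_le_Lp_mul_Lq (volume.restrict I)
          (p := 2) (q := 2) (by constructor <;> norm_num) hm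
          (hzu.mono_measure Measure.restrict_le_self).enorm
        refine h2.trans (mul_le_mul_right ?_ _)
        refine le_trans ?_ (he u hu)
        rw [eLpNorm_eq_lintegral_rpow_enorm_toReal (by norm_num) (by norm_num)]
        simp only [ENNReal.toReal_ofNat]
        exact ENNReal.rpow_le_rpow (lintegral_mono' Measure.restrict_le_self le_rfl) (by norm_num)
    _ = ENNReal.ofReal h * ((∫⁻ t in I, m t ^ (2 : ℝ)) ^ (1 / 2 : ℝ) * e) := by
        rw [setLIntegral_const, Real.volume_Ioo, sub_zero, mul_comm]

/-- The backward difference of step `k` is integrated over `(a + k, c)`. The left side telescopes to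
the integral of `F` near `c` minus that near `a`, roughly `k * (F c - F a)`. The right side is at
most `k * N * δ`, with `δ` arbitrarily small by continuity of translations in L². Dividing by `k`
gives the claim. -/
lemma le_of_forall_ofReal_sub_le_of_memLp {a b : ℝ} {F : ℝ → ℝ} (hF : Continuous F) {z : ℝ → X}
    (hz : MemLp z 2 volume) {m : ℝ → ℝ≥0∞} (hm : AEMeasurable m (volume.restrict (Ioo a b)))
    (hm2 : ∫⁻ t in Ioo a b, m t ^ (2 : ℝ) ≠ ⊤)
    (h : ∀ᵐ t ∂volume.restrict (Ioo a b), ∀ t' ∈ Ico a t,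
      ENNReal.ofReal (F t - F t') ≤ m t * ∫⁻ s in Ioo t' t, ‖z s - z t‖ₑ)
    {c : ℝ} (hc : c ∈ Icc a b) : F c ≤ F a := by
  rcases hc.1.eq_or_lt with rfl | hac
  · exact le_rfl
  set N := (∫⁻ t in Ioo a b, m t ^ (2 : ℝ)) ^ (1 / 2 : ℝ)
  have hN : N ≠ ⊤ := ENNReal.rpow_ne_top_of_nonneg (by norm_num) hm2
  have key : ∀ δ > 0, F c - F a ≤ (2 + N.toReal) * δ := by
    intro δ hδ
    have ev1 : ∀ᶠ u in 𝓝 (0 : ℝ), eLpNorm (fun t => z (t - u) - z t) 2 volume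
        ≤ ENNReal.ofReal δ :=
      (tendsto_eLpNorm_translate (by norm_num) (by norm_num) hz).eventually
        (ge_mem_nhds (ENNReal.ofReal_pos.2 hδ))
    obtain ⟨h₁, hh₁, H₁⟩ := Metric.eventually_nhds_iff.1 ev1
    obtain ⟨h₂, hh₂, H₂⟩ := Metric.continuous_iff.1 hF a δ hδ
    obtain ⟨h₃, hh₃, H₃⟩ := Metric.continuous_iff.1 hF c δ hδ
    obtain ⟨k, hk0, hk⟩ := exists_between (lt_min (lt_min hh₁ hh₂) (lt_min hh₃ (sub_pos.2 hac)))
    simp only [lt_min_iff] at hk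
    obtain ⟨⟨k1, k2⟩, k3, k4⟩ := hk
    have hint : ∀ x y, IntervalIntegrable F volume x y := fun x y => hF.intervalIntegrable x y
    have hle : a + k ≤ c := by linarith
    have e1 : ∫ t in (a + k)..c, (F t - F (t - k)) = (∫ t in (c - k)..c, F t) -
        ∫ t in a..(a + k), F t := by
      have hint' : IntervalIntegrable (fun t => F (t - k)) volume (a + k) c :=
        (hF.comp (continuous_sub_right k)).intervalIntegrable _ _
      rw [intervalIntegral.integral_sub (hint _ _) hint',
        intervalIntegral.integral_comp_sub_right, add_sub_cancel_right,
        ← intervalIntegral.integral_add_adjacent_intervals (hint a (a + k)) (hint (a + k) (c - k)),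
        ← intervalIntegral.integral_add_adjacent_intervals (hint (a + k) (c - k)) (hint (c - k) c)]
      ring
    have e2 : k * (F c - δ) ≤ ∫ t in (c - k)..c, F t := by
      have := intervalIntegral.integral_mono_on (by linarith) (intervalIntegrable_const (c := F c - δ))
        (hint (c - k) c) fun x hx => by
          have := H₃ x (by rw [Real.dist_eq, abs_lt]; constructor <;> linarith [hx.1, hx.2])
          rw [Real.dist_eq, abs_lt] at this
          linarith
      rwa [intervalIntegral.integral_const, sub_sub_cancel, smul_eq_mul] at this
    have e3 : ∫ t in a..(a + k), F t ≤ k * (F a + δ) := by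
      have := intervalIntegral.integral_mono_on (by linarith) (hint a (a + k))
        (intervalIntegrable_const (c := F a + δ)) fun x hx => by
          have := H₂ x (by rw [Real.dist_eq, abs_lt]; constructor <;> linarith [hx.1, hx.2])
          rw [Real.dist_eq, abs_lt] at this
          linarith
      rwa [intervalIntegral.integral_const, add_sub_cancel_left, smul_eq_mul] at this
    have e4 : ∫ t in (a + k)..c, (F t - F (t - k)) ≤ k * (N.toReal * δ) := by
      have hi : IntegrableOn (fun t => F t - F (t - k)) (Ioc (a + k) c) :=
        (hF.sub (hF.comp (continuous_sub_right k))).integrableOn_Ioc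
      rw [intervalIntegral.integral_of_le hle,
        -- The hypothesis bounds positive parts only; dropping the negative part is harmless for an
        -- upper bound.
        integral_eq_lintegral_pos_part_sub_lintegral_neg_part hi]
      refine (sub_le_self _ ENNReal.toReal_nonneg).trans ?_
      have hN' : (k * (N.toReal * δ)) = (ENNReal.ofReal k * (N * ENNReal.ofReal δ)).toReal := by
        rw [ENNReal.toReal_mul, ENNReal.toReal_mul, ENNReal.toReal_ofReal hk0.le,
          ENNReal.toReal_ofReal hδ.le]
      rw [hN']
      refine ENNReal.toReal_mono (ENNReal.mul_ne_top ENNReal.ofReal_ne_top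
        (ENNReal.mul_ne_top hN ENNReal.ofReal_ne_top)) ?_
      refine le_trans ?_ (lintegral_mul_lintegral_translate_le hz hm (h := k) fun u hu =>
        H₁ (by rw [Real.dist_eq, sub_zero, abs_of_pos hu.1]; exact hu.2.trans k1))
      rw [← restrict_Ioo_eq_restrict_Ioc]
      have hsub : Ioo (a + k) c ⊆ Ioo a b := Ioo_subset_Ioo (by linarith) hc.2
      refine le_trans (lintegral_mono_ae ?_) (lintegral_mono_set hsub)
      filter_upwards [ae_mono (Measure.restrict_mono hsub le_rfl) h,
        ae_restrict_mem measurableSet_Ioo] with t ht ht'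
      exact ht (t - k) ⟨by linarith [ht'.1], by linarith⟩
    have e5 : k * (F c - F a) ≤ k * ((2 + N.toReal) * δ) := by
      rw [e1] at e4
      linarith
    exact le_of_mul_le_mul_left e5 hk0
  by_contra hlt
  rw [not_le, ← sub_pos] at hlt
  have hN0 : 0 < 2 + N.toReal := by positivity
  have := key ((F c - F a) / (2 * (2 + N.toReal))) (by positivity)
  have e : (2 + N.toReal) * ((F c - F a) / (2 * (2 + N.toReal))) = (F c - F a) / 2 := by
    field_simp
  linarith

/-- A continuous function whose backward differences are controlled by the oscillation of an `L²`
function around its values is nonincreasing. -/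
theorem le_of_forall_ofReal_sub_le {a b : ℝ} {F : ℝ → ℝ} (hF : Continuous F) {z : ℝ → X}
    (hz : MemLp z 2 (volume.restrict (Ioo a b))) {m : ℝ → ℝ≥0∞}
    (hm : AEMeasurable m (volume.restrict (Ioo a b)))
    (hm2 : ∫⁻ t in Ioo a b, m t ^ (2 : ℝ) ≠ ⊤)
    (h : ∀ᵐ t ∂volume.restrict (Ioo a b), ∀ t' ∈ Ico a t,
      ENNReal.ofReal (F t - F t') ≤ m t * ∫⁻ s in Ioo t' t, ‖z s - z t‖ₑ)
    {c : ℝ} (hc : c ∈ Icc a b) : F c ≤ F a := by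
  refine le_of_forall_ofReal_sub_le_of_memLp hF (memLp_indicator_Ioo hz) hm hm2 ?_ hc
  filter_upwards [h, ae_restrict_mem measurableSet_Ioo] with t h1 ht t' ht'
  refine (h1 t' ht').trans_eq ?_
  congr 1
  refine setLIntegral_congr_fun measurableSet_Ioo fun s hs => ?_
  rw [Set.indicator_of_mem (Ioo_subset_Ioo ht'.1 ht.2.le hs), Set.indicator_of_mem ht]

end Decreasing

/-! ### The minimum principle -/

lemma continuousOn_extendZero_apply {K : Set E3} [CompactSpace K] {I : Set ℝ} {Θ : ℝ → C(K, ℝ)}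
    (hΘ : ContinuousOn Θ I) : ContinuousOn (fun p : E3 × ℝ => extendZero (Θ p.2) p.1) (K ×ˢ I) := by
  rw [continuousOn_iff_continuous_domRestrict] at hΘ ⊢
  have h1 : Continuous fun p : ↥(K ×ˢ I) => I.domRestrict Θ ⟨p.1.2, p.2.2⟩ :=
    hΘ.comp (by fun_prop)
  have h2 : Continuous fun p : ↥(K ×ˢ I) => (⟨p.1.1, p.2.1⟩ : K) := by fun_prop
  refine (h1.eval h2).congr fun p => ?_
  exact (extendZero_apply _ p.2.1).symm

/-- The sign is known only for `f t`, paired with the test function belonging to the same time.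
Subtracting the constant `f t` from the integrand therefore drops the nonpositive term `(t - s) * f
t ξ` and leaves the oscillation of `f` around `f t`. -/
lemma ofReal_intervalIntegral_apply_le {Y : Type*} [NormedAddCommGroup Y] [NormedSpace ℝ Y]
    {f : ℝ → StrongDual ℝ Y} {s t : ℝ} (hst : s ≤ t) (hf : IntervalIntegrable f volume s t) {ξ : Y}
    (hξ : f t ξ ≤ 0) :
    ENNReal.ofReal ((∫ x in s..t, f x) ξ)
      ≤ ENNReal.ofReal ‖ξ‖ * ∫⁻ x in Ioo s t, ‖f x - f t‖ₑ := by
  have e : ∫ x in s..t, f x = (∫ x in s..t, (f x - f t)) + (t - s) • f t := by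
    rw [intervalIntegral.integral_sub hf (by simp), intervalIntegral.integral_const, sub_add_cancel]
  have h1 : (∫ x in s..t, f x) ξ ≤ ‖∫ x in s..t, (f x - f t)‖ * ‖ξ‖ := by
    rw [e, add_apply, smul_apply, smul_eq_mul]
    have h2 : (∫ x in s..t, (f x - f t)) ξ ≤ ‖∫ x in s..t, (f x - f t)‖ * ‖ξ‖ :=
      (Real.le_norm_self _).trans (ContinuousLinearMap.le_opNorm _ ξ)
    have h3 := mul_nonpos_of_nonneg_of_nonpos (sub_nonneg.2 hst) hξ
    linarith
  refine (ENNReal.ofReal_le_ofReal h1).trans ?_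
  rw [ENNReal.ofReal_mul (norm_nonneg _), mul_comm, ofReal_norm, ofReal_norm,
    intervalIntegral.integral_of_le hst, integral_Ioc_eq_integral_Ioo]
  exact mul_le_mul_right (enorm_integral_le_lintegral_enorm _) _

lemma aestronglyMeasurable_max_pow {Ω : Set E3} (hΩ : IsOpen Ω) (M : ℝ) (g : C(closure Ω, ℝ)) :
    AEStronglyMeasurable (fun x => max (M - extendZero g x) 0 ^ 3 / 3) (volume.restrict Ω) :=
  (show Continuous fun s : ℝ => max (M - s) 0 ^ 3 / 3 by fun_prop).comp_aestronglyMeasurable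
    (aestronglyMeasurable_extendZero hΩ g)

/-! ### The functional measuring how far a continuous function falls below `M`. -/

section

variable {Ω : Set E3} [CompactSpace (closure Ω)]

lemma abs_max_pow_le (M : ℝ) {B : ℝ} (g : C(closure Ω, ℝ)) (hg : ‖g‖ ≤ B) (x : E3) :
    ‖max (M - extendZero g x) 0 ^ 3 / 3‖ ≤ (|M| + B) ^ 3 := by
  have h0 : 0 ≤ max (M - extendZero g x) 0 := le_max_right _ _
  rw [Real.norm_of_nonneg (by positivity)]
  refine (div_le_self (by positivity) (by norm_num)).trans (pow_le_pow_left₀ h0 ?_ 3)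
  exact (max_sub_zero_le _ _).trans (add_le_add_right ((abs_extendZero_le g x).trans hg) _)

lemma integrable_max_pow (hΩ : IsOpen Ω) (hv : volume Ω ≠ ⊤) (M : ℝ) (g : C(closure Ω, ℝ)) :
    Integrable (fun x => max (M - extendZero g x) 0 ^ 3 / 3) (volume.restrict Ω) := by
  have : IsFiniteMeasure (volume.restrict Ω) := ⟨by simpa using hv.lt_top⟩
  exact Integrable.of_bound (aestronglyMeasurable_max_pow hΩ M g) _
    (Eventually.of_forall (abs_max_pow_le M g le_rfl))

lemma integral_max_pow_sub_le {p : ℝ≥0∞} [Fact (1 ≤ p)] (hΩ : IsOpen Ω) (hv : volume Ω ≠ ⊤) {M : ℝ}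
    (g₁ g₂ : C(closure Ω, ℝ)) {ξ : W1 Ω p}
    (hξ : fn ξ =ᵐ[volume.restrict Ω] fun x => negSq M (extendZero g₁ x)) :
    (∫ x in Ω, max (M - extendZero g₁ x) 0 ^ 3 / 3) - ∫ x in Ω, max (M - extendZero g₂ x) 0 ^ 3 / 3
      ≤ (∫ x in Ω, extendZero g₁ x * fn ξ x) - ∫ x in Ω, extendZero g₂ x * fn ξ x := by
  have hi := integrable_fn hv ξ
  rw [← integral_sub (integrable_max_pow hΩ hv M g₁) (integrable_max_pow hΩ hv M g₂),
    ← integral_sub (integrable_extendZero_mul hΩ g₁ hi) (integrable_extendZero_mul hΩ g₂ hi)]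
  refine integral_mono_ae ((integrable_max_pow hΩ hv M g₁).sub (integrable_max_pow hΩ hv M g₂))
    ((integrable_extendZero_mul hΩ g₁ hi).sub (integrable_extendZero_mul hΩ g₂ hi)) ?_
  filter_upwards [hξ] with x hx
  refine (max_pow_three_sub_le M _ _).trans_eq ?_
  rw [hx]
  ring

lemma continuous_integral_max_pow (hΩ : IsOpen Ω) (hv : volume Ω ≠ ⊤) (M : ℝ) {B : ℝ}
    {Θ : ℝ → C(closure Ω, ℝ)} (hΘ : Continuous Θ) (hB : ∀ t, ‖Θ t‖ ≤ B) :
    Continuous fun t => ∫ x in Ω, max (M - extendZero (Θ t) x) 0 ^ 3 / 3 := by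
  have : IsFiniteMeasure (volume.restrict Ω) := ⟨by simpa using hv.lt_top⟩
  refine continuous_of_dominated (fun t => aestronglyMeasurable_max_pow hΩ M (Θ t))
    (fun t => Eventually.of_forall (abs_max_pow_le M (Θ t) (hB t))) (integrable_const _) ?_
  filter_upwards [ae_restrict_mem hΩ.measurableSet] with x hx
  have h1 : Continuous fun t => extendZero (Θ t) x := by
    simp_rw [extendZero_apply _ (subset_closure hx)]
    exact hΘ.eval_const _
  fun_prop

/-- A nonnegative integrand with nonpositive integral vanishes almost everywhere in `Ω`, hence by
continuity everywhere on the closure. -/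
lemma le_of_integral_max_pow_nonpos (hΩ : IsOpen Ω) (hv : volume Ω ≠ ⊤) {M : ℝ}
    {g : C(closure Ω, ℝ)} (h : ∫ x in Ω, max (M - extendZero g x) 0 ^ 3 / 3 ≤ 0) {x : E3}
    (hx : x ∈ closure Ω) : M ≤ extendZero g x := by
  have h0 : 0 ≤ᵐ[volume.restrict Ω] fun x => max (M - extendZero g x) 0 ^ 3 / 3 :=
    Eventually.of_forall fun x => div_nonneg (pow_nonneg (le_max_right _ _) 3) (by norm_num)
  have h1 := (integral_eq_zero_iff_of_nonneg_ae h0 (integrable_max_pow hΩ hv M g)).1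
    (le_antisymm h (integral_nonneg_of_ae h0))
  have hc : ContinuousOn (fun x => max (M - extendZero g x) 0 ^ 3 / 3) (closure Ω) :=
    (show Continuous fun s : ℝ => max (M - s) 0 ^ 3 / 3 by fun_prop).comp_continuousOn
      (continuousOn_extendZero g)
  have h2 := eqOn_closure_of_ae_eq hΩ hc continuousOn_const h1 hx
  have h3 : max (M - extendZero g x) 0 ^ 3 / 3 = 0 := h2
  have h4 : max (M - extendZero g x) 0 = 0 := by
    rwa [div_eq_zero_iff, or_iff_left (by norm_num), pow_eq_zero_iff (by norm_num)] at h3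
  have := le_max_left (M - extendZero g x) 0
  linarith

end

lemma memLp_const_mul_one_add_norm {α X : Type*} {_ : MeasurableSpace α} {μ : Measure α}
    [IsFiniteMeasure μ] [NormedAddCommGroup X] {p : ℝ≥0∞} {f : α → X} (C : ℝ) (hf : MemLp f p μ) :
    MemLp (fun t => C * (1 + ‖f t‖)) p μ :=
  ((memLp_const (1 : ℝ)).add hf.norm).const_mul C

/-! ### Time slices of the surrounding temperature. -/

section Slices

variable {q' : ℝ≥0∞} [Fact (1 ≤ q')] {D : Data q'}

lemma Data.ae_memLp_slice (hΩ : IsLipschitzDomain D.Ω) (hθl : MemLp D.θl ⊤ D.lateralMeasure) :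
    ∀ᵐ t ∂volume.restrict (Ioo D.T₀ D.T₁),
      MemLp (fun x => D.θl (x, t)) ⊤ (boundaryMeasure D.Ω) ∧
        ∀ᵐ x ∂boundaryMeasure D.Ω, essInf D.θl D.lateralMeasure ≤ D.θl (x, t) := by
  have hfin := isFiniteMeasure_boundaryMeasure hΩ
  have hswap : MeasurePreserving Prod.swap
      ((volume.restrict (Ioo D.T₀ D.T₁)).prod (boundaryMeasure D.Ω)) D.lateralMeasure :=
    Measure.measurePreserving_swap
  have hb : ∀ᵐ p ∂D.lateralMeasure, ‖D.θl p‖ ≤ (eLpNormEssSup D.θl D.lateralMeasure).toReal := by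
    have hne : eLpNormEssSup D.θl D.lateralMeasure ≠ ⊤ := by
      simpa [eLpNorm_exponent_top] using hθl.2.ne
    filter_upwards [ae_le_eLpNormEssSup (f := D.θl) (μ := D.lateralMeasure)] with p hp
    rw [← toReal_enorm]
    exact ENNReal.toReal_mono hne hp
  have hinf : ∀ᵐ p ∂D.lateralMeasure, essInf D.θl D.lateralMeasure ≤ D.θl p :=
    -- In `ℝ` the essential infimum is an almost everywhere lower bound only for functions
    -- essentially bounded below; the bound comes from the L^∞ norm.
    ae_essInf_le ⟨_, eventually_map.2 (hb.mono fun p hp => (abs_le.1 hp).1)⟩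
  have h1 := Measure.ae_ae_of_ae_prod (hswap.quasiMeasurePreserving.ae (hb.and hinf))
  have h2 := (hθl.1.comp_measurePreserving hswap).prodMk_left
  filter_upwards [h1, h2] with t ht1 ht2
  exact ⟨memLp_top_of_bound ht2 _ (ht1.mono fun x hx => hx.1), ht1.mono fun x hx => hx.2⟩

end Slices

section Minimum

lemma conj_le_self {q q' : ℝ≥0∞} [ENNReal.HolderConjugate q q'] (hq : 2 < q) : q' ≤ q := by
  by_contra! h
  have h1 := ENNReal.add_lt_add (ENNReal.inv_lt_inv.2 hq) (ENNReal.inv_lt_inv.2 (hq.trans h))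
  rw [ENNReal.HolderConjugate.inv_add_inv_eq_one, ENNReal.inv_two_add_inv_two] at h1
  exact lt_irrefl _ h1

variable {q q' r : ℝ≥0∞} [Fact (1 ≤ q)] [Fact (1 ≤ q')] [ENNReal.HolderConjugate q q']

/-- The minimum principle for a continuous representative of a solution. -/
theorem Data.IsLocalSolution.le_extendZero {D : Data q'} (hD : D.IsAdmissible q r) {Tb : ℝ}
    {θ : ℝ → W1 D.Ω q} {φ : ℝ → W1Zero D.Ω D.ΓD q} (hsol : D.IsLocalSolution r Tb θ φ)
    [CompactSpace (closure D.Ω)] {dθ w : ℝ → W1Dual D.Ω q'}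
    (hdθ : MemLp dθ r (volume.restrict (Ioo D.T₀ Tb)))
    (hpar : ∀ᵐ t ∂volume.restrict (Ioo D.T₀ Tb), D.ParabolicEq t (θ t) (dθ t) (φ t).1)
    (hw : ∀ s t, D.T₀ ≤ s → s ≤ t → t ≤ Tb → w t - w s = ∫ x in s..t, dθ x)
    {Θ : ℝ → C(closure D.Ω, ℝ)} (hΘ : ContinuousOn Θ (Icc D.T₀ Tb))
    (hΘw : ∀ t ∈ Icc D.T₀ Tb, ∀ ξ : W1 D.Ω q', w t ξ = ∫ x in D.Ω, extendZero (Θ t) x * fn ξ x)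
    (hΘθ : ∀ᵐ t ∂volume.restrict (Ioo D.T₀ Tb),
      fn (θ t) =ᵐ[volume.restrict D.Ω] extendZero (Θ t)) {M : ℝ}
    (hM : M ≤ essInf D.θl D.lateralMeasure)
    (hM₀ : ∀ x ∈ closure D.Ω, M ≤ extendZero (Θ D.T₀) x) {t : ℝ} (ht : t ∈ Icc D.T₀ Tb) {x : E3}
    (hx : x ∈ closure D.Ω) : M ≤ extendZero (Θ t) x := by
  have hΩ := hD.domain
  have hv := volume_ne_top hΩ
  have hqt : q ≠ ⊤ := (hD.lt_four.trans_le le_top).ne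
  have hrt := hD.r_lt_top.ne
  have hab := hsol.lt
  have hr2 : 2 ≤ r := by
    rw [← ENNReal.toReal_le_toReal (by simp) hrt]
    simpa using (two_lt_toReal_and_lt hD.three_lt hqt hD.critical_lt hrt).1.le
  have hr1 : 1 ≤ r := le_trans (by norm_num) hr2
  have hdi : IntegrableOn dθ (Ioo D.T₀ Tb) := hdθ.integrable hr1
  obtain ⟨B, hB⟩ := isCompact_Icc.exists_bound_of_continuousOn hΘ
  obtain ⟨C, hC0, hC⟩ := exists_test_function (q := q) (q' := q') hΩ
    (conj_le_self (lt_trans (by norm_num) hD.three_lt)) hqt M B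
  -- Constant extension beyond the end points, since the monotonicity theorem takes a function
  -- continuous on the whole line.
  set P : ℝ → C(closure D.Ω, ℝ) := IccExtend hab.le ((Icc D.T₀ Tb).domRestrict Θ) with hP
  have hPc : Continuous P := (continuousOn_iff_continuous_domRestrict.1 hΘ).Icc_extend'
  have hPB : ∀ t, ‖P t‖ ≤ B := fun t => hB _ (projIcc D.T₀ Tb hab.le t).2
  have hPΘ : ∀ t ∈ Icc D.T₀ Tb, P t = Θ t := fun t ht => IccExtend_of_mem _ _ ht
  set F : ℝ → ℝ := fun t => ∫ x in D.Ω, max (M - extendZero (P t) x) 0 ^ 3 / 3 with hF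
  have hFc : Continuous F := continuous_integral_max_pow hΩ.isOpen hv M hPc hPB
  have hF₀ : F D.T₀ = 0 := by
    refine integral_eq_zero_of_ae ?_
    filter_upwards [ae_restrict_mem hΩ.isOpen.measurableSet] with y hy
    rw [hPΘ _ (left_mem_Icc.2 hab.le), max_eq_right (sub_nonpos.2 (hM₀ y (subset_closure hy)))]
    simp
  have hz2 : MemLp dθ 2 (volume.restrict (Ioo D.T₀ Tb)) := hdθ.mono_exponent hr2
  -- The bound for the norm of the test function at time `t`. It is measurable in `t` by
  -- construction, whereas the test functions are chosen separately for each time.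
  set m : ℝ → ℝ≥0∞ := fun t => ENNReal.ofReal (C * (1 + ‖θ t‖)) with hm
  have hm2 : MemLp (fun t => C * (1 + ‖θ t‖)) 2 (volume.restrict (Ioo D.T₀ Tb)) :=
    memLp_const_mul_one_add_norm C (hsol.θ_memLp.mono_exponent hr2)
  have hmm : ∫⁻ t in Ioo D.T₀ Tb, m t ^ (2 : ℝ) ≠ ⊤ := by
    have h1 := lintegral_rpow_enorm_lt_top_of_eLpNorm_lt_top (by simp) (by simp) hm2.2
    refine ne_of_eq_of_ne (lintegral_congr fun t => ?_) h1.ne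
    rw [Real.enorm_eq_ofReal (by positivity), ENNReal.toReal_ofNat]
  have hkey : ∀ᵐ t ∂volume.restrict (Ioo D.T₀ Tb), ∀ t' ∈ Ico D.T₀ t,
      ENNReal.ofReal (F t - F t') ≤ m t * ∫⁻ s in Ioo t' t, ‖dθ s - dθ t‖ₑ := by
    have hsl := ae_mono (Measure.restrict_mono (Ioo_subset_Ioo_right hsol.le) le_rfl)
      (Data.ae_memLp_slice hΩ hD.θl_memLp)
    filter_upwards [hpar, hΘθ, hsl, ae_restrict_mem measurableSet_Ioo] with t h1 h2 h3 h4 t' ht'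
    have htI := Ioo_subset_Icc_self h4
    have ht'I : t' ∈ Icc D.T₀ Tb := ⟨ht'.1, (ht'.2.trans h4.2).le⟩
    obtain ⟨ξ, hξ, hξ', hξn⟩ := hC (θ t) (Θ t) (hB t htI) h2
    have hneg : dθ t ξ ≤ 0 := h1.apply_nonpos hΩ hD.η_cond hD.σ_cond hD.κ_elliptic hD.ε_elliptic
      hD.α_memLp hD.α_nonneg h3.1 (h3.2.mono fun y hy => hM.trans hy) (continuousOn_extendZero _)
      h2 hξ hξ'
    -- The test function stays frozen at the later time `t`, where convexity puts the tangent.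
    have hFle : F t - F t' ≤ (∫ s in t'..t, dθ s) ξ := by
      rw [← hw t' t ht'.1 ht'.2.le h4.2.le, sub_apply, hΘw t htI,
        hΘw t' ht'I, hF]
      simp only [hPΘ t htI, hPΘ t' ht'I]
      exact integral_max_pow_sub_le hΩ.isOpen hv (Θ t) (Θ t') hξ
    have hsub : Ioo t' t ⊆ Ioo D.T₀ Tb := Ioo_subset_Ioo ht'.1 h4.2.le
    have hii : IntervalIntegrable dθ volume t' t :=
      (intervalIntegrable_iff_integrableOn_Ioo_of_le ht'.2.le).2 (hdi.mono_set hsub)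
    refine (ENNReal.ofReal_le_ofReal hFle).trans
      ((ofReal_intervalIntegral_apply_le ht'.2.le hii hneg).trans ?_)
    exact mul_le_mul_left (ENNReal.ofReal_le_ofReal hξn) _
  have hfin := le_of_forall_ofReal_sub_le hFc hz2 hm2.1.aemeasurable.ennreal_ofReal hmm hkey ht
  rw [hF₀] at hfin
  rw [← hPΘ t ht]
  exact le_of_integral_max_pow_nonpos hΩ.isOpen hv hfin hx

end Minimum

end Thermistor

theorem proposition4p9 (q q' r : ENNReal) [Fact (1 ≤ q)] [Fact (1 ≤ q')]
    [ENNReal.HolderConjugate q q'] (D : Thermistor.Data q') (hD : D.IsAdmissible q r)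
    (Tb : ℝ) (θ : ℝ → Thermistor.W1 D.Ω q) (φ : ℝ → Thermistor.W1Zero D.Ω D.ΓD q)
    (hsol : D.IsLocalSolution r Tb θ φ) :
    ∃ (f₀ : Thermistor.E3 → ℝ) (Θ : Thermistor.E3 × ℝ → ℝ),
      D.IsContinuousInitialValue f₀ ∧ D.IsContinuousRep Tb θ Θ ∧
      (∀ x ∈ closure D.Ω, Θ (x, D.T₀) = f₀ x) ∧
      ∀ x ∈ closure D.Ω, ∀ t ∈ Set.Icc D.T₀ Tb,
        min (essInf D.θl D.lateralMeasure) (sInf (f₀ '' closure D.Ω)) ≤ Θ (x, t) := by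
  have hΩ := hD.domain
  have hcpt : CompactSpace (closure D.Ω) :=
    isCompact_iff_compactSpace.1 (Thermistor.isCompact_closure hΩ)
  have hqt : q ≠ ⊤ := (hD.lt_four.trans_le le_top).ne
  have hrt := hD.r_lt_top.ne
  have hr1 : 1 ≤ r := by
    rw [← ENNReal.toReal_le_toReal (by simp) hrt, ENNReal.toReal_one]
    linarith [(Thermistor.two_lt_toReal_and_lt hD.three_lt hqt hD.critical_lt hrt).1]
  obtain ⟨dθ, hdθ, hweak, hpar⟩ := hsol.parabolic
  obtain ⟨w, hwc, hwθ, hw₀⟩ := hsol.initial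
  obtain ⟨Θ, hΘc, hΘw, hΘθ⟩ := Thermistor.exists_continuous_representative hΩ hD.three_lt hqt
    hD.critical_lt hrt hsol.lt hsol.θ_memLp hdθ hweak hwc hwθ
  -- The initial value is the time slice of the representative itself, so agreement at `D.T₀` is
  -- definitional; that it stands for `D.θ₀` follows from `w D.T₀ = D.θ₀`.
  refine ⟨Thermistor.extendZero (Θ D.T₀), fun p => Thermistor.extendZero (Θ p.2) p.1,
    ⟨Thermistor.continuousOn_extendZero _, fun ξ => ?_⟩,
    ⟨Thermistor.continuousOn_extendZero_apply hΘc, hΘθ⟩, fun _ _ => rfl, fun x hx t ht => ?_⟩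
  · rw [← hw₀, hΘw _ (left_mem_Icc.2 hsol.lt.le)]
  -- The infimum over the compact closure is a genuine lower bound only because the image is bounded
  -- below.
  · have hbdd : BddBelow (Thermistor.extendZero (Θ D.T₀) '' closure D.Ω) :=
      ((Thermistor.isCompact_closure hΩ).image_of_continuousOn
        (Thermistor.continuousOn_extendZero _)).bddBelow
    exact hsol.le_extendZero hD hdθ hpar
      (fun s t h1 h2 h3 => hweak.sub_eq_integral hwc hwθ (hdθ.integrable hr1) h1 h2 h3) hΘc hΘw hΘθ
      (min_le_left _ _)
      (fun y hy => (min_le_right _ _).trans (csInf_le hbdd (mem_image_of_mem _ hy))) ht hx
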